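/- **Setting.** Let $\omega>0$, $\mu>0$, $\lambda+\mu>0$, $\Lambda>0$, $\theta\in(-\pi/2,\pi/2)$, and put $\kappa_1=\omega/\sqrt{\lambda+2\mu}$, $\kappa_2=\omega/\sqrt\mu$, $\alpha=\kappa_1\sin\theta$, $\alpha_n=\alpha+2\pi n/\Lambda$ for $n\in\mathbb Z$. Assume $\kappa_j\ne|\alpha_n|$ for $j=1,2$ and all $n$. Let $\beta_j^{(n)}=(\kappa_j^2-\alpha_n^2)^{1/2}$ if $|\alpha_n|<\kappa_j$ and $\beta_j^{(n)}={\rm i}(\alpha_n^2-\kappa_j^2)^{1/2}$ if $|\alpha_n|>\kappa_j$, $\Delta_j^{(n)}=|\kappa_j^2-\alpha_n^2|^{1/2}$, $\chi^{(n)}=\alpha_n^2+\beta_1^{(n)}\beta_2^{(n)}$, and $$M^{(n)}=\frac{\rm i}{\chi^{(n)}}\begin{bmatrix}\omega^2\beta_1^{(n)}&\mu\alpha_n\chi^{(n)}-\omega^2\alpha_n\\ \omega^2\alpha_n-\mu\alpha_n\chi^{(n)}&\omega^2\beta_2^{(n)}\end{bmatrix}.$$ Let $S$ be a Lipschitz surface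 that is $\Lambda$-periodic in $x$, bounded from below and lying strictly below the line $y=b$ (it is the boundary of a connected open region $W$ above it, which near each boundary point is the epigraph of a Lipschitz function in rotated coordinates). Let $\Gamma=(0,\Lambda)\times\{b\}$, $\Omega=\{(x,y)\in W:0<x<\Lambda,\ y<b\}$, $a=\min\{y:(x,y)\in S\}$ and $\gamma_2=(1+(b-a)^{-1})^{1/2}$. Let $V=H^1_{S,\rm qp}(\Omega)^2$, where $H^1_{S,\rm qp}(\Omega)=\{u\in H^1(\Omega): u(\Lambda,y)=e^{{\rm i}\alpha\Lambda}u(0,y),\ u=0\text{ on }S\}$. For functions on $\Gamma$ let $u^{(n)}=\Lambda^{-1}\int_0^\Lambda u(x)e^{-{\rm i}\alpha_nx}\,dx$, and let $\langle\cdot,\cdot\rangle_\Gamma$ be the $L^2(\Gamma)^2$ pairing (linear in the first argument, conjugate-linear in the second). Let $\mathscr T u=\sum_nM^{(n)}u^{(n)}e^{{\rm i}\alpha_nx}$, so that $\langle\mathscr Tu,v\rangle_\Gamma=\Lambda\sum_n (M^{(n)}u^{(n)})\cdot\overline{v^{(n)}}$. Let $u_{\rm inc}=[\sin\theta,-\cos\theta]^\top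 e^{{\rm i}\kappa_1(x\sin\theta-y\cos\theta)}$, $\mathscr Dw=[\mu\partial_yw_1,\ (\lambda+\mu)\partial_xw_1+(\lambda+2\mu)\partial_yw_2]^\top$, and $f=\mathscr Du_{\rm inc}-\mathscr Tu_{\rm inc}$ on $\Gamma$. For $u,v\in V$ let $$a(u,v)=\mu\int_\Omega\nabla u:\nabla\bar v+(\lambda+\mu)\int_\Omega(\nabla\cdot u)(\nabla\cdot\bar v)-\omega^2\int_\Omega u\cdot\bar v-\langle\mathscr Tu,v\rangle_\Gamma .$$ The original variational problem is: find $u\in V$ with $a(u,v)=\langle f,v\rangle_\Gamma$ for all $v\in V$. The inf-sup condition with constant $\gamma_1>0$ is $$\sup_{0\ne v\in V}\frac{|a(u,v)|}{\|v\|_{H^1(\Omega)^2}}\ge\gamma_1\|u\|_{H^1(\Omega)^2}\qquad\text{for all }u\in V .$$ **PML.** Let $\rho:\mathbb R\to\mathbb C$ be continuous with $\rho=1$ on $(-\infty,b]$ and $\operatorname{Re}\rho\ge1$, $\operatorname{Im}\rho>0$ on $(b,\infty)$. Let $\delta>0$ and $\zeta=\int_b^{b+\delta}\rho(\tau)\,d\tau$,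 and assume $\operatorname{Re}\zeta\ge1$. Put $$\varepsilon_1^{(n)}=\coth(-{\rm i}\beta_1^{(n)}\zeta)-1,\quad \delta_j^{(n)}=\frac{e^{{\rm i}\beta_2^{(n)}\zeta}-e^{{\rm i}\beta_1^{(n)}\zeta}}{e^{-{\rm i}\beta_j^{(n)}\zeta}-e^{{\rm i}\beta_j^{(n)}\zeta}},\quad \eta^{(n)}=\frac{e^{-{\rm i}\beta_1^{(n)}\zeta}-e^{{\rm i}\beta_1^{(n)}\zeta}}{e^{-{\rm i}\beta_2^{(n)}\zeta}-e^{{\rm i}\beta_2^{(n)}\zeta}},$$ $$\hat\chi^{(n)}=\chi^{(n)}+4(\delta_2^{(n)}-\delta_1^{(n)}-\delta_1^{(n)}\delta_2^{(n)})\alpha_n^2\beta_1^{(n)}\beta_2^{(n)}/\chi^{(n)},$$ and let $\hat M^{(n)}$ be the matrix with entries (superscripts $(n)$ omitted) $$\begin{aligned}\hat m_{11}&=\tfrac{{\rm i}\omega^2\beta_1}{\hat\chi}+\tfrac{{\rm i}\omega^2\beta_1}{\chi\hat\chi}\bigl[\varepsilon_1\alpha_n^2+(\varepsilon_1\eta+2\delta_2)\beta_1\beta_2\bigr],\\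 \hat m_{12}&={\rm i}\mu\alpha_n-\tfrac{{\rm i}\omega^2\alpha_n}{\hat\chi}-\tfrac{{\rm i}\omega^2\alpha_n\beta_1\beta_2}{\chi\hat\chi}\bigl[\varepsilon_1(1+2\delta_2-\eta)+2\delta_2\bigr],\\ \hat m_{21}&=-{\rm i}\mu\alpha_n+\tfrac{{\rm i}\omega^2\alpha_n}{\hat\chi}-\tfrac{{\rm i}\omega^2\alpha_n\beta_1\beta_2}{\chi\hat\chi}\bigl[\varepsilon_1(1+2\delta_2-\eta)+2(2\delta_1+2\delta_1\delta_2-\delta_2)\bigr],\\ \hat m_{22}&=\tfrac{{\rm i}\omega^2\beta_2}{\hat\chi}+\tfrac{{\rm i}\omega^2\beta_2}{\chi\hat\chi}\bigl[\varepsilon_1\beta_1\beta_2+(\varepsilon_1\eta+2\delta_2)\alpha_n^2\bigr].\end{aligned}$$ Let $\mathscr T^{\rm PML}$, $a^{\rm PML}$ and $f^{\rm PML}$ be defined as $\mathscr T$, $a$ and $f$, with $\hat M^{(n)}$ in place of $M^{(n)}$. The truncated PML variational problem is: find $u^{\rm PML}\in V$ with $a^{\rm PML}(u^{\rm PML},v)=\langle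 f^{\rm PML},v\rangle_\Gamma$ for all $v\in V$. Finally let $\Delta_j^-=\min\{\Delta_j^{(n)}:|\alpha_n|<\kappa_j\}$, $\Delta_j^+=\min\{\Delta_j^{(n)}:|\alpha_n|>\kappa_j\}$, $$F=\max_{j=1,2}\Bigl(\tfrac{\Delta_j^-}{e^{\frac12\Delta_j^-\operatorname{Im}\zeta}-1},\tfrac{\Delta_j^+}{e^{\frac12\Delta_j^+\operatorname{Re}\zeta}-1}\Bigr)\max\Bigl\{12\kappa_2,\,16\kappa_2^4,\,8+2\kappa_2^2,\,\tfrac{16\kappa_2^3}{\kappa_1^2},\,\tfrac{24(16+\kappa_2^2)^2}{\kappa_1^2}\Bigr\},\qquad \hat F=\frac{17\omega^2F}{\kappa_1^4}.$$ **Theorem.** (i) $\hat F$, as a function of $\zeta$, decays exponentially: there are $C,c>0$ depending only on $\omega,\lambda,\mu,\Lambda,\theta$ such that $0<\hat F\le C\bigl(e^{-c\operatorname{Re}\zeta}+e^{-c\operatorname{Im}\zeta}\bigr)$ whenever $\operatorname{Re}\zeta\ge1$ and $\operatorname{Im}\zeta\ge1$. (ii) Suppose that the inf-sup condition holds with the constant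 $\gamma_1>0$ and that $\hat F\gamma_2^2<\gamma_1$. Then the truncated PML variational problem has a unique solution $u^{\rm PML}\in V$, and if $u\in V$ is the solution of the original variational problem (unique by the inf-sup condition), then $$\|u-u^{\rm PML}\|_\Omega:=\sup_{0\ne v\in V}\frac{|a(u-u^{\rm PML},v)|}{\|v\|_{H^1(\Omega)^2}}\le\hat F\gamma_2\,\|u^{\rm PML}-u_{\rm inc}\|_{L^2(\Gamma)^2}.$$ -/

import Mathlib

open MeasureTheory Set
open scoped ContDiff ENNReal ComplexConjugate

noncomputable section

namespace ElasticPML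

/-! ## Medium, incident wave and Fourier symbols -/

/-- Frequency, Lamé constants, period and incident angle. -/
structure WaveData where
  /-- the angular frequency `ω` -/
  freq : ℝ
  lam : ℝ
  mu : ℝ
  /-- the period -/
  Lam : ℝ
  /-- the incident angle -/
  θ : ℝ
  freq_pos : 0 < freq
  mu_pos : 0 < mu
  lam_add_mu_pos : 0 < lam + mu
  Lam_pos : 0 < Lam
  θ_mem : θ ∈ Ioo (-(Real.pi / 2)) (Real.pi / 2)

namespace WaveData

variable (d : WaveData)

/-- Compressional wavenumber. -/
def kappa1 : ℝ := d.freq / √(d.lam + 2 * d.mu)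

/-- Shear wavenumber. -/
def kappa2 : ℝ := d.freq / √d.mu

/-- Quasi-periodicity parameter. -/
def alpha : ℝ := d.kappa1 * Real.sin d.θ

def alphaN (n : ℤ) : ℝ := d.alpha + n * (2 * Real.pi / d.Lam)

/-- `β_j^{(n)}` for the wavenumber `k = κ_j`. -/
def beta (k : ℝ) (n : ℤ) : ℂ :=
  if |d.alphaN n| < k then ((√(k ^ 2 - d.alphaN n ^ 2) : ℝ) : ℂ)
  else Complex.I * ((√(d.alphaN n ^ 2 - k ^ 2) : ℝ) : ℂ)

def beta1 (n : ℤ) : ℂ := d.beta d.kappa1 n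

def beta2 (n : ℤ) : ℂ := d.beta d.kappa2 n

def chi (n : ℤ) : ℂ := (d.alphaN n : ℂ) ^ 2 + d.beta1 n * d.beta2 n

/-- Symbol `M^{(n)}` of the exact transparent boundary operator. -/
def M (n : ℤ) : Matrix (Fin 2) (Fin 2) ℂ :=
  (Complex.I / d.chi n) •
    !![(d.freq : ℂ) ^ 2 * d.beta1 n,
        d.mu * d.alphaN n * d.chi n - (d.freq : ℂ) ^ 2 * d.alphaN n;
       (d.freq : ℂ) ^ 2 * d.alphaN n - d.mu * d.alphaN n * d.chi n,
        (d.freq : ℂ) ^ 2 * d.beta2 n]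

/-- Hyperbolic cotangent. -/
def coth (t : ℂ) : ℂ :=
  (Complex.exp t + Complex.exp (-t)) / (Complex.exp t - Complex.exp (-t))

/-- `ε_1^{(n)}`; here and below `z` stands for the PML parameter `ζ`. -/
def eps1 (z : ℂ) (n : ℤ) : ℂ := coth (-(Complex.I * d.beta1 n * z)) - 1

/-- `δ_j^{(n)}` for `β = β_j^{(n)}`. -/
def del (z : ℂ) (n : ℤ) (β : ℂ) : ℂ :=
  (Complex.exp (Complex.I * d.beta2 n * z) - Complex.exp (Complex.I * d.beta1 n * z)) /
    (Complex.exp (-(Complex.I * β * z)) - Complex.exp (Complex.I * β * z))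

def del1 (z : ℂ) (n : ℤ) : ℂ := d.del z n (d.beta1 n)

def del2 (z : ℂ) (n : ℤ) : ℂ := d.del z n (d.beta2 n)

def eta (z : ℂ) (n : ℤ) : ℂ :=
  (Complex.exp (-(Complex.I * d.beta1 n * z)) - Complex.exp (Complex.I * d.beta1 n * z)) /
    (Complex.exp (-(Complex.I * d.beta2 n * z)) - Complex.exp (Complex.I * d.beta2 n * z))

def chiHat (z : ℂ) (n : ℤ) : ℂ :=
  d.chi n + 4 * (d.del2 z n - d.del1 z n - d.del1 z n * d.del2 z n) *
    (d.alphaN n : ℂ) ^ 2 * d.beta1 n * d.beta2 n / d.chi n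

/-- Symbol of the transparent boundary operator of the truncated PML problem. -/
def MHat (z : ℂ) (n : ℤ) : Matrix (Fin 2) (Fin 2) ℂ :=
  !![Complex.I * d.freq ^ 2 * d.beta1 n / d.chiHat z n +
        Complex.I * d.freq ^ 2 * d.beta1 n / (d.chi n * d.chiHat z n) *
          (d.eps1 z n * d.alphaN n ^ 2 +
            (d.eps1 z n * d.eta z n + 2 * d.del2 z n) * d.beta1 n * d.beta2 n),
      Complex.I * d.mu * d.alphaN n - Complex.I * d.freq ^ 2 * d.alphaN n / d.chiHat z n -
        Complex.I * d.freq ^ 2 * d.alphaN n * d.beta1 n * d.beta2 n / (d.chi n * d.chiHat z n) *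
          (d.eps1 z n * (1 + 2 * d.del2 z n - d.eta z n) + 2 * d.del2 z n);
     -(Complex.I * d.mu * d.alphaN n) + Complex.I * d.freq ^ 2 * d.alphaN n / d.chiHat z n -
        Complex.I * d.freq ^ 2 * d.alphaN n * d.beta1 n * d.beta2 n / (d.chi n * d.chiHat z n) *
          (d.eps1 z n * (1 + 2 * d.del2 z n - d.eta z n) +
            2 * (2 * d.del1 z n + 2 * d.del1 z n * d.del2 z n - d.del2 z n)),
      Complex.I * d.freq ^ 2 * d.beta2 n / d.chiHat z n +
        Complex.I * d.freq ^ 2 * d.beta2 n / (d.chi n * d.chiHat z n) *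
          (d.eps1 z n * d.beta1 n * d.beta2 n +
            (d.eps1 z n * d.eta z n + 2 * d.del2 z n) * d.alphaN n ^ 2)]

/-- `Δ_j^{(n)}` for `k = κ_j`. -/
def Delta (k : ℝ) (n : ℤ) : ℝ := √|k ^ 2 - d.alphaN n ^ 2|

/-- Minimum of `Δ_j^{(n)}` over the propagating modes. -/
def DeltaMinus (k : ℝ) : ℝ := sInf (d.Delta k '' {n | |d.alphaN n| < k})

/-- Minimum of `Δ_j^{(n)}` over the evanescent modes. -/
def DeltaPlus (k : ℝ) : ℝ := sInf (d.Delta k '' {n | ¬ |d.alphaN n| < k})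

/-- The two terms of the first maximum in `F` that belong to the wavenumber `k = κ_j`. -/
def decay (z : ℂ) (k : ℝ) : ℝ :=
  max (d.DeltaMinus k / (Real.exp (1 / 2 * d.DeltaMinus k * z.im) - 1))
    (d.DeltaPlus k / (Real.exp (1 / 2 * d.DeltaPlus k * z.re) - 1))

def F (z : ℂ) : ℝ :=
  max (d.decay z d.kappa1) (d.decay z d.kappa2) *
    max (12 * d.kappa2) (max (16 * d.kappa2 ^ 4) (max (8 + 2 * d.kappa2 ^ 2)
      (max (16 * d.kappa2 ^ 3 / d.kappa1 ^ 2)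
        (24 * (16 + d.kappa2 ^ 2) ^ 2 / d.kappa1 ^ 2))))

def FHat (z : ℂ) : ℝ := 17 * d.freq ^ 2 * d.F z / d.kappa1 ^ 4

/-- No resonance: `κ_j ≠ |α_n|` for `j = 1, 2` and all `n`. -/
def NonResonant : Prop := ∀ n : ℤ, d.kappa1 ≠ |d.alphaN n| ∧ d.kappa2 ≠ |d.alphaN n|

/-- The compressional incident plane wave. -/
def uInc (i : Fin 2) (x y : ℝ) : ℂ :=
  ![(Real.sin d.θ : ℂ), -(Real.cos d.θ : ℂ)] i *
    Complex.exp (Complex.I * d.kappa1 * (x * Real.sin d.θ - y * Real.cos d.θ))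

/-- The boundary differential operator
`𝒟 w = (μ ∂_y w₁, (λ+μ) ∂_x w₁ + (λ+2μ) ∂_y w₂)`. -/
def boundaryD (w : Fin 2 → ℝ → ℝ → ℂ) (x y : ℝ) : Fin 2 → ℂ :=
  ![d.mu * deriv (fun t => w 0 x t) y,
    (d.lam + d.mu) * deriv (fun s => w 0 s y) x +
      (d.lam + 2 * d.mu) * deriv (fun t => w 1 x t) y]

/-- Fourier coefficient `g^{(n)}` of a quasi-periodic function given on `(0, Λ)`. -/
def coeff (g : ℝ → ℂ) (n : ℤ) : ℂ :=
  1 / (d.Lam : ℂ) * ∫ x in Ioo 0 d.Lam, g x * Complex.exp (-(Complex.I * d.alphaN n * x))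

/-- The duality pairing `⟨T g, h⟩_Γ` for the operator `T g = ∑ₙ A^{(n)} g^{(n)} e^{i αₙ x}`. -/
def symbolPair (A : ℤ → Matrix (Fin 2) (Fin 2) ℂ) (g h : Fin 2 → ℝ → ℂ) : ℂ :=
  (d.Lam : ℂ) * ∑' n : ℤ, ∑ i : Fin 2,
    (A n).mulVec (fun j => d.coeff (g j) n) i * conj (d.coeff (h i) n)

/-- The inner product of `L²(Γ)²`. -/
def l2Pair (g h : Fin 2 → ℝ → ℂ) : ℂ :=
  ∫ x in Ioo 0 d.Lam, ∑ i : Fin 2, g i x * conj (h i x)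

/-- The norm of `L²(Γ)²`. -/
def l2Norm (g : Fin 2 → ℝ → ℂ) : ℝ :=
  √(∫ x in Ioo 0 d.Lam, ∑ i : Fin 2, ‖g i x‖ ^ 2)

end WaveData

/-! ## Geometry -/

/-- A periodic Lipschitz grating surface `S`, given as the boundary of the open region `W` above
it, together with the height `b` of the artificial boundary `Γ`, which lies strictly above `S`. -/
structure Grating (Lam : ℝ) where
  b : ℝ
  /-- the region above the grating surface -/
  W : Set (ℝ × ℝ)
  isOpen : IsOpen W
  isConnected : IsConnected W
  periodic : ∀ x y : ℝ, (x + Lam, y) ∈ W ↔ (x, y) ∈ W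
  above : ∃ c, c < b ∧ ∀ x y : ℝ, c < y → (x, y) ∈ W
  below : ∃ c, ∀ p ∈ W, c < p.2
  /-- near each boundary point, `W` is the strict epigraph of a Lipschitz function in suitably
  rotated coordinates -/
  lipschitz : ∀ p ∈ frontier W, ∃ (φ r : ℝ) (K : NNReal) (h : ℝ → ℝ), 0 < r ∧ LipschitzWith K h ∧
    ∀ q : ℝ × ℝ, dist q p < r →
      (q ∈ W ↔
        h (Real.cos φ * (q.1 - p.1) + Real.sin φ * (q.2 - p.2)) <
          -Real.sin φ * (q.1 - p.1) + Real.cos φ * (q.2 - p.2))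

namespace Grating

variable {Lam : ℝ} (G : Grating Lam)

/-- The surface. -/
def S : Set (ℝ × ℝ) := frontier G.W

/-- One period of the region between `S` and `Γ`. -/
def Ω : Set (ℝ × ℝ) := {p | p ∈ G.W ∧ 0 < p.1 ∧ p.1 < Lam ∧ p.2 < G.b}

/-- The lowest height `a` of the surface. -/
def a : ℝ := sInf (Prod.snd '' G.S)

/-- The trace constant `γ₂ = (1 + (b - a)⁻¹)^{1/2}`. -/
def gamma2 : ℝ := √(1 + (G.b - G.a)⁻¹)

theorem measurableSet_Ω : MeasurableSet G.Ω :=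
  (G.isOpen.inter ((isOpen_lt continuous_const continuous_fst).inter
    ((isOpen_lt continuous_fst continuous_const).inter
      (isOpen_lt continuous_snd continuous_const)))).measurableSet

theorem exists_isCompact : ∃ K : Set (ℝ × ℝ), IsCompact K ∧ G.Ω ⊆ K := by
  obtain ⟨c, hc⟩ := G.below
  refine ⟨Icc 0 Lam ×ˢ Icc c G.b, isCompact_Icc.prod isCompact_Icc, ?_⟩
  rintro p ⟨hW, h0, h1, h2⟩
  exact ⟨⟨h0.le, h1.le⟩, ⟨(hc p hW).le, h2.le⟩⟩

instance : IsFiniteMeasure (volume.restrict G.Ω) := by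
  obtain ⟨K, hK, hΩ⟩ := G.exists_isCompact
  exact ⟨by simpa using (measure_mono hΩ).trans_lt hK.measure_lt_top⟩

end Grating

/-! ## The space `H¹_{S,qp}(Ω)` -/

section Space

variable (d : WaveData) (G : Grating d.Lam)

/-- `L²(Ω)`. -/
abbrev L2Ω := Lp ℂ 2 (volume.restrict G.Ω)

/-- `L²(Γ)`. -/
abbrev L2Γ := Lp ℂ 2 (volume.restrict (Ioo 0 d.Lam))

variable {d} in
/-- `p` and `q` are the weak partial derivatives of `u` in `Ω`. -/
def IsWeakGradient (u p q : L2Ω d G) : Prop :=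
  ∀ φ : ℝ × ℝ → ℂ, ContDiff ℝ ∞ φ → HasCompactSupport φ → tsupport φ ⊆ G.Ω →
    (∫ z in G.Ω, u z * fderiv ℝ φ z (1, 0)) + (∫ z in G.Ω, p z * φ z) = 0 ∧
    (∫ z in G.Ω, u z * fderiv ℝ φ z (0, 1)) + (∫ z in G.Ω, q z * φ z) = 0

/-- The boundary values of `u` with gradient `(p, q)`, expressed by Green's formula: `u = 0` on `S`,
`u(Λ, y) = e^{iαΛ} u(0, y)` on the vertical sides, and `u = g` on `Γ`.
The test functions are the smooth `φ` with `φ(x + Λ, y) = e^{-iαΛ} φ(x, y)`. For such `φ` Green's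
formula reads `∫_Ω (u ∂_j φ + ∂_j u φ) = ∫_{∂Ω} u φ ν_j`; the two conditions say that, of the
boundary integral, only the part `∫_Γ g φ` (for `j = 2`) is left. As `φ` is otherwise arbitrary, the
trace of `u` vanishes on `S`, the contributions of the two vertical sides cancel, and the trace on
`Γ` is `g`. -/
def HasBoundaryValues (u p q : L2Ω d G) (g : L2Γ d) : Prop :=
  ∀ φ : ℝ × ℝ → ℂ, ContDiff ℝ ∞ φ →
    (∀ x y : ℝ, φ (x + d.Lam, y) =
      Complex.exp (-(Complex.I * d.alpha * d.Lam)) * φ (x, y)) →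
    (∫ z in G.Ω, u z * fderiv ℝ φ z (1, 0)) + (∫ z in G.Ω, p z * φ z) = 0 ∧
    (∫ z in G.Ω, u z * fderiv ℝ φ z (0, 1)) + (∫ z in G.Ω, q z * φ z) =
      ∫ x in Ioo 0 d.Lam, g x * φ (x, G.b)

theorem integrable_mul {u : L2Ω d G} {ψ : ℝ × ℝ → ℂ} (hψ : Continuous ψ) :
    Integrable (fun z => u z * ψ z) (volume.restrict G.Ω) := by
  obtain ⟨K, hK, hΩ⟩ := G.exists_isCompact
  have hu : IntegrableOn (fun z => u z) G.Ω := (Lp.memLp u).integrable (by norm_num)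
  exact hu.mul_continuousOn_of_subset hψ.continuousOn G.measurableSet_Ω hK hΩ

theorem integral_add_mul (u v : L2Ω d G) {ψ : ℝ × ℝ → ℂ} (hψ : Continuous ψ) :
    ∫ z in G.Ω, (u + v : L2Ω d G) z * ψ z =
      (∫ z in G.Ω, u z * ψ z) + ∫ z in G.Ω, v z * ψ z := by
  rw [← integral_add (integrable_mul d G hψ) (integrable_mul d G hψ)]
  refine integral_congr_ae ?_
  filter_upwards [Lp.coeFn_add u v] with z hz
  rw [hz, Pi.add_apply, add_mul]

theorem integral_smul_mul (c : ℂ) (u : L2Ω d G) (ψ : ℝ × ℝ → ℂ) :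
    ∫ z in G.Ω, (c • u : L2Ω d G) z * ψ z = c * ∫ z in G.Ω, u z * ψ z := by
  rw [← integral_const_mul]
  refine integral_congr_ae ?_
  filter_upwards [Lp.coeFn_smul c u] with z hz
  rw [hz, Pi.smul_apply, smul_eq_mul, mul_assoc]

theorem integral_zero_mul (ψ : ℝ × ℝ → ℂ) :
    ∫ z in G.Ω, (0 : L2Ω d G) z * ψ z = 0 := by
  simpa using integral_smul_mul d G 0 (0 : L2Ω d G) ψ

theorem integrable_mul_Γ {g : L2Γ d} {ψ : ℝ → ℂ} (hψ : Continuous ψ) :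
    Integrable (fun x => g x * ψ x) (volume.restrict (Ioo 0 d.Lam)) := by
  have hu : IntegrableOn (fun x => g x) (Ioo 0 d.Lam) := (Lp.memLp g).integrable (by norm_num)
  exact hu.mul_continuousOn_of_subset hψ.continuousOn measurableSet_Ioo
    (isCompact_Icc (a := 0) (b := d.Lam)) Ioo_subset_Icc_self

theorem integral_add_mul_Γ (g h : L2Γ d) {ψ : ℝ → ℂ} (hψ : Continuous ψ) :
    ∫ x in Ioo 0 d.Lam, (g + h : L2Γ d) x * ψ x =
      (∫ x in Ioo 0 d.Lam, g x * ψ x) + ∫ x in Ioo 0 d.Lam, h x * ψ x := by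
  rw [← integral_add (integrable_mul_Γ d hψ) (integrable_mul_Γ d hψ)]
  refine integral_congr_ae ?_
  filter_upwards [Lp.coeFn_add g h] with z hz
  rw [hz, Pi.add_apply, add_mul]

theorem integral_smul_mul_Γ (c : ℂ) (g : L2Γ d) (ψ : ℝ → ℂ) :
    ∫ x in Ioo 0 d.Lam, (c • g : L2Γ d) x * ψ x = c * ∫ x in Ioo 0 d.Lam, g x * ψ x := by
  rw [← integral_const_mul]
  refine integral_congr_ae ?_
  filter_upwards [Lp.coeFn_smul c g] with z hz
  rw [hz, Pi.smul_apply, smul_eq_mul, mul_assoc]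

theorem integral_zero_mul_Γ (ψ : ℝ → ℂ) :
    ∫ x in Ioo 0 d.Lam, (0 : L2Γ d) x * ψ x = 0 := by
  simpa using integral_smul_mul_Γ d 0 (0 : L2Γ d) ψ

theorem continuous_partial {φ : ℝ × ℝ → ℂ} (hφ : ContDiff ℝ ∞ φ) (e : ℝ × ℝ) :
    Continuous fun z => fderiv ℝ φ z e :=
  (hφ.continuous_fderiv (by simp)).clm_apply continuous_const

/-- The space `H¹_{S,qp}(Ω)`. An element is recorded as `(u, ∂_x u, ∂_y u, u|_Γ)`; the last three
entries are determined by `u`. -/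
def H1Sqp : Submodule ℂ (L2Ω d G × L2Ω d G × L2Ω d G × L2Γ d) where
  carrier := {w | IsWeakGradient G w.1 w.2.1 w.2.2.1 ∧
    HasBoundaryValues d G w.1 w.2.1 w.2.2.1 w.2.2.2}
  zero_mem' := by
    refine ⟨fun φ _ _ _ => ?_, fun φ _ _ => ?_⟩
    · simp only [Prod.fst_zero, Prod.snd_zero, integral_zero_mul, add_zero, and_self]
    · simp only [Prod.fst_zero, Prod.snd_zero, integral_zero_mul, add_zero, true_and]
      exact (integral_zero_mul_Γ d fun x => φ (x, G.b)).symm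
  add_mem' := by
    rintro w w' ⟨h1, h2⟩ ⟨h1', h2'⟩
    refine ⟨fun φ hφ hc hs => ?_, fun φ hφ hq => ?_⟩
    · have hx := continuous_partial hφ (1, 0)
      have hy := continuous_partial hφ (0, 1)
      obtain ⟨a1, a2⟩ := h1 φ hφ hc hs
      obtain ⟨b1, b2⟩ := h1' φ hφ hc hs
      simp only [Prod.fst_add, Prod.snd_add, integral_add_mul d G _ _ hx,
        integral_add_mul d G _ _ hy, integral_add_mul d G _ _ hφ.continuous]
      exact ⟨by linear_combination a1 + b1, by linear_combination a2 + b2⟩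
    · have hx := continuous_partial hφ (1, 0)
      have hy := continuous_partial hφ (0, 1)
      have hg : Continuous fun x : ℝ => φ (x, G.b) := hφ.continuous.comp (by fun_prop)
      obtain ⟨a1, a2⟩ := h2 φ hφ hq
      obtain ⟨b1, b2⟩ := h2' φ hφ hq
      simp only [Prod.fst_add, Prod.snd_add, integral_add_mul d G _ _ hx,
        integral_add_mul d G _ _ hy, integral_add_mul d G _ _ hφ.continuous]
      refine ⟨by linear_combination a1 + b1, ?_⟩
      rw [integral_add_mul_Γ d _ _ hg]
      linear_combination a2 + b2
  smul_mem' := by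
    rintro c w ⟨h1, h2⟩
    refine ⟨fun φ hφ hc hs => ?_, fun φ hφ hq => ?_⟩
    · obtain ⟨a1, a2⟩ := h1 φ hφ hc hs
      simp only [Prod.smul_fst, Prod.smul_snd, integral_smul_mul]
      exact ⟨by linear_combination c * a1, by linear_combination c * a2⟩
    · obtain ⟨a1, a2⟩ := h2 φ hφ hq
      simp only [Prod.smul_fst, Prod.smul_snd, integral_smul_mul]
      refine ⟨by linear_combination c * a1, ?_⟩
      rw [integral_smul_mul_Γ d c _ fun x => φ (x, G.b)]
      linear_combination c * a2

end Space

section Problem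

variable {d : WaveData} {G : Grating d.Lam}

/-- The space `H¹_{S,qp}(Ω)²`. -/
abbrev V (d : WaveData) (G : Grating d.Lam) := Fin 2 → H1Sqp d G

namespace V

/-- The components of a vector field. -/
def val (u : V d G) (i : Fin 2) : L2Ω d G := (u i).1.1

/-- The `x`-derivatives of the components. -/
def dx (u : V d G) (i : Fin 2) : L2Ω d G := (u i).1.2.1

/-- The `y`-derivatives of the components. -/
def dy (u : V d G) (i : Fin 2) : L2Ω d G := (u i).1.2.2.1

/-- The traces of the components on `Γ`. -/
def trace (u : V d G) (i : Fin 2) : L2Γ d := (u i).1.2.2.2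

/-- The norm of `H¹(Ω)²`. -/
def h1Norm (u : V d G) : ℝ :=
  √(∑ i, (‖u.val i‖ ^ 2 + ‖u.dx i‖ ^ 2 + ‖u.dy i‖ ^ 2))

end V

/-- The sesquilinear form of the Navier equation in `Ω` with the boundary operator of symbol `A`. -/
def form (A : ℤ → Matrix (Fin 2) (Fin 2) ℂ) (u v : V d G) : ℂ :=
  d.mu * (∫ z in G.Ω, ∑ i, (u.dx i z * conj (v.dx i z) + u.dy i z * conj (v.dy i z)))
    + (d.lam + d.mu) *
      (∫ z in G.Ω, (u.dx 0 z + u.dy 1 z) * conj (v.dx 0 z + v.dy 1 z))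
    - d.freq ^ 2 * (∫ z in G.Ω, ∑ i, u.val i z * conj (v.val i z))
    - d.symbolPair A (fun i x => u.trace i x) (fun i x => v.trace i x)

/-- `⟨𝒟 u_inc - T u_inc, v⟩_Γ`, where `T` is the boundary operator of symbol `A`. -/
def load (A : ℤ → Matrix (Fin 2) (Fin 2) ℂ) (v : V d G) : ℂ :=
  d.l2Pair (fun i x => d.boundaryD d.uInc x G.b i) (fun i x => v.trace i x)
    - d.symbolPair A (fun i x => d.uInc i x G.b) (fun i x => v.trace i x)

/-- Weak solutions of the variational problem `a(u, v) = ⟨f, v⟩_Γ` of the scattering problem. -/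
def IsWeakSolution (u : V d G) : Prop := ∀ v : V d G, form d.M u v = load d.M v

/-- Weak solutions of the variational problem `a^PML(u, v) = ⟨f^PML, v⟩_Γ` of the truncated PML
problem with parameter `z = ζ`. -/
def IsPMLSolution (z : ℂ) (u : V d G) : Prop :=
  ∀ v : V d G, form (d.MHat z) u v = load (d.MHat z) v

/-- The dual norm `sup_{v ≠ 0} |a(u, v)| / ‖v‖_{H¹(Ω)²}` induced by `a`. -/
def aNorm (u : V d G) : ℝ≥0∞ :=
  ⨆ (v : V d G) (_ : v ≠ 0), ENNReal.ofReal (‖form d.M u v‖ / v.h1Norm)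

/-- The inf-sup condition for `a` with constant `γ`. -/
def InfSup (G : Grating d.Lam) (γ : ℝ) : Prop :=
  ∀ u : V d G, ENNReal.ofReal (γ * u.h1Norm) ≤ aNorm u

end Problem

/-- The PML function: continuous, equal to `1` up to the height `b`, with real part at least `1` and
positive imaginary part above it. -/
structure IsPMLFunction (b : ℝ) (ρ : ℝ → ℂ) : Prop where
  continuous : Continuous ρ
  eq_one : ∀ τ ≤ b, ρ τ = 1
  one_le_re : ∀ τ, b < τ → 1 ≤ (ρ τ).re
  im_pos : ∀ τ, b < τ → 0 < (ρ τ).im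

/-- `ζ = ∫_b^{b+δ} ρ(τ) dτ`. -/
def zeta (b δ : ℝ) (ρ : ℝ → ℂ) : ℂ := ∫ τ in b..(b + δ), ρ τ

end ElasticPML

end

noncomputable section

namespace ElasticPML

/-! ## Wavenumbers and the decay factor -/

namespace WaveData

variable (d : WaveData)

/-! The exact and the truncated problem share the form in `Ω` and differ only in the boundary
symbol. Everything rests on one bound, uniform in `n`: each entry of `M n - MHat z n` has modulus at
most `FHat z / 2` (`norm_M_sub_MHat_le`). The trace on `Γ` satisfies ‖u‖_Γ ≤ ‖u‖_{H¹} with constant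
1, so the two forms differ by at most F̂ ‖u‖ ‖v‖. Writing w for the PML solution, the terms with 𝒟
u_inc cancel in a(u - w, v), leaving ⟨(T - T^PML)(w - u_inc), v⟩, and the error estimate follows.
The constant γ₂ enters only through γ₂ ≥ 1.

Symbol bound. Put e_j = exp(iβ_jζ). After reduction to the denominator χχ̂, the entries of M - M̂
are polynomials in α_n, β_1, β_2 and the products β₁ε₁, β₂ε₁η, β_jδ_j. These products are
combinations of h_j e_k with h_j = β_j e_j / (1 - e_j²). One half of the exponent of e_j is spent on
absorbing β_j into the maximum of the quotients Δ/(exp(Δs/2) - 1); the remaining decay compensates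
the powers of α_n (`exists_mode_bound`, `symbol_complex_estimates`). Dividing requires |χ| ≥ κ₁² and
a small F, so that |χ̂| ≥ κ₁²/2.

Smallness of F is not assumed. It comes from F̂ < γ₁ and the a priori bound γ₁ ≤ 2(λ+2μ)
(`InfSup.le`), which is found by inserting a rapidly oscillating, compactly supported field into the
inf-sup condition.

Solvability. The inf-sup condition makes the operator of a bounded below; surjectivity needs a
Fredholm argument. A Gårding inequality holds up to finitely many functionals (`exists_garding`):
the exact symbol is dissipative at all but finitely many modes (`re_M_nonpos`), and the L² norm is
controlled by a small part of the H¹ norm and finitely many Fourier modes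
(`norm_sq_le_of_finite_modes`). Hence a finite rank perturbation of the operator is coercive and
injectivity implies bijectivity. The PML operator lies within F̂ < γ₁ of it and is inverted by a
Neumann series.

The trace and compactness estimates come from Green's formula tested with exponentials, after
functions on `Ω` are extended by zero to a rectangle. No regularity of the surface is needed for
them. -/

theorem lam_add_two_mu_pos : 0 < d.lam + 2 * d.mu := by
  have := d.lam_add_mu_pos; have := d.mu_pos; linarith

theorem kappa1_pos : 0 < d.kappa1 :=
  div_pos d.freq_pos (Real.sqrt_pos.2 d.lam_add_two_mu_pos)

theorem kappa2_pos : 0 < d.kappa2 := div_pos d.freq_pos (Real.sqrt_pos.2 d.mu_pos)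

theorem kappa1_sq : d.kappa1 ^ 2 = d.freq ^ 2 / (d.lam + 2 * d.mu) := by
  rw [kappa1, div_pow, Real.sq_sqrt d.lam_add_two_mu_pos.le]

theorem kappa2_sq : d.kappa2 ^ 2 = d.freq ^ 2 / d.mu := by
  rw [kappa2, div_pow, Real.sq_sqrt d.mu_pos.le]

theorem freq_sq : d.freq ^ 2 = d.mu * d.kappa2 ^ 2 := by
  rw [kappa2_sq, mul_div_cancel₀ _ d.mu_pos.ne']

theorem kappa1_lt_kappa2 : d.kappa1 < d.kappa2 := by
  have := d.lam_add_mu_pos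
  exact div_lt_div_of_pos_left d.freq_pos (Real.sqrt_pos.2 d.mu_pos)
    (Real.sqrt_lt_sqrt d.mu_pos.le (by linarith))

theorem abs_alphaN_zero_lt : |d.alphaN 0| < d.kappa1 := by
  have hs : |Real.sin d.θ| < 1 := by
    have hc : 0 < Real.cos d.θ := Real.cos_pos_of_mem_Ioo d.θ_mem
    rw [← sq_lt_one_iff_abs_lt_one]
    nlinarith [Real.sin_sq_add_cos_sq d.θ]
  simp only [alphaN, alpha, Int.cast_zero, zero_mul, add_zero, abs_mul, abs_of_pos d.kappa1_pos]
  nlinarith [d.kappa1_pos]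

theorem finite_abs_alphaN_lt (k : ℝ) : {n : ℤ | |d.alphaN n| < k}.Finite := by
  have hp : 0 < 2 * Real.pi / d.Lam := div_pos (by positivity) d.Lam_pos
  refine (Set.finite_Icc (-⌈(k + |d.alpha|) / (2 * Real.pi / d.Lam)⌉)
    ⌈(k + |d.alpha|) / (2 * Real.pi / d.Lam)⌉).subset fun n hn => ?_
  have hn' : |d.alpha + n * (2 * Real.pi / d.Lam)| < k := hn
  have h1 : |(n : ℝ)| ≤ (k + |d.alpha|) / (2 * Real.pi / d.Lam) := by
    rw [le_div_iff₀ hp, ← abs_of_pos hp, ← abs_mul]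
    have := abs_sub (d.alpha + n * (2 * Real.pi / d.Lam)) d.alpha
    rw [add_sub_cancel_left] at this
    linarith
  have h2 := h1.trans (Int.le_ceil _)
  rw [abs_le] at h2
  exact ⟨by exact_mod_cast h2.1, by exact_mod_cast h2.2⟩

theorem Delta_pos {k : ℝ} (hk : 0 < k) {n : ℤ} (h : k ≠ |d.alphaN n|) : 0 < d.Delta k n := by
  refine Real.sqrt_pos.2 (abs_pos.2 fun h0 => h ?_)
  rw [← abs_of_pos hk]
  exact (sq_eq_sq_iff_abs_eq_abs _ _).1 (by linarith)

/-- Once |α_n| ≥ k + 1 the value is at least 1, and only finitely many modes remain, each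
nonresonant. -/
theorem exists_pos_le_Delta {k : ℝ} (hk : 0 < k) (h : ∀ n, k ≠ |d.alphaN n|) :
    ∃ ε, 0 < ε ∧ ∀ n, ε ≤ d.Delta k n := by
  have hne : (d.finite_abs_alphaN_lt (k + 1)).toFinset.Nonempty ∨
      (d.finite_abs_alphaN_lt (k + 1)).toFinset = ∅ := (Finset.eq_empty_or_nonempty _).symm
  have hfar : ∀ n, ¬ |d.alphaN n| < k + 1 → 1 ≤ d.Delta k n := fun n hn => by
    rw [Delta, Real.one_le_sqrt, le_abs]
    right
    have := sq_abs (d.alphaN n)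
    nlinarith
  rcases hne with hne | hemp
  · obtain ⟨m, -, hm⟩ := Finset.exists_min_image _ (d.Delta k) hne
    refine ⟨min 1 (d.Delta k m), lt_min one_pos (d.Delta_pos hk (h m)), fun n => ?_⟩
    by_cases hn : |d.alphaN n| < k + 1
    · exact (min_le_right _ _).trans (hm n (by simpa using hn))
    · exact (min_le_left _ _).trans (hfar n hn)
  · refine ⟨1, one_pos, fun n => hfar n fun hn => ?_⟩
    have : n ∈ (d.finite_abs_alphaN_lt (k + 1)).toFinset := by simpa using hn
    rw [hemp] at this
    simp at this

/-- The infimum of an empty set would be 0. The mode n = 0 is propagating, since |α| = κ₁ |sin θ| <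
κ₁ ≤ k, and this is where the lower bound on k is needed. -/
theorem DeltaMinus_pos {k : ℝ} (hk : d.kappa1 ≤ k) (h : ∀ n, k ≠ |d.alphaN n|) :
    0 < d.DeltaMinus k := by
  obtain ⟨ε, hε, hle⟩ := d.exists_pos_le_Delta (d.kappa1_pos.trans_le hk) h
  refine hε.trans_le (le_csInf ⟨_, 0, d.abs_alphaN_zero_lt.trans_le hk, rfl⟩ ?_)
  rintro _ ⟨n, -, rfl⟩
  exact hle n

theorem DeltaPlus_pos {k : ℝ} (hk : d.kappa1 ≤ k) (h : ∀ n, k ≠ |d.alphaN n|) :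
    0 < d.DeltaPlus k := by
  obtain ⟨ε, hε, hle⟩ := d.exists_pos_le_Delta (d.kappa1_pos.trans_le hk) h
  obtain ⟨n, hn⟩ := (d.finite_abs_alphaN_lt k).exists_notMem
  refine hε.trans_le (le_csInf ⟨_, n, hn, rfl⟩ ?_)
  rintro _ ⟨n, -, rfl⟩
  exact hle n

theorem DeltaMinus_le {k : ℝ} {n : ℤ} (hn : |d.alphaN n| < k) : d.DeltaMinus k ≤ d.Delta k n :=
  csInf_le ⟨0, by rintro _ ⟨n, -, rfl⟩; exact Real.sqrt_nonneg _⟩ ⟨n, hn, rfl⟩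

theorem DeltaPlus_le {k : ℝ} {n : ℤ} (hn : ¬ |d.alphaN n| < k) : d.DeltaPlus k ≤ d.Delta k n :=
  csInf_le ⟨0, by rintro _ ⟨n, -, rfl⟩; exact Real.sqrt_nonneg _⟩ ⟨n, hn, rfl⟩

end WaveData

/-- By convexity the slope of the chord of the exponential that starts at 0 increases; this is its
reciprocal. Hence the extremal Δ in `decay` controls all modes of its kind. -/
theorem div_exp_sub_one_anti {s t t' : ℝ} (hs : 0 < s) (ht : 0 < t) (h : t ≤ t') :
    t' / (Real.exp (1 / 2 * t' * s) - 1) ≤ t / (Real.exp (1 / 2 * t * s) - 1) := by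
  have ht' : 0 < t' := ht.trans_le h
  have e1 : 0 < Real.exp (1 / 2 * t * s) - 1 := sub_pos.2 (Real.one_lt_exp_iff.2 (by positivity))
  have e2 : 0 < Real.exp (1 / 2 * t' * s) - 1 := sub_pos.2 (Real.one_lt_exp_iff.2 (by positivity))
  rw [div_le_div_iff₀ e2 e1]
  have hc := convexOn_exp.2 (mem_univ (1 / 2 * t' * s)) (mem_univ 0)
    (show 0 ≤ t / t' by positivity) (show 0 ≤ 1 - t / t' from sub_nonneg.2 ((div_le_one ht').2 h))
    (by ring)
  have h1 : (t / t') • (1 / 2 * t' * s) + (1 - t / t') • (0 : ℝ) = 1 / 2 * t * s := by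
    simp only [smul_eq_mul]; field_simp; ring
  rw [h1, Real.exp_zero] at hc
  simp only [smul_eq_mul] at hc
  have := mul_le_mul_of_nonneg_left hc ht'.le
  have h2 : t' * (t / t' * Real.exp (1 / 2 * t' * s) + (1 - t / t') * 1) =
      t * Real.exp (1 / 2 * t' * s) + (t' - t) := by field_simp
  linarith

theorem div_exp_sub_one_pos {s t : ℝ} (hs : 0 < s) (ht : 0 < t) :
    0 < t / (Real.exp (1 / 2 * t * s) - 1) :=
  div_pos ht (sub_pos.2 (Real.one_lt_exp_iff.2 (by positivity)))

theorem div_exp_sub_one_le {t c : ℝ} (ht : 0 < t) (hc : c ≤ t / 2) :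
    ∃ C, 0 < C ∧ ∀ s, 1 ≤ s →
      t / (Real.exp (1 / 2 * t * s) - 1) ≤ C * Real.exp (-(c * s)) := by
  have h1 : 0 < 1 - Real.exp (-(t / 2)) := sub_pos.2 (Real.exp_lt_one_iff.2 (by linarith))
  -- For s ≥ 1 one has exp(ts/2) - 1 ≥ exp(ts/2) (1 - exp(-t/2)), which yields this constant.
  refine ⟨t / (1 - Real.exp (-(t / 2))), div_pos ht h1, fun s hs => ?_⟩
  have e1 : 0 < Real.exp (1 / 2 * t * s) - 1 := sub_pos.2 (Real.one_lt_exp_iff.2 (by positivity))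
  have key : Real.exp (c * s) * (1 - Real.exp (-(t / 2))) ≤ Real.exp (1 / 2 * t * s) - 1 := by
    have : 1 ≤ Real.exp (1 / 2 * t * s) * Real.exp (-(t / 2)) := by
      rw [← Real.exp_add]; exact Real.one_le_exp (by nlinarith)
    have h3 : Real.exp (c * s) ≤ Real.exp (1 / 2 * t * s) :=
      Real.exp_le_exp.2 (by nlinarith)
    nlinarith
  rw [Real.exp_neg (c * s), ← div_eq_mul_inv, div_div]
  exact div_le_div_of_nonneg_left ht.le (by positivity) (by linarith)

/-! ### Exponential decay of F̂ -/

namespace WaveData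

variable (d : WaveData)

/-- The first maximum in `F`. -/
def decayMax (z : ℂ) : ℝ := max (d.decay z d.kappa1) (d.decay z d.kappa2)

/-- The second maximum in `F`. -/
def factor : ℝ :=
  max (12 * d.kappa2) (max (16 * d.kappa2 ^ 4) (max (8 + 2 * d.kappa2 ^ 2)
    (max (16 * d.kappa2 ^ 3 / d.kappa1 ^ 2)
      (24 * (16 + d.kappa2 ^ 2) ^ 2 / d.kappa1 ^ 2))))

theorem F_eq (z : ℂ) : d.F z = d.decayMax z * d.factor := rfl

theorem le_factor : 24 * (16 + d.kappa2 ^ 2) ^ 2 / d.kappa1 ^ 2 ≤ d.factor := by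
  simp [factor]

theorem factor_pos : 0 < d.factor :=
  (mul_pos (by norm_num) d.kappa2_pos).trans_le (le_max_left (12 * d.kappa2) _)

theorem decay_pos {z : ℂ} (hi : 0 < z.im) {k : ℝ} (hk : d.kappa1 ≤ k)
    (h : ∀ n, k ≠ |d.alphaN n|) : 0 < d.decay z k :=
  lt_max_of_lt_left (div_exp_sub_one_pos hi (d.DeltaMinus_pos hk h))

theorem decayMax_pos (hres : d.NonResonant) {z : ℂ} (hi : 0 < z.im) : 0 < d.decayMax z :=
  lt_max_of_lt_left (d.decay_pos hi le_rfl fun n => (hres n).1)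

theorem decay_le {k c : ℝ} (hk : d.kappa1 ≤ k) (h : ∀ n, k ≠ |d.alphaN n|)
    (h1 : c ≤ d.DeltaMinus k / 2) (h2 : c ≤ d.DeltaPlus k / 2) :
    ∃ C, 0 < C ∧ ∀ z : ℂ, 1 ≤ z.re → 1 ≤ z.im →
      d.decay z k ≤ C * (Real.exp (-(c * z.re)) + Real.exp (-(c * z.im))) := by
  obtain ⟨C₁, hC₁, h1⟩ := div_exp_sub_one_le (d.DeltaMinus_pos hk h) h1
  obtain ⟨C₂, hC₂, h2⟩ := div_exp_sub_one_le (d.DeltaPlus_pos hk h) h2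
  refine ⟨C₁ + C₂, by positivity, fun z hr hi => max_le ((h1 _ hi).trans ?_) ((h2 _ hr).trans ?_)⟩
  · nlinarith [mul_pos hC₁ (Real.exp_pos (-(c * z.re))), mul_pos hC₂ (Real.exp_pos (-(c * z.re))),
      mul_pos hC₂ (Real.exp_pos (-(c * z.im)))]
  · nlinarith [mul_pos hC₁ (Real.exp_pos (-(c * z.re))), mul_pos hC₁ (Real.exp_pos (-(c * z.im))),
      mul_pos hC₂ (Real.exp_pos (-(c * z.im)))]

theorem FHat_exponential_decay (hres : d.NonResonant) :
    ∃ C c : ℝ, 0 < C ∧ 0 < c ∧ ∀ z : ℂ, 1 ≤ z.re → 1 ≤ z.im →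
      0 < d.FHat z ∧
        d.FHat z ≤ C * (Real.exp (-(c * z.re)) + Real.exp (-(c * z.im))) := by
  have hr1 := fun n => (hres n).1
  have hr2 := fun n => (hres n).2
  have hk2 := d.kappa1_lt_kappa2.le
  have p1 := d.DeltaMinus_pos le_rfl hr1
  have p2 := d.DeltaPlus_pos le_rfl hr1
  have p3 := d.DeltaMinus_pos hk2 hr2
  have p4 := d.DeltaPlus_pos hk2 hr2
  obtain ⟨c, hc, c1, c2, c3, c4⟩ : ∃ c : ℝ, 0 < c ∧ c ≤ d.DeltaMinus d.kappa1 / 2 ∧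
      c ≤ d.DeltaPlus d.kappa1 / 2 ∧ c ≤ d.DeltaMinus d.kappa2 / 2 ∧
      c ≤ d.DeltaPlus d.kappa2 / 2 := by
    refine ⟨min (min (d.DeltaMinus d.kappa1 / 2) (d.DeltaPlus d.kappa1 / 2))
      (min (d.DeltaMinus d.kappa2 / 2) (d.DeltaPlus d.kappa2 / 2)), ?_, ?_, ?_, ?_, ?_⟩
    · simp only [lt_min_iff]; refine ⟨⟨?_, ?_⟩, ?_, ?_⟩ <;> linarith
    all_goals simp
  obtain ⟨C₁, hC₁, b1⟩ := d.decay_le le_rfl hr1 c1 c2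
  obtain ⟨C₂, hC₂, b2⟩ := d.decay_le hk2 hr2 c3 c4
  have hK := d.factor_pos
  have hω := d.freq_pos
  have hκ := d.kappa1_pos
  refine ⟨17 * d.freq ^ 2 * ((C₁ + C₂) * d.factor) / d.kappa1 ^ 4, c, by positivity, hc,
    fun z hr hi => ⟨?_, ?_⟩⟩
  · have := d.decayMax_pos hres (one_pos.trans_le hi)
    rw [FHat, F_eq]; positivity
  · have hle : d.decayMax z ≤ (C₁ + C₂) * (Real.exp (-(c * z.re)) + Real.exp (-(c * z.im))) := by
      have he := add_pos (Real.exp_pos (-(c * z.re))) (Real.exp_pos (-(c * z.im)))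
      refine max_le ((b1 z hr hi).trans ?_) ((b2 z hr hi).trans ?_) <;> nlinarith
    rw [FHat, F_eq]
    calc _ ≤ 17 * d.freq ^ 2 * ((C₁ + C₂) *
          (Real.exp (-(c * z.re)) + Real.exp (-(c * z.im))) * d.factor) / d.kappa1 ^ 4 := by
          gcongr
      _ = _ := by ring

end WaveData

/-! ## Comparison of the two boundary symbols -/

/-- Elementary inequalities behind the symbol estimate. -/
theorem symbol_real_estimates {D ρ m T k F y : ℝ} (hD : 0 ≤ D) (hρ0 : 0 ≤ ρ) (hρ1 : ρ ≤ 1)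
    (hm : 0 ≤ m) (hT : 16 ≤ T) (hk : 0 < k) (hkT : k ≤ T) (h2 : m ^ 2 * ρ ≤ T)
    (h4 : m ^ 4 * ρ ≤ T ^ 2) (hF : 24 * (D * T ^ 2) ≤ F * k) (hFk : F ≤ 2 * k / 17)
    (hy : k * y ≤ 4 * m ^ 2 * (4 * m * (D * ρ) + 4 * (D * ρ) ^ 2)) :
    y ≤ k / 2 ∧ m * y + 16 * (m ^ 2 * (D * ρ)) + 24 * (m * (D * ρ) ^ 2) ≤ 3 / 2 * F := by
  have hT0 : 0 < T := by linarith
  -- The hypotheses on F and k ≤ T give 24 D ≤ 2/17, that is D ≤ 1/204. Terms quadratic in D thereby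
  -- become negligible.
  have hD1 : D ≤ 1 / 200 := by
    have h : 24 * (D * T ^ 2) ≤ 2 / 17 * T ^ 2 := by
      calc 24 * (D * T ^ 2) ≤ F * k := hF
        _ ≤ 2 * k / 17 * k := by gcongr
        _ ≤ 2 * T / 17 * T := by gcongr
        _ = _ := by ring
    have h' : (24 * D) * T ^ 2 ≤ 2 / 17 * T ^ 2 := by linarith
    have := le_of_mul_le_mul_right h' (by positivity)
    linarith
  have hT2 : T ≤ T ^ 2 := by nlinarith
  have h3 : m ^ 3 * ρ ≤ T ^ 2 := by
    have : 0 ≤ m ^ 2 * ρ * (m - 1) ^ 2 := by positivity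
    nlinarith
  have h1 : m * ρ ≤ T := by
    have : 0 ≤ ρ * (m - 1) ^ 2 := by positivity
    nlinarith
  have hρρ : ρ ^ 2 ≤ ρ := by nlinarith
  have hDT : 0 ≤ D * T ^ 2 := by positivity
  constructor
  · have e : k * y ≤ 32 * (D * T ^ 2) := by
      calc k * y ≤ 4 * m ^ 2 * (4 * m * (D * ρ) + 4 * (D * ρ) ^ 2) := hy
        _ = 16 * D * (m ^ 3 * ρ) + 16 * D * D * (m ^ 2 * ρ ^ 2) := by ring
        _ ≤ 16 * D * T ^ 2 + 16 * D * 1 * (m ^ 2 * ρ) := by gcongr; linarith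
        _ ≤ 16 * D * T ^ 2 + 16 * D * 1 * T ^ 2 := by gcongr; linarith
        _ = _ := by ring
    have e2 : k * y ≤ k * (k / 2) := by nlinarith
    exact le_of_mul_le_mul_left e2 hk
  · have e : k * (m * y) ≤ (16 + 16 / 200) * (D * T ^ 2) := by
      calc k * (m * y) = m * (k * y) := by ring
        _ ≤ m * (4 * m ^ 2 * (4 * m * (D * ρ) + 4 * (D * ρ) ^ 2)) := by gcongr
        _ = 16 * D * (m ^ 4 * ρ) + 16 * D * D * (m ^ 3 * ρ ^ 2) := by ring
        _ ≤ 16 * D * T ^ 2 + 16 * D * (1 / 200) * (m ^ 3 * ρ) := by gcongr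
        _ ≤ 16 * D * T ^ 2 + 16 * D * (1 / 200) * T ^ 2 := by gcongr
        _ = _ := by ring
    have e2 : k * (16 * (m ^ 2 * (D * ρ))) ≤ 16 * (D * T ^ 2) := by
      calc k * (16 * (m ^ 2 * (D * ρ))) = 16 * (k * D * (m ^ 2 * ρ)) := by ring
        _ ≤ 16 * (T * D * T) := by gcongr
        _ = _ := by ring
    have e3 : k * (24 * (m * (D * ρ) ^ 2)) ≤ 24 / 200 * (D * T ^ 2) := by
      calc k * (24 * (m * (D * ρ) ^ 2)) = 24 * (k * D * D * (m * ρ ^ 2)) := by ring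
        _ ≤ 24 * (T * D * (1 / 200) * (m * ρ)) := by gcongr
        _ ≤ 24 * (T * D * (1 / 200) * T) := by gcongr
        _ = _ := by ring
    -- Multiplied by k, the three terms add up to at most (16.08 + 16 + 0.12) D T² = 32.2 D T²,
    -- which is below 36 D T² ≤ (3/2) F k.
    refine le_of_mul_le_mul_left ?_ hk
    nlinarith

/-- `β e / (1 - e²)` is controlled by the decay factor. -/
theorem norm_mul_div_one_sub_sq_le {β e : ℂ} {D r : ℝ} (hr0 : 0 < r) (hr1 : r < 1)
    (he : ‖e‖ = r ^ 2) (hβ : ‖β‖ * r ≤ D * (1 - r)) : ‖β * e / (1 - e ^ 2)‖ ≤ D * r := by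
  -- Here |e²| = r⁴ ≤ r. The numerator is (|β| r) r ≤ D (1 - r) r, so one factor r survives the
  -- division.
  have h1 : 1 - r ≤ ‖1 - e ^ 2‖ := by
    have := norm_sub_norm_le (1 : ℂ) (e ^ 2)
    rw [norm_one, norm_pow, he] at this
    have : (r ^ 2) ^ 2 ≤ r := by
      rw [← pow_mul]; simpa using pow_le_pow_of_le_one hr0.le hr1.le (show 1 ≤ 2 * 2 by norm_num)
    linarith
  rw [norm_div, norm_mul, he, div_le_iff₀ (by linarith)]
  have hD : 0 ≤ D := by
    have : 0 ≤ D * (1 - r) := le_trans (by positivity) hβ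
    exact nonneg_of_mul_nonneg_left this (by linarith)
  nlinarith [mul_le_mul_of_nonneg_left h1 (mul_nonneg hD hr0.le)]

/-! ### Propagating and evanescent modes -/

namespace WaveData

variable (d : WaveData)

theorem beta_of_lt {k : ℝ} {n : ℤ} (h : |d.alphaN n| < k) :
    d.beta k n = (d.Delta k n : ℂ) := by
  rw [beta, if_pos h, Delta, abs_of_nonneg]
  have := abs_lt.1 h; nlinarith

theorem beta_of_not_lt {k : ℝ} (hk : 0 < k) {n : ℤ} (h : ¬ |d.alphaN n| < k) :
    d.beta k n = Complex.I * (d.Delta k n : ℂ) := by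
  rw [beta, if_neg h, Delta, abs_of_nonpos, neg_sub]
  have := sq_abs (d.alphaN n); nlinarith

theorem norm_beta {k : ℝ} (hk : 0 < k) (n : ℤ) : ‖d.beta k n‖ = d.Delta k n := by
  have h0 : 0 ≤ d.Delta k n := Real.sqrt_nonneg _
  by_cases h : |d.alphaN n| < k
  · rw [d.beta_of_lt h, Complex.norm_real, Real.norm_of_nonneg h0]
  · rw [d.beta_of_not_lt hk h, norm_mul, Complex.norm_I, one_mul, Complex.norm_real,
      Real.norm_of_nonneg h0]

theorem Delta_nonneg (k : ℝ) (n : ℤ) : 0 ≤ d.Delta k n := Real.sqrt_nonneg _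

theorem Delta_sq_of_lt {k : ℝ} {n : ℤ} (h : |d.alphaN n| < k) :
    d.Delta k n ^ 2 = k ^ 2 - d.alphaN n ^ 2 := by
  rw [Delta, Real.sq_sqrt (abs_nonneg _), abs_of_nonneg]
  have := abs_lt.1 h; nlinarith

theorem Delta_sq_of_not_lt {k : ℝ} (hk : 0 < k) {n : ℤ} (h : ¬ |d.alphaN n| < k) :
    d.Delta k n ^ 2 = d.alphaN n ^ 2 - k ^ 2 := by
  rw [Delta, Real.sq_sqrt (abs_nonneg _), abs_of_nonpos, neg_sub]
  have := sq_abs (d.alphaN n); nlinarith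

/-- Three regimes. Below κ₁, χ = α_n² + Δ₁Δ₂ ≥ α_n² + Δ₁² = κ₁². Between κ₁ and κ₂, β₁β₂ is purely
imaginary and Re χ = α_n². Above κ₂, χ = α_n² - Δ₁Δ₂ ≥ α_n² - Δ₁² = κ₁². -/
theorem kappa1_sq_le_re_chi (n : ℤ) : d.kappa1 ^ 2 ≤ (d.chi n).re := by
  have k1 := d.kappa1_pos
  have k2 := d.kappa2_pos
  have k12 := d.kappa1_lt_kappa2
  have n1 := d.Delta_nonneg d.kappa1 n
  have n2 := d.Delta_nonneg d.kappa2 n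
  have ha := sq_abs (d.alphaN n)
  have hsq : ((d.alphaN n : ℂ) ^ 2).re = d.alphaN n ^ 2 := by
    rw [← Complex.ofReal_pow, Complex.ofReal_re]
  by_cases h1 : |d.alphaN n| < d.kappa1
  · have h2 := h1.trans k12
    have e1 := d.Delta_sq_of_lt h1
    have e2 := d.Delta_sq_of_lt h2
    have : d.Delta d.kappa1 n ≤ d.Delta d.kappa2 n := abs_le_of_sq_le_sq' (by nlinarith) n2 |>.2
    rw [chi, beta1, beta2, d.beta_of_lt h1, d.beta_of_lt h2, Complex.add_re, hsq,
      ← Complex.ofReal_mul, Complex.ofReal_re]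
    nlinarith
  · have e1 := d.Delta_sq_of_not_lt k1 h1
    by_cases h2 : |d.alphaN n| < d.kappa2
    · rw [chi, beta1, beta2, d.beta_of_not_lt k1 h1, d.beta_of_lt h2, Complex.add_re, hsq,
        mul_assoc, ← Complex.ofReal_mul, Complex.I_mul_re, Complex.ofReal_im]
      nlinarith
    · have e2 := d.Delta_sq_of_not_lt k2 h2
      have : d.Delta d.kappa2 n ≤ d.Delta d.kappa1 n := abs_le_of_sq_le_sq' (by nlinarith) n1 |>.2
      have hb : Complex.I * (d.Delta d.kappa1 n : ℂ) * (Complex.I * (d.Delta d.kappa2 n : ℂ)) =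
          ((-(d.Delta d.kappa1 n * d.Delta d.kappa2 n) : ℝ) : ℂ) := by
        push_cast; linear_combination
          (d.Delta d.kappa1 n : ℂ) * (d.Delta d.kappa2 n : ℂ) * Complex.I_mul_I
      rw [chi, beta1, beta2, d.beta_of_not_lt k1 h1, d.beta_of_not_lt k2 h2, Complex.add_re, hsq,
        hb, Complex.ofReal_re]
      nlinarith

theorem kappa1_sq_le_norm_chi (n : ℤ) : d.kappa1 ^ 2 ≤ ‖d.chi n‖ :=
  (d.kappa1_sq_le_re_chi n).trans (Complex.re_le_norm _)

theorem chi_ne_zero (n : ℤ) : d.chi n ≠ 0 := by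
  have := d.kappa1_sq_le_norm_chi n
  have := d.kappa1_pos
  exact norm_pos_iff.1 (by nlinarith)

/-- The square root of the modulus of `e^{iβz}`. -/
def decayRoot (z : ℂ) (k : ℝ) (n : ℤ) : ℝ :=
  Real.exp (-(1 / 2 * d.Delta k n * if |d.alphaN n| < k then z.im else z.re))

theorem norm_exp_beta {k : ℝ} (hk : 0 < k) (z : ℂ) (n : ℤ) :
    ‖Complex.exp (Complex.I * d.beta k n * z)‖ = d.decayRoot z k n ^ 2 := by
  rw [Complex.norm_exp, decayRoot, ← Real.exp_nat_mul]
  congr 1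
  split_ifs with h
  · rw [d.beta_of_lt h]; simp; ring
  · rw [d.beta_of_not_lt hk h, ← mul_assoc, Complex.I_mul_I]; simp; ring

theorem decayRoot_pos (z : ℂ) (k : ℝ) (n : ℤ) : 0 < d.decayRoot z k n := Real.exp_pos _

theorem decayRoot_lt_one {z : ℂ} (hr : 0 < z.re) (hi : 0 < z.im) {k : ℝ} (hk : 0 < k) {n : ℤ}
    (h : k ≠ |d.alphaN n|) : d.decayRoot z k n < 1 := by
  have := d.Delta_pos hk h
  rw [decayRoot, Real.exp_lt_one_iff, neg_lt_zero]
  split_ifs <;> positivity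

/-- With r = exp(-Δs/2), the claim is Δ/(exp(Δs/2) - 1) ≤ D multiplied through by r; monotonicity in
Δ reduces that bound to the smallest Δ of the same kind. -/
theorem Delta_mul_decayRoot_le {z : ℂ} (hr : 0 < z.re) (hi : 0 < z.im) {k D : ℝ}
    (hk : d.kappa1 ≤ k) (h : ∀ n, k ≠ |d.alphaN n|) (hD : d.decay z k ≤ D) (n : ℤ) :
    d.Delta k n * d.decayRoot z k n ≤ D * (1 - d.decayRoot z k n) := by
  have hpos := d.Delta_pos (d.kappa1_pos.trans_le hk) (h n)
  have key : ∀ s, 0 < s → d.Delta k n / (Real.exp (1 / 2 * d.Delta k n * s) - 1) ≤ D →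
      d.Delta k n * Real.exp (-(1 / 2 * d.Delta k n * s)) ≤
        D * (1 - Real.exp (-(1 / 2 * d.Delta k n * s))) := fun s hs hle => by
    have e1 : 0 < Real.exp (1 / 2 * d.Delta k n * s) - 1 :=
      sub_pos.2 (Real.one_lt_exp_iff.2 (by positivity))
    rw [div_le_iff₀ e1] at hle
    have := mul_le_mul_of_nonneg_right hle (Real.exp_pos (-(1 / 2 * d.Delta k n * s))).le
    have e2 : Real.exp (1 / 2 * d.Delta k n * s) * Real.exp (-(1 / 2 * d.Delta k n * s)) = 1 := by
      rw [← Real.exp_add]; simp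
    calc _ ≤ _ := this
      _ = D * (Real.exp (1 / 2 * d.Delta k n * s) * Real.exp (-(1 / 2 * d.Delta k n * s)) -
          Real.exp (-(1 / 2 * d.Delta k n * s))) := by ring
      _ = _ := by rw [e2]
  rw [decayRoot]
  split_ifs with hn
  · refine key _ hi (le_trans ?_ ((le_max_left _ _).trans hD))
    exact div_exp_sub_one_anti hi (d.DeltaMinus_pos hk h) (d.DeltaMinus_le hn)
  · refine key _ hr (le_trans ?_ ((le_max_right _ _).trans hD))
    exact div_exp_sub_one_anti hr (d.DeltaPlus_pos hk h) (d.DeltaPlus_le hn)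

/-- A common bound `m` for `|α_n|`, `|β_1|`, `|β_2|`, and a weight `ρ` that compensates its
growth. -/
theorem exists_mode_bound (hres : d.NonResonant) {z : ℂ} (hr : 1 ≤ z.re) (hi : 0 < z.im) (n : ℤ) :
    ∃ m ρ : ℝ, 0 ≤ m ∧ 0 ≤ ρ ∧ ρ ≤ 1 ∧ |d.alphaN n| ≤ m ∧ d.Delta d.kappa1 n ≤ m ∧
      d.Delta d.kappa2 n ≤ m ∧ m ^ 2 * ρ ≤ 16 + d.kappa2 ^ 2 ∧
      m ^ 4 * ρ ≤ (16 + d.kappa2 ^ 2) ^ 2 ∧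
      ∀ k ∈ ({d.kappa1, d.kappa2} : Set ℝ), ∀ k' ∈ ({d.kappa1, d.kappa2} : Set ℝ),
        d.decayRoot z k n * d.decayRoot z k' n ^ 2 ≤ ρ := by
  have k1 := d.kappa1_pos
  have k2 := d.kappa2_pos
  have k12 := d.kappa1_lt_kappa2
  have n1 := d.Delta_nonneg d.kappa1 n
  have n2 := d.Delta_nonneg d.kappa2 n
  have hr0 : 0 < z.re := by linarith
  have ha := sq_abs (d.alphaN n)
  have ha0 := abs_nonneg (d.alphaN n)
  have l1 := d.decayRoot_lt_one hr0 hi k1 (hres n).1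
  have l2 := d.decayRoot_lt_one hr0 hi k2 (hres n).2
  have p1 := d.decayRoot_pos z d.kappa1 n
  have p2 := d.decayRoot_pos z d.kappa2 n
  by_cases h2 : |d.alphaN n| < d.kappa2
  · have e2 := d.Delta_sq_of_lt h2
    have e1 : d.Delta d.kappa1 n ≤ d.kappa2 := by
      refine abs_le_of_sq_le_sq' ?_ k2.le |>.2
      by_cases h1 : |d.alphaN n| < d.kappa1
      · rw [d.Delta_sq_of_lt h1]; nlinarith
      · rw [d.Delta_sq_of_not_lt k1 h1]; nlinarith
    have hmul : ∀ a b : ℝ, 0 < a → 0 < b → a < 1 → b < 1 → a * b ^ 2 ≤ 1 := fun a b ha hb ha' hb' =>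
      mul_le_one₀ ha'.le (by positivity) (pow_le_one₀ hb.le hb'.le)
    -- Below κ₂ all three moduli are at most κ₂, so no compensating weight is needed.
    refine ⟨d.kappa2, 1, k2.le, zero_le_one, le_rfl, h2.le, e1,
      abs_le_of_sq_le_sq' (by nlinarith) k2.le |>.2, by linarith, by nlinarith, ?_⟩
    rintro k (rfl | rfl) k' (rfl | rfl) <;> apply hmul <;> assumption
  · have h1 : ¬ |d.alphaN n| < d.kappa1 := fun h => h2 (h.trans k12)
    have e1 := d.Delta_sq_of_not_lt k1 h1
    have e2 := d.Delta_sq_of_not_lt k2 h2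
    have h21 : d.Delta d.kappa2 n ≤ d.Delta d.kappa1 n :=
      abs_le_of_sq_le_sq' (by nlinarith) n1 |>.2
    have r12 : d.decayRoot z d.kappa1 n ≤ d.decayRoot z d.kappa2 n := by
      rw [decayRoot, decayRoot, if_neg h1, if_neg h2, Real.exp_le_exp]
      nlinarith
    set r := d.decayRoot z d.kappa2 n with hrdef
    set t := d.Delta d.kappa2 n with ht
    -- This uses Re ζ ≥ 1. Together with x²/2 ≤ eˣ at x = t/2 it gives t² r ≤ 8.
    have hrt : r ≤ Real.exp (-(t / 2)) := by
      rw [hrdef, decayRoot, if_neg h2, Real.exp_le_exp]; nlinarith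
    have hE : t ^ 2 * Real.exp (-(t / 2)) ≤ 8 := by
      have := Real.quadratic_le_exp_of_nonneg (show 0 ≤ t / 2 by positivity)
      have h1 : t ^ 2 ≤ 8 * Real.exp (t / 2) := by nlinarith
      rw [Real.exp_neg, ← div_eq_mul_inv, div_le_iff₀ (Real.exp_pos _)]
      exact h1
    have hm2 : |d.alphaN n| ^ 2 = d.kappa2 ^ 2 + t ^ 2 := by linarith
    have htr : t ^ 2 * r ≤ 8 := le_trans (by gcongr) hE
    have hb : |d.alphaN n| ^ 2 * r ≤ 16 + d.kappa2 ^ 2 := by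
      rw [hm2]; nlinarith
    have hr3 : r ^ 3 ≤ r ^ 2 := pow_le_pow_of_le_one p2.le l2.le (by norm_num)
    have hr2 : r ^ 2 ≤ r := by nlinarith
    -- Since Δ₂ ≤ Δ₁, r is the larger of the two roots, and r³ dominates every product of one root
    -- with the square of another. For the fourth power of |α_n| two of the three factors suffice,
    -- each paired with |α_n|².
    refine ⟨|d.alphaN n|, r ^ 3, ha0, by positivity, pow_le_one₀ p2.le l2.le, le_rfl,
      abs_le_of_sq_le_sq' (by nlinarith) ha0 |>.2, abs_le_of_sq_le_sq' (by nlinarith) ha0 |>.2,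
      ?_, ?_, ?_⟩
    · exact le_trans (by gcongr; exact hr3.trans hr2) hb
    · calc |d.alphaN n| ^ 4 * r ^ 3 ≤ |d.alphaN n| ^ 4 * r ^ 2 := by gcongr
        _ = (|d.alphaN n| ^ 2 * r) ^ 2 := by ring
        _ ≤ _ := by gcongr
    · have : ∀ a b : ℝ, 0 < a → 0 < b → a ≤ r → b ≤ r → a * b ^ 2 ≤ r ^ 3 := fun a b h1 h2 h3 h4 =>
        calc a * b ^ 2 ≤ r * r ^ 2 := by gcongr
          _ = r ^ 3 := by ring
      rintro k (rfl | rfl) k' (rfl | rfl) <;> apply this <;> first | assumption | exact le_rfl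

end WaveData

/-- The entrywise symbol estimate, in terms of the products `E₁ = β₁ε₁`, `E₂ = β₂ε₁η`,
`d₁ = β₁δ₁`, `d₂ = β₂δ₂`. -/
theorem symbol_complex_estimates {a β₁ β₂ χ χ' E₁ E₂ d₁ d₂ : ℂ} {D ρ m T k F : ℝ}
    (hD : 0 ≤ D) (hρ0 : 0 ≤ ρ) (hρ1 : ρ ≤ 1)
    (hm : 0 ≤ m) (hT : 16 ≤ T) (hk : 0 < k) (hkT : k ≤ T) (h2 : m ^ 2 * ρ ≤ T)
    (h4 : m ^ 4 * ρ ≤ T ^ 2) (hF : 24 * (D * T ^ 2) ≤ F * k) (hFk : F ≤ 2 * k / 17)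
    (ha : ‖a‖ ≤ m) (hβ₁ : ‖β₁‖ ≤ m) (hβ₂ : ‖β₂‖ ≤ m) (hχ : k ≤ ‖χ‖)
    (hE₁ : ‖E₁‖ ≤ 2 * (D * ρ)) (hE₂ : ‖E₂‖ ≤ 2 * (D * ρ))
    (hd₁ : ‖d₁‖ ≤ 2 * (D * ρ)) (hd₂ : ‖d₂‖ ≤ 2 * (D * ρ))
    (hχ' : χ' = χ + 4 * (β₁ * d₂ - β₂ * d₁ - d₁ * d₂) * a ^ 2 / χ) :
    k / 2 ≤ ‖χ'‖ ∧
    ‖β₁ * (χ' - χ) - E₁ * a ^ 2 - β₁ * β₁ * (E₂ + 2 * d₂)‖ ≤ 3 / 2 * F ∧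
    ‖a * (χ - χ') + a * (β₂ * E₁ + 2 * (E₁ * d₂) - β₁ * E₂ + 2 * (β₁ * d₂))‖ ≤ 3 / 2 * F ∧
    ‖a * (χ' - χ) + a * (β₂ * E₁ + 2 * (E₁ * d₂) - β₁ * E₂ +
      2 * (2 * (β₂ * d₁) + 2 * (d₁ * d₂) - β₁ * d₂))‖ ≤ 3 / 2 * F ∧
    ‖β₂ * (χ' - χ) - β₂ * β₂ * E₁ - (E₂ + 2 * d₂) * a ^ 2‖ ≤ 3 / 2 * F := by
  have hχ0 : 0 < ‖χ‖ := hk.trans_le hχ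
  set e := D * ρ with he
  have he0 : 0 ≤ e := by positivity
  have n12 : ‖d₁ * d₂‖ ≤ 4 * e ^ 2 := by
    rw [norm_mul]
    calc ‖d₁‖ * ‖d₂‖ ≤ (2 * e) * (2 * e) := by gcongr
      _ = _ := by ring
  have n1 : ∀ {x y : ℂ}, ‖x‖ ≤ m → ‖y‖ ≤ 2 * e → ‖x * y‖ ≤ 2 * (m * e) := fun {x y} hx hy => by
    rw [norm_mul]
    calc ‖x‖ * ‖y‖ ≤ m * (2 * e) := by gcongr
      _ = _ := by ring
  have nE12 : ‖E₁ * d₂‖ ≤ 4 * e ^ 2 := by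
    rw [norm_mul]
    calc ‖E₁‖ * ‖d₂‖ ≤ (2 * e) * (2 * e) := by gcongr
      _ = _ := by ring
  have two : ∀ x : ℂ, ‖2 * x‖ = 2 * ‖x‖ := fun x => by rw [norm_mul]; simp
  -- Only products β_jδ_j enter χ̂ - χ: β₁β₂δ₂ = β₁d₂, β₁β₂δ₁ = β₂d₁ and β₁β₂δ₁δ₂ = d₁d₂.
  have hy : k * ‖χ' - χ‖ ≤ 4 * m ^ 2 * (4 * m * e + 4 * e ^ 2) := by
    have h : ‖χ‖ * ‖χ' - χ‖ = 4 * ‖a‖ ^ 2 * ‖β₁ * d₂ - β₂ * d₁ - d₁ * d₂‖ := by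
      rw [hχ', add_sub_cancel_left, norm_div, mul_div_cancel₀ _ hχ0.ne']
      simp only [norm_mul, norm_pow, Complex.norm_ofNat]
      ring
    calc k * ‖χ' - χ‖ ≤ ‖χ‖ * ‖χ' - χ‖ := by gcongr
      _ = _ := h
      _ ≤ 4 * m ^ 2 * (2 * (m * e) + 2 * (m * e) + 4 * e ^ 2) := by
        gcongr
        refine (norm_sub_le _ _).trans (add_le_add ((norm_sub_le _ _).trans
          (add_le_add (n1 hβ₁ hd₂) (n1 hβ₂ hd₁))) n12)
      _ = _ := by ring
  obtain ⟨hy1, hy2⟩ := symbol_real_estimates hD hρ0 hρ1 hm hT hk hkT h2 h4 hF hFk hy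
  have hme : 0 ≤ m ^ 2 * e := by positivity
  have hme2 : 0 ≤ m * e ^ 2 := by positivity
  have hYn : ∀ {x : ℂ}, ‖x‖ ≤ m → ‖x * (χ' - χ)‖ ≤ m * ‖χ' - χ‖ := fun {x} hx => by
    rw [norm_mul]; gcongr
  have q : ∀ {x y w : ℂ} {c : ℝ}, 0 ≤ c → ‖x‖ ≤ m → ‖y‖ ≤ m → ‖w‖ ≤ c →
      ‖x * y * w‖ ≤ m ^ 2 * c := fun {x y w c} h0 hx hy hw => by
    rw [norm_mul, norm_mul]
    calc ‖x‖ * ‖y‖ * ‖w‖ ≤ m * m * c := by gcongr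
      _ = _ := by ring
  have hEd : ‖E₂ + 2 * d₂‖ ≤ 6 * e := by
    refine (norm_add_le _ _).trans ?_
    rw [two]; linarith
  have hS1 : ‖β₂ * E₁ + 2 * (E₁ * d₂) - β₁ * E₂‖ ≤ 4 * (m * e) + 8 * e ^ 2 := by
    refine (norm_sub_le _ _).trans ((add_le_add_left (norm_add_le _ _) _).trans ?_)
    rw [two]
    linarith [n1 hβ₂ hE₁, n1 hβ₁ hE₂]
  refine ⟨?_, ?_, ?_, ?_, ?_⟩
  · have := norm_sub_norm_le χ (χ - χ')
    rw [sub_sub_cancel, norm_sub_rev χ χ'] at this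
    linarith
  · refine (norm_sub_le _ _).trans ((add_le_add_left (norm_sub_le _ _) _).trans ?_)
    have t1 : ‖E₁ * a ^ 2‖ ≤ m ^ 2 * (2 * e) := by
      rw [mul_comm, sq]; exact q (by positivity) ha ha hE₁
    linarith [hYn hβ₁, q (by positivity) hβ₁ hβ₁ hEd]
  · have t : ‖β₂ * E₁ + 2 * (E₁ * d₂) - β₁ * E₂ + 2 * (β₁ * d₂)‖ ≤ 8 * (m * e) + 8 * e ^ 2 := by
      refine (norm_add_le _ _).trans ?_
      rw [two]; linarith [n1 hβ₁ hd₂]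
    refine (norm_add_le _ _).trans ?_
    have t2 : ‖a * (χ - χ')‖ ≤ m * ‖χ' - χ‖ := by
      rw [norm_mul, norm_sub_rev]; gcongr
    have t3 : ‖a * (β₂ * E₁ + 2 * (E₁ * d₂) - β₁ * E₂ + 2 * (β₁ * d₂))‖ ≤
        m * (8 * (m * e) + 8 * e ^ 2) := by
      rw [norm_mul]; gcongr
    linarith
  · have t0 : ‖2 * (β₂ * d₁) + 2 * (d₁ * d₂) - β₁ * d₂‖ ≤ 6 * (m * e) + 8 * e ^ 2 := by
      refine (norm_sub_le _ _).trans ((add_le_add_left (norm_add_le _ _) _).trans ?_)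
      rw [two, two]; linarith [n1 hβ₂ hd₁, n1 hβ₁ hd₂]
    -- The lower left entry is the worst of the four; it determines the coefficients 16 and 24 in
    -- `symbol_real_estimates`.
    have t : ‖β₂ * E₁ + 2 * (E₁ * d₂) - β₁ * E₂ +
        2 * (2 * (β₂ * d₁) + 2 * (d₁ * d₂) - β₁ * d₂)‖ ≤ 16 * (m * e) + 24 * e ^ 2 := by
      refine (norm_add_le _ _).trans ?_
      rw [two]; linarith
    refine (norm_add_le _ _).trans ?_
    have t3 : ‖a * (β₂ * E₁ + 2 * (E₁ * d₂) - β₁ * E₂ +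
        2 * (2 * (β₂ * d₁) + 2 * (d₁ * d₂) - β₁ * d₂))‖ ≤ m * (16 * (m * e) + 24 * e ^ 2) := by
      rw [norm_mul]; gcongr
    linarith [hYn ha]
  · refine (norm_sub_le _ _).trans ((add_le_add_left (norm_sub_le _ _) _).trans ?_)
    have t1 : ‖(E₂ + 2 * d₂) * a ^ 2‖ ≤ m ^ 2 * (6 * e) := by
      rw [mul_comm, sq]; exact q (by positivity) ha ha hEd
    linarith [hYn hβ₂, q (by positivity) hβ₂ hβ₂ hE₁]

/-! ### The uniform bound for the difference of the symbols -/

namespace WaveData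

variable (d : WaveData)

/-- Each entry is iω²/(χχ̂) times a numerator treated by `symbol_complex_estimates`, with k = κ₁²
and T = 16 + κ₂². Of the second maximum in `F` only the last entry, 24 T²/κ₁², is needed. -/
theorem norm_M_sub_MHat_le (hres : d.NonResonant) {z : ℂ} (hr : 1 ≤ z.re) (hi : 0 < z.im)
    (hF : d.F z ≤ 2 * d.kappa1 ^ 2 / 17) (n : ℤ) (i j : Fin 2) :
    ‖(d.M n - d.MHat z n) i j‖ ≤ d.FHat z / 2 := by
  have hr0 : 0 < z.re := by linarith
  have k1 := d.kappa1_pos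
  have k2 := d.kappa2_pos
  have k12 := d.kappa1_lt_kappa2
  obtain ⟨m, ρ, hm, hρ0, hρ1, ha, hb1, hb2, h2, h4, hρ⟩ := d.exists_mode_bound hres hr hi n
  set D := d.decayMax z with hDdef
  have hD : 0 < D := d.decayMax_pos hres hi
  set e₁ := Complex.exp (Complex.I * d.beta1 n * z) with he₁
  set e₂ := Complex.exp (Complex.I * d.beta2 n * z) with he₂
  have ne₁ : ‖e₁‖ = d.decayRoot z d.kappa1 n ^ 2 := d.norm_exp_beta k1 z n
  have ne₂ : ‖e₂‖ = d.decayRoot z d.kappa2 n ^ 2 := d.norm_exp_beta k2 z n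
  have l1 := d.decayRoot_lt_one hr0 hi k1 (hres n).1
  have l2 := d.decayRoot_lt_one hr0 hi k2 (hres n).2
  have p1 := d.decayRoot_pos z d.kappa1 n
  have p2 := d.decayRoot_pos z d.kappa2 n
  have hh1 : ‖d.beta1 n * e₁ / (1 - e₁ ^ 2)‖ ≤ D * d.decayRoot z d.kappa1 n := by
    refine norm_mul_div_one_sub_sq_le p1 l1 ne₁ ?_
    rw [beta1, d.norm_beta k1]
    exact d.Delta_mul_decayRoot_le hr0 hi le_rfl (fun n => (hres n).1) (le_max_left _ _) n
  have hh2 : ‖d.beta2 n * e₂ / (1 - e₂ ^ 2)‖ ≤ D * d.decayRoot z d.kappa2 n := by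
    refine norm_mul_div_one_sub_sq_le p2 l2 ne₂ ?_
    rw [beta2, d.norm_beta k2]
    exact d.Delta_mul_decayRoot_le hr0 hi k12.le (fun n => (hres n).2) (le_max_right _ _) n
  set h₁ := d.beta1 n * e₁ / (1 - e₁ ^ 2) with hh₁
  set h₂ := d.beta2 n * e₂ / (1 - e₂ ^ 2) with hh₂
  have m1 : d.kappa1 ∈ ({d.kappa1, d.kappa2} : Set ℝ) := by simp
  have m2 : d.kappa2 ∈ ({d.kappa1, d.kappa2} : Set ℝ) := by simp
  -- All small quantities are combinations of products h_j e_k: the first factor contributes D r,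
  -- the second r'².
  have b : ∀ {h e : ℂ} {r r' : ℝ}, ‖h‖ ≤ D * r → ‖e‖ = r' ^ 2 → r * r' ^ 2 ≤ ρ →
      ‖h * e‖ ≤ D * ρ := fun {h e r r'} x y w => by
    rw [norm_mul, y]
    calc ‖h‖ * r' ^ 2 ≤ D * r * r' ^ 2 := by gcongr
      _ = D * (r * r' ^ 2) := by ring
      _ ≤ _ := by gcongr
  have b11 := b hh1 ne₁ (hρ _ m1 _ m1)
  have b12 := b hh1 ne₂ (hρ _ m1 _ m2)
  have b21 := b hh2 ne₁ (hρ _ m2 _ m1)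
  have b22 := b hh2 ne₂ (hρ _ m2 _ m2)
  have hne : ∀ {e : ℂ} {r : ℝ}, ‖e‖ = r ^ 2 → 0 < r → r < 1 → 1 - e ^ 2 ≠ 0 :=
    fun {e r} h h0 h1 hz => by
      have : ‖e ^ 2‖ = 1 := by rw [← sub_eq_zero.1 hz, norm_one]
      rw [norm_pow, h, ← pow_mul] at this
      exact (pow_lt_one₀ h0.le h1 (by norm_num : 2 * 2 ≠ 0)).ne this
  have z1 := hne ne₁ p1 l1
  have z2 := hne ne₂ p2 l2
  have x1 : e₁ ≠ 0 := Complex.exp_ne_zero _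
  have x2 : e₂ ≠ 0 := Complex.exp_ne_zero _
  have i1 : Complex.exp (-(Complex.I * d.beta1 n * z)) = e₁⁻¹ := Complex.exp_neg _
  have i2 : Complex.exp (-(Complex.I * d.beta2 n * z)) = e₂⁻¹ := Complex.exp_neg _
  have s1 : e₁⁻¹ - e₁ = (1 - e₁ ^ 2) / e₁ := by field_simp
  have s2 : e₂⁻¹ - e₂ = (1 - e₂ ^ 2) / e₂ := by field_simp
  have hE₁ : d.beta1 n * d.eps1 z n = 2 * (h₁ * e₁) := by
    rw [eps1, coth, neg_neg, i1, ← he₁, s1, hh₁]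
    field_simp
    ring
  -- The factor η is not estimated alone: its numerator is the denominator of ε₁ and cancels.
  have hε : d.eps1 z n * d.eta z n = 2 * (e₂ / (1 - e₂ ^ 2) * e₁) := by
    rw [eps1, coth, neg_neg, eta, i1, i2, ← he₁, ← he₂, s1, s2]
    field_simp
    ring
  have hE₂ : d.beta2 n * (d.eps1 z n * d.eta z n) = 2 * (h₂ * e₁) := by
    rw [hε, hh₂]; ring
  have hd₁ : d.beta1 n * d.del1 z n = h₁ * e₂ - h₁ * e₁ := by
    rw [del1, del, i1, ← he₁, ← he₂, s1, hh₁]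
    field_simp
  have hd₂ : d.beta2 n * d.del2 z n = h₂ * e₂ - h₂ * e₁ := by
    rw [del2, del, i2, ← he₁, ← he₂, s2, hh₂]
    field_simp
  have hχ' : d.chiHat z n = d.chi n + 4 * (d.beta1 n * (d.beta2 n * d.del2 z n) -
      d.beta2 n * (d.beta1 n * d.del1 z n) -
      (d.beta1 n * d.del1 z n) * (d.beta2 n * d.del2 z n)) * (d.alphaN n : ℂ) ^ 2 / d.chi n := by
    rw [chiHat]; ring
  have two : ∀ x : ℂ, ‖2 * x‖ = 2 * ‖x‖ := fun x => by rw [norm_mul]; simp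
  have k1sq : 0 < d.kappa1 ^ 2 := by positivity
  have hFle : 24 * (D * (16 + d.kappa2 ^ 2) ^ 2) ≤ d.F z * d.kappa1 ^ 2 := by
    have := mul_le_mul_of_nonneg_left d.le_factor hD.le
    rw [← F_eq, ← mul_div_assoc, div_le_iff₀ k1sq] at this
    linarith
  obtain ⟨c0, c11, c12, c21, c22⟩ := symbol_complex_estimates (E₁ := d.beta1 n * d.eps1 z n)
    (E₂ := d.beta2 n * (d.eps1 z n * d.eta z n)) hD.le hρ0 hρ1 hm
    (by nlinarith : (16 : ℝ) ≤ 16 + d.kappa2 ^ 2) k1sq (by nlinarith) h2 h4 hFle hF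
    (a := (d.alphaN n : ℂ)) (by rwa [Complex.norm_real]) (by rwa [beta1, d.norm_beta k1])
    (by rwa [beta2, d.norm_beta k2]) (d.kappa1_sq_le_norm_chi n)
    (by rw [hE₁, two]; linarith) (by rw [hE₂, two]; linarith)
    (by rw [hd₁]; linarith [norm_sub_le (h₁ * e₂) (h₁ * e₁)])
    (by rw [hd₂]; linarith [norm_sub_le (h₂ * e₂) (h₂ * e₁)]) hχ'
  have hχ0 := d.chi_ne_zero n
  have hχ'0 : d.chiHat z n ≠ 0 := norm_pos_iff.1 (by linarith)
  have hF0 : 0 ≤ d.F z := by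
    rw [F_eq]; exact mul_nonneg hD.le d.factor_pos.le
  -- The bounds |χ| ≥ κ₁² and |χ̂| ≥ κ₁²/2 give 3 ω²F/κ₁⁴, well below F̂/2 = (17/2) ω²F/κ₁⁴.
  have fin : ∀ {x y : ℂ}, x = Complex.I * d.freq ^ 2 / (d.chi n * d.chiHat z n) * y →
      ‖y‖ ≤ 3 / 2 * d.F z → ‖x‖ ≤ d.FHat z / 2 := fun {x y} hx hy => by
    rw [hx, norm_mul, norm_div, norm_mul, norm_mul, norm_pow, Complex.norm_I, one_mul,
      Complex.norm_real, Real.norm_of_nonneg d.freq_pos.le]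
    have hω := d.freq_pos
    calc d.freq ^ 2 / (‖d.chi n‖ * ‖d.chiHat z n‖) * ‖y‖
        ≤ d.freq ^ 2 / (d.kappa1 ^ 2 * (d.kappa1 ^ 2 / 2)) * (3 / 2 * d.F z) := by
          gcongr; exact d.kappa1_sq_le_norm_chi n
      _ = 3 * (d.freq ^ 2 * d.F z / d.kappa1 ^ 4) := by field_simp
      _ ≤ 17 / 2 * (d.freq ^ 2 * d.F z / d.kappa1 ^ 4) := by
          gcongr; norm_num
      _ = _ := by rw [FHat]; ring
  fin_cases i <;> fin_cases j
  · refine fin ?_ c11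
    simp [M, MHat]
    field_simp
    ring
  · refine fin ?_ c12
    simp [M, MHat]
    field_simp
    ring
  · refine fin ?_ c21
    simp [M, MHat]
    field_simp
    ring
  · refine fin ?_ c22
    simp [M, MHat]
    field_simp
    ring

end WaveData

/-! ## Solvability of variational problems -/

section Hilbert

variable {E : Type*} [NormedAddCommGroup E] [InnerProductSpace ℂ E] [CompleteSpace E]

/-- A finite rank perturbation of the identity that is injective is surjective. -/
theorem surjective_id_sub_of_finite_rank {X : Type*} [AddCommGroup X] [Module ℂ X]
    (T : X →ₗ[ℂ] X) [FiniteDimensional ℂ (LinearMap.range T)]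
    (hinj : ∀ x, x - T x = 0 → x = 0) (y : X) : ∃ x, x - T x = y := by
  let S : LinearMap.range T →ₗ[ℂ] LinearMap.range T :=
    LinearMap.id - T.restrict (fun x _ => LinearMap.mem_range_self T x)
  have hS : Function.Injective S := by
    rw [injective_iff_map_eq_zero]
    intro x hx
    exact Subtype.ext (hinj x (by simpa [S] using congrArg Subtype.val hx))
  obtain ⟨r, hr⟩ := LinearMap.injective_iff_surjective.1 hS ⟨T y, y, rfl⟩
  refine ⟨y + r, ?_⟩
  have := congrArg Subtype.val hr
  simp only [S, LinearMap.sub_apply, LinearMap.id_apply, AddSubgroupClass.coe_sub,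
    LinearMap.coe_restrict_apply] at this
  rw [map_add, ← this]
  abel

/-- Lax–Milgram for a bounded operator with coercive real part. -/
theorem bijective_of_coercive (C : E →L[ℂ] E) {c : ℝ} (hc : 0 < c)
    (h : ∀ u, c * ‖u‖ ^ 2 ≤ (inner ℂ u (C u)).re) : Function.Bijective C := by
  have hb : ∀ u, c * ‖u‖ ≤ ‖C u‖ := fun u => by
    rcases eq_or_ne u 0 with rfl | hu
    · simp
    have h1 := (h u).trans ((Complex.re_le_norm _).trans (norm_inner_le_norm u (C u)))
    have h2 : 0 < ‖u‖ := norm_pos_iff.2 hu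
    refine le_of_mul_le_mul_right ?_ h2
    linarith
  have hanti : AntilipschitzWith (Real.toNNReal c⁻¹) C := by
    refine AddMonoidHomClass.antilipschitz_of_bound C fun x => ?_
    rw [Real.coe_toNNReal _ (by positivity), inv_mul_eq_div, le_div_iff₀ hc, mul_comm]
    exact hb x
  refine ⟨hanti.injective, ?_⟩
  have hcl : IsClosed (Set.range C) := hanti.isClosed_range C.uniformContinuous
  have hcl' : IsClosed ((LinearMap.range C.toLinearMap : Submodule ℂ E) : Set E) := by
    exact hcl
  have hco : CompleteSpace (LinearMap.range C.toLinearMap) := hcl'.completeSpace_coe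
  have hbot : (LinearMap.range C.toLinearMap)ᗮ = ⊥ := by
    rw [Submodule.eq_bot_iff]
    intro x hx
    have := (Submodule.mem_orthogonal' _ _).1 hx (C x) ⟨x, rfl⟩
    have h2 := h x
    rw [this, Complex.zero_re] at h2
    have h3 : ‖x‖ ^ 2 ≤ 0 := by nlinarith [sq_nonneg ‖x‖]
    exact norm_eq_zero.1 (by nlinarith [norm_nonneg x])
  rw [Submodule.orthogonal_eq_bot_iff] at hbot
  exact LinearMap.range_eq_top.1 hbot

/-- The operator of a bounded sesquilinear form. -/
theorem exists_operator_of_form (a : E →ₗ[ℂ] E →ₗ⋆[ℂ] ℂ) (K : ℝ)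
    (ha : ∀ u v, ‖a u v‖ ≤ K * ‖u‖ * ‖v‖) :
    ∃ A : E →L[ℂ] E, ∀ u v, inner ℂ v (A u) = a u v := by
  let B : E →ₗ⋆[ℂ] E →ₗ[ℂ] ℂ := LinearMap.mk₂'ₛₗ (starRingEnd ℂ) (RingHom.id ℂ)
    (fun u v => conj (a u v)) (fun _ _ _ => by simp) (fun _ _ _ => by simp)
    (fun _ _ _ => by simp) (fun _ _ _ => by simp)
  have hB : ∀ u v, ‖B u v‖ ≤ K * ‖u‖ * ‖v‖ := fun u v => by
    simpa [B] using ha u v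
  refine ⟨InnerProductSpace.continuousLinearMapOfBilin (B.mkContinuous₂ K hB), fun u v => ?_⟩
  rw [← inner_conj_symm, InnerProductSpace.continuousLinearMapOfBilin_apply]
  simp [B]

/-- Represent ℓ_k by y_k and put K = ∑ ℓ_k(·) y_k. Then ⟨u, Ku⟩ = ∑ |ℓ_k u|², so A + K is coercive,
hence invertible, and A = (A + K)(1 - T) with T = (A + K)⁻¹K of finite rank. For 1 - T injectivity
gives surjectivity. -/
theorem bijective_of_garding (A : E →L[ℂ] E) {ι : Type*} [Fintype ι] (ℓ : ι → E →L[ℂ] ℂ)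
    {c : ℝ} (hc : 0 < c)
    (hg : ∀ u, c * ‖u‖ ^ 2 ≤ (inner ℂ u (A u)).re + ∑ k, ‖ℓ k u‖ ^ 2)
    (hinj : ∀ u, A u = 0 → u = 0) : Function.Bijective A := by
  let y : ι → E := fun k => (InnerProductSpace.toDual ℂ E).symm (ℓ k)
  let K : E →L[ℂ] E := ∑ k, (ℓ k).smulRight (y k)
  have hK : ∀ u, K u = ∑ k, ℓ k u • y k := fun u => by
    simp [K]
  have hC : ∀ u, c * ‖u‖ ^ 2 ≤ (inner ℂ u ((A + K) u)).re := fun u => by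
    refine (hg u).trans (le_of_eq ?_)
    rw [add_apply, inner_add_right, Complex.add_re, hK, inner_sum,
      Complex.re_sum]
    congr 1
    refine Finset.sum_congr rfl fun k _ => ?_
    rw [inner_smul_right, ← inner_conj_symm, InnerProductSpace.toDual_symm_apply,
      Complex.mul_conj, Complex.ofReal_re, Complex.normSq_eq_norm_sq]
  let e := LinearEquiv.ofBijective (A + K).toLinearMap (bijective_of_coercive (A + K) hc hC)
  have he : ∀ x, e x = A x + K x := fun x => rfl
  let T : E →ₗ[ℂ] E := e.symm.toLinearMap ∘ₗ K.toLinearMap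
  have hfin : FiniteDimensional ℂ (LinearMap.range T) := by
    have hle : LinearMap.range T ≤ Submodule.span ℂ (Set.range fun k => e.symm (y k)) := by
      rintro _ ⟨u, rfl⟩
      simp only [T, LinearMap.comp_apply, ContinuousLinearMap.coe_coe, hK,
        LinearEquiv.coe_coe, map_sum, map_smul]
      exact Submodule.sum_mem _ fun k _ =>
        Submodule.smul_mem _ _ (Submodule.subset_span ⟨k, rfl⟩)
    have : FiniteDimensional ℂ (Submodule.span ℂ (Set.range fun k => e.symm (y k))) :=
      FiniteDimensional.span_of_finite ℂ (Set.finite_range _)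
    exact Submodule.finiteDimensional_of_le hle
  have hAT : ∀ x, A x = e (x - T x) := fun x => by
    have : e (T x) = K x := by simp [T]
    rw [map_sub, this, he]; simp
  refine ⟨(injective_iff_map_eq_zero A).2 hinj, fun w => ?_⟩
  obtain ⟨x, hx⟩ := surjective_id_sub_of_finite_rank T (fun x hx => hinj x (by
    rw [hAT, hx, map_zero])) (e.symm w)
  exact ⟨x, by rw [hAT, hx, LinearEquiv.apply_symm_apply]⟩

/-- Operators close to one that is bijective and bounded below are bijective. -/
theorem bijective_of_norm_sub_le (A B : E →L[ℂ] E) (hA : Function.Bijective A) {γ η : ℝ}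
    (hη0 : 0 ≤ η) (hη : η < γ) (hb : ∀ u, γ * ‖u‖ ≤ ‖A u‖) (hAB : ∀ u, ‖A u - B u‖ ≤ η * ‖u‖) :
    Function.Bijective B := by
  have hγ : 0 < γ := hη0.trans_lt hη
  let e := ContinuousLinearEquiv.ofBijective A (LinearMap.ker_eq_bot.2 hA.1)
    (LinearMap.range_eq_top.2 hA.2)
  have he : ∀ x, e x = A x := fun x => rfl
  -- T = A⁻¹(A - B) has norm at most η/γ < 1, and B = A(1 - T).
  let T : E →L[ℂ] E := (e.symm : E →L[ℂ] E) ∘L (A - B)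
  have hT : ‖T‖ < 1 := by
    refine lt_of_le_of_lt (ContinuousLinearMap.opNorm_le_bound _ (div_nonneg hη0 hγ.le)
      fun x => ?_) ((div_lt_one hγ).2 hη)
    have h1 := hb (T x)
    have h2 : A (T x) = A x - B x := by rw [← he]; simp [T]
    rw [h2] at h1
    rw [div_mul_eq_mul_div, le_div_iff₀ hγ, mul_comm]
    exact h1.trans (hAB x)
  have hu : IsUnit (1 - T) := isUnit_one_sub_of_norm_lt_one hT
  obtain ⟨U, hU⟩ := hu
  have hbij : Function.Bijective (1 - T : E →L[ℂ] E) := by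
    rw [← hU]
    exact (ContinuousLinearEquiv.unitsEquiv ℂ E U).bijective
  have hcomp : (B : E → E) = A ∘ (1 - T : E →L[ℂ] E) := by
    funext x
    have h2 : A (T x) = A x - B x := by rw [← he]; simp [T]
    simp [h2]
  rw [hcomp]
  exact hA.comp hbij

end Hilbert

/-- Unique solvability of a perturbed variational problem on a space `X` that is identified by `J`
with a complete subspace of a Hilbert space: the unperturbed form `a` satisfies a Gårding
inequality up to finitely many functionals and an inf-sup condition. -/
theorem existsUnique_of_garding_of_infSup {X H : Type*} [AddCommGroup X] [Module ℂ X]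
    [NormedAddCommGroup H] [InnerProductSpace ℂ H] (J : X →ₗ[ℂ] H) (hJ : Function.Injective J)
    (hcomp : IsComplete (Set.range J)) (a b : X →ₗ[ℂ] X →ₗ⋆[ℂ] ℂ) {K η γ c : ℝ}
    (ha : ∀ u v, ‖a u v‖ ≤ K * ‖J u‖ * ‖J v‖) (hη0 : 0 ≤ η) (hη : η < γ)
    (hab : ∀ u v, ‖a u v - b u v‖ ≤ η * ‖J u‖ * ‖J v‖)
    {ι : Type*} [Fintype ι] (ℓ : ι → X →ₗ[ℂ] ℂ) (hℓ : ∀ k, ∃ C, ∀ u, ‖ℓ k u‖ ≤ C * ‖J u‖)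
    (hc : 0 < c) (hg : ∀ u, c * ‖J u‖ ^ 2 ≤ (a u u).re + ∑ k, ‖ℓ k u‖ ^ 2)
    (his : ∀ u B, 0 ≤ B → (∀ v, ‖a u v‖ ≤ B * ‖J v‖) → γ * ‖J u‖ ≤ B)
    (L : X →ₗ⋆[ℂ] ℂ) (hL : ∃ C, ∀ v, ‖L v‖ ≤ C * ‖J v‖) :
    ∃! u, ∀ v, b u v = L v := by
  have hc' : CompleteSpace (LinearMap.range J) := by
    have : IsComplete ((LinearMap.range J : Submodule ℂ H) : Set H) := hcomp
    exact this.completeSpace_coe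
  let e : X ≃ₗ[ℂ] LinearMap.range J := LinearEquiv.ofInjective J hJ
  have hn : ∀ x, ‖J (e.symm x)‖ = ‖x‖ := fun x => by
    have : J (e.symm x) = ((e (e.symm x) : LinearMap.range J) : H) := rfl
    rw [this, LinearEquiv.apply_symm_apply]; rfl
  let tr : (X →ₗ[ℂ] X →ₗ⋆[ℂ] ℂ) → LinearMap.range J →ₗ[ℂ] LinearMap.range J →ₗ⋆[ℂ] ℂ := fun f =>
    LinearMap.mk₂'ₛₗ (RingHom.id ℂ) (starRingEnd ℂ) (fun u v => f (e.symm u) (e.symm v))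
      (fun _ _ _ => by simp) (fun _ _ _ => by simp) (fun _ _ _ => by simp) (fun _ _ _ => by simp)
  have htr : ∀ f u v, tr f u v = f (e.symm u) (e.symm v) := fun f u v => rfl
  obtain ⟨A, hA⟩ := exists_operator_of_form (tr a) K fun u v => by
    simpa only [htr, hn] using ha (e.symm u) (e.symm v)
  obtain ⟨B, hB⟩ := exists_operator_of_form (tr b) (K + η) fun u v => by
    have h1 := ha (e.symm u) (e.symm v)
    have h2 := hab (e.symm u) (e.symm v)
    have h3 := norm_sub_le (a (e.symm u) (e.symm v)) (a (e.symm u) (e.symm v) -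
      b (e.symm u) (e.symm v))
    rw [sub_sub_cancel] at h3
    simp only [hn] at h1 h2
    rw [htr]
    linarith
  choose Cl hCl using hℓ
  let ℓ' : ι → LinearMap.range J →L[ℂ] ℂ := fun k =>
    ((ℓ k) ∘ₗ e.symm.toLinearMap).mkContinuous (Cl k) fun x => by
      simpa [hn] using hCl k (e.symm x)
  -- By Cauchy–Schwarz, ‖A u‖ is an admissible bound for v ↦ a(u, v) in the inf-sup hypothesis.
  have hAb : ∀ u, γ * ‖u‖ ≤ ‖A u‖ := fun u => by
    have := his (e.symm u) ‖A u‖ (norm_nonneg _) fun v => by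
      have h1 := norm_inner_le_norm (𝕜 := ℂ) (e v) (A u)
      rw [hA, htr, LinearEquiv.symm_apply_apply, ← hn (e v), LinearEquiv.symm_apply_apply] at h1
      linarith
    rwa [hn] at this
  have hγ : 0 < γ := hη0.trans_lt hη
  have hAbij : Function.Bijective A := by
    refine bijective_of_garding A ℓ' hc (fun u => ?_) fun u hu => ?_
    · have := hg (e.symm u)
      rw [hn] at this
      rw [hA, htr]
      exact this
    · have := hAb u
      rw [hu, norm_zero] at this
      exact norm_eq_zero.1 (by nlinarith [norm_nonneg u])
  have hBbij : Function.Bijective B := by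
    refine bijective_of_norm_sub_le A B hAbij hη0 hη hAb fun u => ?_
    -- Testing with v = A u - B u turns the bound on the forms into one on the operators.
    have h1 : inner ℂ (A u - B u) (A u - B u) =
        a (e.symm u) (e.symm (A u - B u)) - b (e.symm u) (e.symm (A u - B u)) := by
      rw [inner_sub_right, hA, hB, htr, htr]
    have h2 := hab (e.symm u) (e.symm (A u - B u))
    rw [← h1, hn, hn, inner_self_eq_norm_sq_to_K, norm_pow, RCLike.norm_ofReal,
      abs_of_nonneg (norm_nonneg _)] at h2
    rcases eq_or_ne (A u - B u) 0 with h0 | h0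
    · rw [h0, norm_zero]; positivity
    · refine le_of_mul_le_mul_right ?_ (norm_pos_iff.2 h0)
      linarith
  obtain ⟨CL, hCL⟩ := hL
  -- Conjugation makes the functional linear, so that Riesz representation applies.
  let L' : LinearMap.range J →L[ℂ] ℂ := LinearMap.mkContinuous
    { toFun := fun v => conj (L (e.symm v))
      map_add' := fun _ _ => by simp
      map_smul' := fun _ _ => by simp } CL fun x => by
        simpa [hn] using hCL (e.symm x)
  let y := (InnerProductSpace.toDual ℂ (LinearMap.range J)).symm L'
  have hy : ∀ v, inner ℂ v y = L (e.symm v) := fun v => by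
    rw [← inner_conj_symm, InnerProductSpace.toDual_symm_apply]
    simp [L']
  obtain ⟨u, hu⟩ := hBbij.2 y
  refine ⟨e.symm u, fun v => ?_, fun w hw => ?_⟩
  · have h1 := hB u (e v)
    rw [htr, LinearEquiv.symm_apply_apply, hu, hy, LinearEquiv.symm_apply_apply] at h1
    exact h1.symm
  · have : B (e w) = y := by
      refine ext_inner_left ℂ fun v => ?_
      rw [hB, htr, hy, LinearEquiv.symm_apply_apply, hw]
    rw [← hBbij.1 (this.trans hu.symm), LinearEquiv.symm_apply_apply]

/-! ## Quasi-periodic Fourier series on intervals and rectangles -/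

theorem memLp_of_continuous_Ioo {p q : ℝ} {f : ℝ → ℂ} (hf : Continuous f) {r : ℝ≥0∞} :
    MemLp f r (volume.restrict (Ioo p q)) := by
  obtain ⟨C, hC⟩ := isCompact_Icc.exists_bound_of_continuousOn (s := Icc p q) hf.continuousOn
  refine MemLp.of_bound hf.aestronglyMeasurable C ?_
  filter_upwards [ae_restrict_mem measurableSet_Ioo] with x hx
  exact hC x (Ioo_subset_Icc_self hx)

theorem norm_exp_neg_I_mul (a x : ℝ) : ‖Complex.exp (-(Complex.I * (a : ℂ) * x))‖ = 1 := by
  rw [Complex.norm_exp]; simp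

/-- Parseval's identity for the system `e^{i(α + 2πn/(q-p))x}` on `(p, q)`. -/
theorem hasSum_sq_norm_integral_exp {p q : ℝ} (hpq : p < q) (α : ℝ) {f : ℝ → ℂ}
    (hf : MemLp f 2 (volume.restrict (Ioo p q))) :
    HasSum (fun n : ℤ => ‖∫ x in Ioo p q, f x *
        Complex.exp (-(Complex.I * ((α + n * (2 * Real.pi / (q - p)) : ℝ) : ℂ) * x))‖ ^ 2)
      ((q - p) * ∫ x in Ioo p q, ‖f x‖ ^ 2) := by
  have hT : 0 < q - p := sub_pos.2 hpq
  -- The twist by e^{-iαx} reduces to ordinary Fourier coefficients without changing moduli; an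
  -- additional unimodular factor from the choice of the interval is not present, as both systems
  -- use the same coordinate.
  let g : ℝ → ℂ := fun x => Complex.exp (-(Complex.I * α * x)) * f x
  have hnorm : ∀ x, ‖g x‖ = ‖f x‖ := fun x => by
    rw [norm_mul, norm_exp_neg_I_mul, one_mul]
  have hg : MemLp g 2 (volume.restrict (Ioc p q)) := by
    rw [← restrict_Ioo_eq_restrict_Ioc]
    refine hf.of_le (((by fun_prop : Continuous fun x : ℝ =>
      Complex.exp (-(Complex.I * α * x))).aestronglyMeasurable).mul hf.1) ?_
    exact Filter.Eventually.of_forall fun x => (hnorm x).le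
  have key := (hasSum_sq_fourierCoeffOn hpq hg).mul_left ((q - p) ^ 2)
  have hcoef : ∀ n : ℤ, ‖∫ x in Ioo p q, f x *
      Complex.exp (-(Complex.I * ((α + n * (2 * Real.pi / (q - p)) : ℝ) : ℂ) * x))‖ ^ 2 =
      (q - p) ^ 2 * ‖fourierCoeffOn hpq g n‖ ^ 2 := fun n => by
    rw [fourierCoeffOn_eq_integral, norm_smul, intervalIntegral.integral_of_le hpq.le,
      ← restrict_Ioo_eq_restrict_Ioc, Real.norm_of_nonneg (by positivity), mul_pow, ← mul_assoc,
      ← mul_pow, mul_one_div_cancel hT.ne', one_pow, one_mul]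
    congr 3
    funext x
    rw [fourier_coe_apply, smul_eq_mul, ← mul_assoc, ← Complex.exp_add, mul_comm]
    congr 2
    push_cast
    have : ((q : ℂ) - p) ≠ 0 := by exact_mod_cast hT.ne'
    field_simp
    ring
  have e : (q - p) ^ 2 * ((q - p)⁻¹ • ∫ x in p..q, ‖g x‖ ^ 2) =
      (q - p) * ∫ x in Ioo p q, ‖f x‖ ^ 2 := by
    rw [intervalIntegral.integral_of_le hpq.le, ← restrict_Ioo_eq_restrict_Ioc]
    simp only [hnorm, smul_eq_mul]
    field_simp
  rw [e] at key
  simpa only [hcoef] using key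

theorem ae_eq_zero_of_integral_exp_eq_zero {p q : ℝ} (hpq : p < q) (α : ℝ) {f : ℝ → ℂ}
    (hf : MemLp f 2 (volume.restrict (Ioo p q)))
    (h : ∀ n : ℤ, ∫ x in Ioo p q, f x *
        Complex.exp (-(Complex.I * ((α + n * (2 * Real.pi / (q - p)) : ℝ) : ℂ) * x)) = 0) :
    f =ᵐ[volume.restrict (Ioo p q)] 0 := by
  have h1 := hasSum_sq_norm_integral_exp hpq α hf
  simp only [h, norm_zero, ne_eq, OfNat.ofNat_ne_zero, not_false_eq_true, zero_pow] at h1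
  have h2 := h1.unique hasSum_zero
  have h3 : ∫ x in Ioo p q, ‖f x‖ ^ 2 = 0 :=
    (mul_eq_zero.1 h2).resolve_left (sub_pos.2 hpq).ne'
  rw [integral_eq_zero_iff_of_nonneg (fun _ => by positivity)
    ((memLp_two_iff_integrable_sq_norm hf.1).1 hf)] at h3
  filter_upwards [h3] with x hx
  simpa using hx

theorem integral_exp_period {p q : ℝ} (hpq : p < q) {k : ℤ} (hk : k ≠ 0) :
    ∫ x in Ioo p q, Complex.exp (Complex.I * ((k * (2 * Real.pi / (q - p)) : ℝ) : ℂ) * x) = 0 := by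
  have hT : 0 < q - p := sub_pos.2 hpq
  have hc : Complex.I * ((k * (2 * Real.pi / (q - p)) : ℝ) : ℂ) ≠ 0 := by
    refine mul_ne_zero Complex.I_ne_zero (Complex.ofReal_ne_zero.2 ?_)
    have : (k : ℝ) ≠ 0 := by exact_mod_cast hk
    have := Real.pi_pos
    positivity
  rw [restrict_Ioo_eq_restrict_Ioc, ← intervalIntegral.integral_of_le hpq.le,
    integral_exp_mul_complex hc, div_eq_zero_iff]
  left
  rw [sub_eq_zero, Complex.exp_eq_exp_iff_exists_int]
  refine ⟨k, ?_⟩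
  have : ((q : ℂ) - p) ≠ 0 := by exact_mod_cast hT.ne'
  push_cast
  field_simp
  ring

/-- Completeness of the exponentials on a rectangle. -/
theorem ae_eq_zero_of_integral_exp_mul_exp_eq_zero {p q r s : ℝ} (hpq : p < q) (hrs : r < s)
    (α α' : ℝ) {f : ℝ × ℝ → ℂ} (hfm : StronglyMeasurable f)
    (hf : MemLp f 2 ((volume.restrict (Ioo p q)).prod (volume.restrict (Ioo r s))))
    (h : ∀ n m : ℤ, ∫ z, f z *
        (Complex.exp (-(Complex.I * ((α + n * (2 * Real.pi / (q - p)) : ℝ) : ℂ) * z.1)) *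
        Complex.exp (-(Complex.I * ((α' + m * (2 * Real.pi / (s - r)) : ℝ) : ℂ) * z.2)))
        ∂((volume.restrict (Ioo p q)).prod (volume.restrict (Ioo r s))) = 0) :
    f =ᵐ[(volume.restrict (Ioo p q)).prod (volume.restrict (Ioo r s))] 0 := by
  let e : ℤ → ℝ → ℂ := fun m y =>
    Complex.exp (-(Complex.I * ((α' + m * (2 * Real.pi / (s - r)) : ℝ) : ℂ) * y))
  have he : ∀ m y, ‖e m y‖ = 1 := fun m y => norm_exp_neg_I_mul _ _
  have hec : ∀ m, Continuous (e m) := fun m => by fun_prop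
  have hsq := (memLp_two_iff_integrable_sq_norm hf.1).1 hf
  have hslice : ∀ᵐ x ∂(volume.restrict (Ioo p q)),
      MemLp (fun y => f (x, y)) 2 (volume.restrict (Ioo r s)) := by
    filter_upwards [hsq.prod_right_ae] with x hx
    exact (memLp_two_iff_integrable_sq_norm
      (hfm.comp_measurable (by fun_prop)).aestronglyMeasurable).2 hx
  -- A single coefficient of a slice is bounded by Parseval's sum, whose value is (s - r) ∫ |f(x,
  -- ·)|², integrable in x by Fubini.
  have hF : ∀ m, MemLp (fun x => ∫ y in Ioo r s, f (x, y) * e m y) 2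
      (volume.restrict (Ioo p q)) := fun m => by
    have hm : AEStronglyMeasurable (fun x => ∫ y in Ioo r s, f (x, y) * e m y)
        (volume.restrict (Ioo p q)) := by
      refine AEStronglyMeasurable.integral_prod_right' (f := fun z : ℝ × ℝ => f z * e m z.2) ?_
      exact hf.1.mul ((hec m).comp continuous_snd).aestronglyMeasurable
    rw [memLp_two_iff_integrable_sq_norm hm]
    refine (hsq.integral_prod_left.const_mul (s - r)).mono' (hm.norm.pow 2) ?_
    filter_upwards [hslice] with x hx
    rw [Real.norm_of_nonneg (by positivity)]
    exact le_hasSum (hasSum_sq_norm_integral_exp hrs α' hx) m fun _ _ => by positivity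
  have hcoeff : ∀ n m : ℤ, ∫ x in Ioo p q, (∫ y in Ioo r s, f (x, y) * e m y) *
      Complex.exp (-(Complex.I * ((α + n * (2 * Real.pi / (q - p)) : ℝ) : ℂ) * x)) = 0 :=
    fun n m => by
      rw [← h n m, integral_prod]
      · refine integral_congr_ae (Filter.Eventually.of_forall fun x => ?_)
        simp only [← integral_mul_const, e]
        refine integral_congr_ae (Filter.Eventually.of_forall fun y => ?_)
        simp only
        ring
      · refine (hf.integrable (by norm_num)).mono (hf.1.mul (Continuous.aestronglyMeasurable
          (by fun_prop))) (Filter.Eventually.of_forall fun z => ?_)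
        rw [norm_mul, norm_mul, norm_exp_neg_I_mul, norm_exp_neg_I_mul, mul_one, mul_one]
  -- Completeness in x is applied for each m. As there are countably many m, one null set serves
  -- all, and completeness in y finishes.
  have hzero : ∀ᵐ x ∂(volume.restrict (Ioo p q)), ∀ m, ∫ y in Ioo r s, f (x, y) * e m y = 0 :=
    ae_all_iff.2 fun m => ae_eq_zero_of_integral_exp_eq_zero hpq α (hF m) fun n => hcoeff n m
  have hms : MeasurableSet {z | f z = (0 : ℝ × ℝ → ℂ) z} :=
    hfm.measurable (measurableSet_singleton 0)
  refine (Measure.ae_prod_iff_ae_ae hms).2 ?_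
  filter_upwards [hzero, hslice] with x hx hx2
  exact ae_eq_zero_of_integral_exp_eq_zero hrs α' hx2 hx

/-- Bessel's inequality for an orthogonal family with weights. -/
theorem sum_weighted_inner_sq_le {E ι : Type*} [NormedAddCommGroup E] [InnerProductSpace ℂ E]
    {v : ι → E} (hv : Pairwise fun i j => inner ℂ (v i) (v j) = 0) {w : ι → ℝ}
    (hw0 : ∀ i, 0 ≤ w i) (hw : ∀ i, w i * ‖v i‖ ^ 2 ≤ 1) (x : E) :
    Summable (fun i => w i * ‖inner ℂ (v i) x‖ ^ 2) ∧
      ∑' i, w i * ‖inner ℂ (v i) x‖ ^ 2 ≤ ‖x‖ ^ 2 := by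
  classical
  have hfin : ∀ s : Finset ι, ∑ i ∈ s, w i * ‖inner ℂ (v i) x‖ ^ 2 ≤ ‖x‖ ^ 2 := fun s => by
    -- For this y one has ⟨y, x⟩ = S and ‖y‖² ≤ S, so S ≤ ‖y‖ ‖x‖ yields S ≤ ‖x‖².
    set y := ∑ i ∈ s, ((w i : ℂ) * inner ℂ (v i) x) • v i with hy
    set S := ∑ i ∈ s, w i * ‖inner ℂ (v i) x‖ ^ 2 with hS
    have h1 : inner ℂ y x = (S : ℂ) := by
      rw [hy, sum_inner, hS, Complex.ofReal_sum]
      refine Finset.sum_congr rfl fun i _ => ?_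
      rw [inner_smul_left, map_mul, Complex.conj_ofReal, mul_assoc, mul_comm (conj _),
        Complex.mul_conj, Complex.normSq_eq_norm_sq]
      push_cast; ring
    have h2 : ‖y‖ ^ 2 ≤ S := by
      have : inner ℂ y y = ((∑ i ∈ s, w i * ‖inner ℂ (v i) x‖ ^ 2 * (w i * ‖v i‖ ^ 2) : ℝ) : ℂ) := by
        rw [hy, sum_inner, Complex.ofReal_sum]
        refine Finset.sum_congr rfl fun i hi => ?_
        rw [inner_sum, Finset.sum_eq_single_of_mem i hi fun j _ hj => by
          rw [inner_smul_left, inner_smul_right, hv hj.symm]; simp]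
        rw [inner_smul_left, inner_smul_right, inner_self_eq_norm_sq_to_K, map_mul,
          Complex.conj_ofReal]
        have := Complex.mul_conj (inner ℂ (v i) x)
        rw [Complex.normSq_eq_norm_sq] at this
        push_cast at this ⊢
        simp only [Complex.coe_algebraMap]
        linear_combination (w i : ℂ) ^ 2 * (‖v i‖ : ℂ) ^ 2 * this
      have h3 : ‖y‖ ^ 2 = ∑ i ∈ s, w i * ‖inner ℂ (v i) x‖ ^ 2 * (w i * ‖v i‖ ^ 2) := by
        have h4 := inner_self_eq_norm_sq (𝕜 := ℂ) y
        rw [this] at h4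
        exact h4.symm.trans (Complex.ofReal_re _)
      rw [h3, hS]
      refine Finset.sum_le_sum fun i _ => ?_
      exact mul_le_of_le_one_right (mul_nonneg (hw0 i) (by positivity)) (hw i)
    have h3 : S ≤ ‖y‖ * ‖x‖ := by
      have := norm_inner_le_norm (𝕜 := ℂ) y x
      rw [h1, Complex.norm_real] at this
      exact (le_abs_self _).trans this
    have h0 : 0 ≤ S := Finset.sum_nonneg fun i _ => mul_nonneg (hw0 i) (by positivity)
    nlinarith [sq_nonneg (‖x‖ - ‖y‖), norm_nonneg x, norm_nonneg y]
  have hs := summable_of_sum_le (fun i => mul_nonneg (hw0 i) (by positivity)) hfin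
  exact ⟨hs, hs.tsum_le_of_sum_le hfin⟩

/-! ## Geometry of the grating -/

namespace Grating

variable {Lam : ℝ} (G : Grating Lam)

/-- A height below the grating surface. -/
def floor : ℝ := G.below.choose

theorem floor_lt {p : ℝ × ℝ} (hp : p ∈ G.W) : G.floor < p.2 := G.below.choose_spec p hp

theorem floor_lt_b : G.floor < G.b := by
  obtain ⟨c, hc, h⟩ := G.above
  have h1 := G.floor_lt (h 0 ((c + G.b) / 2) (by linarith))
  simp only at h1
  linarith

/-- `W` is nonempty and not the whole plane, so its boundary has a point. That point cannot lie
above the height where everything belongs to the open set `W`. -/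
theorem a_le_b : G.a ≤ G.b := by
  obtain ⟨c, hc, h⟩ := G.above
  have hne : (frontier G.W).Nonempty := by
    rw [nonempty_frontier_iff]
    refine ⟨G.isConnected.nonempty, fun hu => ?_⟩
    have : ((0 : ℝ), G.floor) ∈ G.W := by rw [hu]; trivial
    exact lt_irrefl _ (G.floor_lt this)
  obtain ⟨p, hp⟩ := hne
  have hcl : ∀ q ∈ closure G.W, G.floor ≤ q.2 := fun q hq => by
    have : closure G.W ⊆ {q : ℝ × ℝ | G.floor ≤ q.2} :=
      closure_minimal (fun q hq => (G.floor_lt hq).le) (isClosed_le continuous_const continuous_snd)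
    exact this hq
  have hbdd : BddBelow (Prod.snd '' G.S) := by
    refine ⟨G.floor, ?_⟩
    rintro _ ⟨q, hq, rfl⟩
    exact hcl q (frontier_subset_closure hq)
  refine (csInf_le hbdd ⟨p, hp, rfl⟩).trans ?_
  by_contra hlt
  have hW : p ∈ G.W := h p.1 p.2 (by linarith)
  rw [frontier, G.isOpen.interior_eq] at hp
  exact hp.2 hW

theorem one_le_gamma2 : 1 ≤ G.gamma2 := by
  rw [gamma2, Real.one_le_sqrt]
  have := inv_nonneg.2 (sub_nonneg.2 G.a_le_b)
  linarith

end Grating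

/-! ## Exponential modes in `Ω` -/

section Modes

variable (d : WaveData) (G : Grating d.Lam)

/-- Lebesgue measure on a rectangle that contains `Ω`. -/
def rectMeasure : Measure (ℝ × ℝ) :=
  (volume.restrict (Ioo 0 d.Lam)).prod (volume.restrict (Ioo G.floor G.b))

theorem rectMeasure_eq :
    rectMeasure d G = volume.restrict (Ioo 0 d.Lam ×ˢ Ioo G.floor G.b) := by
  rw [rectMeasure, Measure.prod_restrict, Measure.volume_eq_prod]

instance : IsFiniteMeasure (rectMeasure d G) := by rw [rectMeasure]; infer_instance

theorem Ω_subset_rect : G.Ω ⊆ Ioo 0 d.Lam ×ˢ Ioo G.floor G.b := fun _ hp =>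
  ⟨⟨hp.2.1, hp.2.2.1⟩, G.floor_lt hp.1, hp.2.2.2⟩

theorem rectMeasure_restrict : (rectMeasure d G).restrict G.Ω = volume.restrict G.Ω := by
  rw [rectMeasure_eq, Measure.restrict_restrict G.measurableSet_Ω,
    inter_eq_left.2 (Ω_subset_rect d G)]

theorem memLp_rect_of_continuous {f : ℝ × ℝ → ℂ} (hf : Continuous f) {r : ℝ≥0∞} :
    MemLp f r (rectMeasure d G) := by
  obtain ⟨C, hC⟩ := (isCompact_Icc.prod isCompact_Icc).exists_bound_of_continuousOn
    (s := Icc 0 d.Lam ×ˢ Icc G.floor G.b) hf.continuousOn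
  refine MemLp.of_bound hf.aestronglyMeasurable C ?_
  rw [rectMeasure_eq]
  filter_upwards [ae_restrict_mem (measurableSet_Ioo.prod measurableSet_Ioo)] with x hx
  exact hC x ⟨Ioo_subset_Icc_self hx.1, Ioo_subset_Icc_self hx.2⟩

theorem memLp_extend (u : L2Ω d G) : MemLp (G.Ω.indicator u) 2 (rectMeasure d G) := by
  rw [memLp_indicator_iff_restrict G.measurableSet_Ω, rectMeasure_restrict]
  exact Lp.memLp u

/-- Extension by zero to the rectangle. -/
def extend (u : L2Ω d G) : Lp ℂ 2 (rectMeasure d G) := (memLp_extend d G u).toLp _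

theorem norm_extend (u : L2Ω d G) : ‖extend d G u‖ = ‖u‖ := by
  rw [extend, Lp.norm_toLp, eLpNorm_indicator_eq_eLpNorm_restrict G.measurableSet_Ω,
    rectMeasure_restrict, Lp.norm_def]

/-- The mode `e^{i α_n x + B y}`. -/
def mode (n : ℤ) (B : ℂ) (z : ℝ × ℝ) : ℂ :=
  Complex.exp (Complex.I * d.alphaN n * z.1 + B * z.2)

theorem continuous_mode (n : ℤ) (B : ℂ) : Continuous (mode d n B) := by
  unfold mode; fun_prop

theorem conj_mode (n : ℤ) (B : ℂ) (z : ℝ × ℝ) :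
    conj (mode d n B z) = Complex.exp (-(Complex.I * d.alphaN n) * z.1 + conj B * z.2) := by
  rw [mode, ← Complex.exp_conj]
  simp

/-- The mode as an element of `L²` of the rectangle. -/
def modeLp (n : ℤ) (B : ℂ) : Lp ℂ 2 (rectMeasure d G) :=
  (memLp_rect_of_continuous d G (continuous_mode d n B)).toLp _

/-- The pairing of `u` with a mode. -/
def modePair (n : ℤ) (B : ℂ) (u : L2Ω d G) : ℂ := ∫ z in G.Ω, u z * conj (mode d n B z)

/-- Extension by zero transfers Bessel and Parseval from the rectangle, where the modes separate
variables, to the irregular domain `Ω`. -/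
theorem inner_modeLp_extend (n : ℤ) (B : ℂ) (u : L2Ω d G) :
    inner ℂ (modeLp d G n B) (extend d G u) = modePair d G n B u := by
  have h0 : modePair d G n B u =
      ∫ z, G.Ω.indicator (fun z => u z * conj (mode d n B z)) z ∂(rectMeasure d G) := by
    rw [integral_indicator G.measurableSet_Ω]
    exact congrArg (fun ν => ∫ z, u z * conj (mode d n B z) ∂ν) (rectMeasure_restrict d G).symm
  rw [L2.inner_def, h0]
  refine integral_congr_ae ?_
  filter_upwards [(memLp_extend d G u).coeFn_toLp,
    (memLp_rect_of_continuous d G (continuous_mode d n B) (r := 2)).coeFn_toLp] with z h1 h2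
  rw [extend, modeLp, h1, h2, RCLike.inner_apply]
  by_cases hz : z ∈ G.Ω <;> simp [hz]

theorem modePair_add (n : ℤ) (B : ℂ) (u v : L2Ω d G) :
    modePair d G n B (u + v) = modePair d G n B u + modePair d G n B v :=
  integral_add_mul d G u v (Complex.continuous_conj.comp (continuous_mode d n B))

theorem modePair_smul (n : ℤ) (B c : ℂ) (u : L2Ω d G) :
    modePair d G n B (c • u) = c * modePair d G n B u :=
  integral_smul_mul d G c u _

theorem inner_modeLp (n m : ℤ) (B C : ℂ) :
    inner ℂ (modeLp d G n B) (modeLp d G m C) =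
      (∫ x in Ioo 0 d.Lam, Complex.exp (Complex.I *
        (((m - n : ℤ) * (2 * Real.pi / (d.Lam - 0)) : ℝ) : ℂ) * x)) *
      ∫ y in Ioo G.floor G.b, Complex.exp ((conj B + C) * y) := by
  rw [L2.inner_def, ← integral_prod_mul]
  refine integral_congr_ae ?_
  filter_upwards [(memLp_rect_of_continuous d G (continuous_mode d n B) (r := 2)).coeFn_toLp,
    (memLp_rect_of_continuous d G (continuous_mode d m C) (r := 2)).coeFn_toLp] with z h1 h2
  rw [modeLp, modeLp, h1, h2, RCLike.inner_apply, conj_mode, mode, ← Complex.exp_add,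
    ← Complex.exp_add, WaveData.alphaN, WaveData.alphaN]
  congr 1
  push_cast
  ring

theorem inner_modeLp_of_ne {n m : ℤ} (h : n ≠ m) (B C : ℂ) :
    inner ℂ (modeLp d G n B) (modeLp d G m C) = 0 := by
  rw [inner_modeLp, integral_exp_period d.Lam_pos (sub_ne_zero.2 h.symm), zero_mul]

theorem inner_modeLp_self_left (n : ℤ) (B C : ℂ) :
    inner ℂ (modeLp d G n B) (modeLp d G n C) =
      d.Lam * ∫ y in Ioo G.floor G.b, Complex.exp ((conj B + C) * y) := by
  rw [inner_modeLp]
  simp [d.Lam_pos.le]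

/-- The squared norm is Λ (e^{2sb} - e^{2sc}) / (2s), with c the height `floor`. Dropping the second
exponential makes the bound independent of the depth of the rectangle. -/
theorem norm_modeLp_ofReal_sq_le (n : ℤ) {s : ℝ} (hs : 0 < s) :
    2 * s * Real.exp (-(2 * s * G.b)) / d.Lam * ‖modeLp d G n s‖ ^ 2 ≤ 1 := by
  have h1 : ‖modeLp d G n s‖ ^ 2 = d.Lam *
      ((Real.exp (2 * s * G.b) - Real.exp (2 * s * G.floor)) / (2 * s)) := by
    have h := inner_self_eq_norm_sq (𝕜 := ℂ) (modeLp d G n s)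
    have hc : (2 * s : ℂ) ≠ 0 := by exact_mod_cast (by positivity : (2 * s : ℝ) ≠ 0)
    have e : (conj (s : ℂ) + s) = 2 * s := by rw [Complex.conj_ofReal]; ring
    rw [inner_modeLp_self_left, e, restrict_Ioo_eq_restrict_Ioc,
      ← intervalIntegral.integral_of_le G.floor_lt_b.le, integral_exp_mul_complex hc] at h
    rw [← h]
    exact_mod_cast Complex.ofReal_re (d.Lam *
      ((Real.exp (2 * s * G.b) - Real.exp (2 * s * G.floor)) / (2 * s)))
  have hΛ := d.Lam_pos
  rw [h1]
  have e2 : Real.exp (-(2 * s * G.b)) * Real.exp (2 * s * G.b) = 1 := by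
    rw [← Real.exp_add]; simp
  calc _ = Real.exp (-(2 * s * G.b)) * Real.exp (2 * s * G.b) -
        Real.exp (-(2 * s * G.b)) * Real.exp (2 * s * G.floor) := by field_simp
    _ ≤ 1 := by
      rw [e2]
      have := mul_pos (Real.exp_pos (-(2 * s * G.b))) (Real.exp_pos (2 * s * G.floor))
      linarith

/-- Bessel's inequality for the modes `e^{i α_n x + s_n y}`. -/
theorem bessel_modePair {s : ℤ → ℝ} (hs : ∀ n, 0 < s n) (u : L2Ω d G) :
    Summable (fun n => 2 * s n * Real.exp (-(2 * s n * G.b)) / d.Lam *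
        ‖modePair d G n (s n) u‖ ^ 2) ∧
      ∑' n, 2 * s n * Real.exp (-(2 * s n * G.b)) / d.Lam * ‖modePair d G n (s n) u‖ ^ 2 ≤
        ‖u‖ ^ 2 := by
  have := sum_weighted_inner_sq_le (v := fun n => modeLp d G n (s n))
    (fun i j hij => inner_modeLp_of_ne d G hij _ _)
    (w := fun n => 2 * s n * Real.exp (-(2 * s n * G.b)) / d.Lam)
    (fun n => by have := d.Lam_pos; have := hs n; positivity)
    (fun n => norm_modeLp_ofReal_sq_le d G n (hs n)) (extend d G u)
  simpa only [inner_modeLp_extend, norm_extend] using this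

/-- Green's formula tested with a mode. -/
theorem modePair_green (w : H1Sqp d G) (n : ℤ) (B : ℂ) :
    Complex.I * d.alphaN n * modePair d G n B w.1.1 = modePair d G n B w.1.2.1 ∧
    conj B * modePair d G n B w.1.1 + modePair d G n B w.1.2.2.1 =
      Complex.exp (conj B * G.b) * (d.Lam * d.coeff w.1.2.2.2 n) := by
  let φ : ℝ × ℝ → ℂ := fun z => conj (mode d n B z)
  have hφe : φ = fun z : ℝ × ℝ =>
      Complex.exp (-(Complex.I * d.alphaN n) * z.1 + conj B * z.2) := funext (conj_mode d n B)
  have hd : ∀ z v : ℝ × ℝ, fderiv ℝ φ z v =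
      φ z * (-(Complex.I * d.alphaN n) * v.1 + conj B * v.2) := fun z v => by
    have h1 : HasFDerivAt (fun z : ℝ × ℝ => (z.1 : ℂ))
        (Complex.ofRealCLM ∘L ContinuousLinearMap.fst ℝ ℝ ℝ) z :=
      (Complex.ofRealCLM ∘L ContinuousLinearMap.fst ℝ ℝ ℝ).hasFDerivAt
    have h2 : HasFDerivAt (fun z : ℝ × ℝ => (z.2 : ℂ))
        (Complex.ofRealCLM ∘L ContinuousLinearMap.snd ℝ ℝ ℝ) z :=
      (Complex.ofRealCLM ∘L ContinuousLinearMap.snd ℝ ℝ ℝ).hasFDerivAt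
    have h3 := ((h1.const_mul (-(Complex.I * d.alphaN n))).add (h2.const_mul (conj B))).cexp
    rw [hφe]
    erw [h3.fderiv]
    simp
    ring
  have hsm : ContDiff ℝ ∞ φ := by
    rw [hφe]
    have h1 : ContDiff ℝ ∞ fun z : ℝ × ℝ => (z.1 : ℂ) :=
      (Complex.ofRealCLM ∘L ContinuousLinearMap.fst ℝ ℝ ℝ).contDiff
    have h2 : ContDiff ℝ ∞ fun z : ℝ × ℝ => (z.2 : ℂ) :=
      (Complex.ofRealCLM ∘L ContinuousLinearMap.snd ℝ ℝ ℝ).contDiff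
    exact ((contDiff_const.mul h1).add (contDiff_const.mul h2)).cexp
  -- Since α_nΛ = αΛ + 2πn, the conjugate mode is an admissible test function in
  -- `HasBoundaryValues`.
  have hper : ∀ x y : ℝ, φ (x + d.Lam, y) =
      Complex.exp (-(Complex.I * d.alpha * d.Lam)) * φ (x, y) := fun x y => by
    rw [hφe]
    simp only
    rw [← Complex.exp_add, Complex.exp_eq_exp_iff_exists_int]
    refine ⟨-n, ?_⟩
    have : (d.Lam : ℂ) ≠ 0 := by exact_mod_cast d.Lam_pos.ne'
    rw [WaveData.alphaN]
    push_cast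
    field_simp
    ring
  obtain ⟨e1, e2⟩ := w.2.2 φ hsm hper
  have i1 : ∫ z in G.Ω, w.1.1 z * fderiv ℝ φ z (1, 0) =
      -(Complex.I * d.alphaN n) * modePair d G n B w.1.1 := by
    rw [modePair, ← integral_const_mul]
    refine integral_congr_ae (Filter.Eventually.of_forall fun z => ?_)
    simp only [hd, φ]
    push_cast
    ring
  have i2 : ∫ z in G.Ω, w.1.1 z * fderiv ℝ φ z (0, 1) =
      conj B * modePair d G n B w.1.1 := by
    rw [modePair, ← integral_const_mul]
    refine integral_congr_ae (Filter.Eventually.of_forall fun z => ?_)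
    simp only [hd, φ]
    push_cast
    ring
  have i3 : ∫ x in Ioo 0 d.Lam, w.1.2.2.2 x * φ (x, G.b) =
      Complex.exp (conj B * G.b) * (d.Lam * d.coeff w.1.2.2.2 n) := by
    have : (d.Lam : ℂ) ≠ 0 := by exact_mod_cast d.Lam_pos.ne'
    rw [WaveData.coeff, ← mul_assoc (d.Lam : ℂ), mul_one_div_cancel this, one_mul,
      ← integral_const_mul]
    refine integral_congr_ae (Filter.Eventually.of_forall fun x => ?_)
    simp only [hφe]
    rw [Complex.exp_add, neg_mul]
    ring
  rw [i1] at e1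
  rw [i2, i3] at e2
  exact ⟨by change _ = ∫ z in G.Ω, w.1.2.1 z * φ z; linear_combination -e1, e2⟩

end Modes

/-! ## Trace and compactness estimates in `H¹_{S,qp}(Ω)` -/

section Estimates

variable (d : WaveData) (G : Grating d.Lam)

theorem WaveData.hasSum_coeff {g : ℝ → ℂ} (hg : MemLp g 2 (volume.restrict (Ioo 0 d.Lam))) :
    HasSum (fun n => d.Lam * ‖d.coeff g n‖ ^ 2) (∫ x in Ioo 0 d.Lam, ‖g x‖ ^ 2) := by
  have hΛ := d.Lam_pos
  have h := (hasSum_sq_norm_integral_exp hΛ d.alpha hg).mul_left (d.Lam)⁻¹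
  rw [sub_zero, ← mul_assoc, inv_mul_cancel₀ hΛ.ne', one_mul] at h
  refine h.congr_fun fun n => ?_
  rw [WaveData.coeff, norm_mul, norm_div, norm_one, Complex.norm_real,
    Real.norm_of_nonneg hΛ.le, WaveData.alphaN]
  field_simp

theorem hasSum_coeff_L2Γ (g : L2Γ d) :
    HasSum (fun n => d.Lam * ‖d.coeff g n‖ ^ 2) (‖g‖ ^ 2) := by
  have h := d.hasSum_coeff (Lp.memLp g)
  have e : ‖g‖ ^ 2 = ∫ x in Ioo 0 d.Lam, ‖g x‖ ^ 2 := by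
    have h1 := inner_self_eq_norm_sq (𝕜 := ℂ) g
    rw [← h1, L2.inner_def]
    have h2 : ∀ x, inner ℂ (g x) (g x) = ((‖g x‖ ^ 2 : ℝ) : ℂ) := fun x => by
      rw [inner_self_eq_norm_sq_to_K]; norm_cast
    simp only [h2]
    rw [integral_complex_ofReal]
    exact Complex.ofReal_re _
  rwa [e]

/-- Green's formula with e^{iα_n x + sy} expresses e^{sb} Λ u^{(n)} as s times the pairing of u plus
that of ∂_y u. Squaring costs a factor 2, which is exactly absorbed in the Bessel weight. -/
theorem coeff_sq_le_modePair (w : H1Sqp d G) (n : ℤ) {s : ℝ} (hs : 0 < s) :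
    s * (d.Lam * ‖d.coeff w.1.2.2.2 n‖ ^ 2) ≤ 2 * s * Real.exp (-(2 * s * G.b)) / d.Lam *
      (s ^ 2 * ‖modePair d G n s w.1.1‖ ^ 2 + ‖modePair d G n s w.1.2.2.1‖ ^ 2) := by
  have hΛ := d.Lam_pos
  have h := congrArg norm (modePair_green d G w n s).2
  have e : Complex.exp (conj (s : ℂ) * G.b) = ((Real.exp (s * G.b) : ℝ) : ℂ) := by
    rw [Complex.conj_ofReal]; push_cast; rfl
  rw [e, norm_mul, norm_mul, Complex.norm_real, Complex.norm_real, Real.norm_of_nonneg hΛ.le,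
    Real.norm_of_nonneg (Real.exp_pos _).le] at h
  have h2 : ‖conj (s : ℂ) * modePair d G n s w.1.1 + modePair d G n s w.1.2.2.1‖ ≤
      s * ‖modePair d G n s w.1.1‖ + ‖modePair d G n s w.1.2.2.1‖ := by
    refine (norm_add_le _ _).trans (le_of_eq ?_)
    rw [norm_mul, Complex.conj_ofReal, Complex.norm_real, Real.norm_of_nonneg hs.le]
  rw [h] at h2
  have h3 : (Real.exp (s * G.b) * (d.Lam * ‖d.coeff w.1.2.2.2 n‖)) ^ 2 ≤
      2 * (s ^ 2 * ‖modePair d G n s w.1.1‖ ^ 2 + ‖modePair d G n s w.1.2.2.1‖ ^ 2) := by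
    refine (pow_le_pow_left₀ (by positivity) h2 2).trans ?_
    nlinarith [sq_nonneg (s * ‖modePair d G n s w.1.1‖ - ‖modePair d G n s w.1.2.2.1‖)]
  have e2 : Real.exp (-(2 * s * G.b)) * Real.exp (s * G.b) ^ 2 = 1 := by
    rw [← Real.exp_nat_mul, ← Real.exp_add]
    rw [Real.exp_eq_one_iff]; push_cast; ring
  have h4 := mul_le_mul_of_nonneg_left h3
    (show 0 ≤ s * Real.exp (-(2 * s * G.b)) / d.Lam by positivity)
  calc _ = s * (Real.exp (-(2 * s * G.b)) * Real.exp (s * G.b) ^ 2) *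
        (d.Lam * ‖d.coeff w.1.2.2.2 n‖ ^ 2) := by rw [e2, mul_one]
    _ = s * Real.exp (-(2 * s * G.b)) / d.Lam *
        (Real.exp (s * G.b) * (d.Lam * ‖d.coeff w.1.2.2.2 n‖)) ^ 2 := by field_simp
    _ ≤ _ := h4
    _ = _ := by ring

/-- The choice s = 1 for all modes gives the L² trace inequality with constant 1. -/
theorem tsum_coeff_le (w : H1Sqp d G) :
    ∑' n, d.Lam * ‖d.coeff w.1.2.2.2 n‖ ^ 2 ≤ ‖w.1.1‖ ^ 2 + ‖w.1.2.2.1‖ ^ 2 := by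
  obtain ⟨s1, t1⟩ := bessel_modePair d G (s := fun _ => 1) (fun _ => one_pos) w.1.1
  obtain ⟨s2, t2⟩ := bessel_modePair d G (s := fun _ => 1) (fun _ => one_pos) w.1.2.2.1
  refine le_trans ?_ (add_le_add t1 t2)
  rw [← s1.tsum_add s2]
  refine (hasSum_coeff_L2Γ d w.1.2.2.2).summable.tsum_le_tsum (fun n => ?_) (s1.add s2)
  have := coeff_sq_le_modePair d G w n one_pos
  linarith

theorem norm_trace_sq_le (w : H1Sqp d G) : ‖w.1.2.2.2‖ ^ 2 ≤ ‖w.1.1‖ ^ 2 + ‖w.1.2.2.1‖ ^ 2 := by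
  rw [← (hasSum_coeff_L2Γ d w.1.2.2.2).tsum_eq]
  exact tsum_coeff_le d G w

/-- The trace on `Γ` lies in `H^{1/2}`. -/
theorem tsum_weighted_coeff_le (w : H1Sqp d G) :
    Summable (fun n => (1 + |d.alphaN n|) * (d.Lam * ‖d.coeff w.1.2.2.2 n‖ ^ 2)) ∧
    ∑' n, (1 + |d.alphaN n|) * (d.Lam * ‖d.coeff w.1.2.2.2 n‖ ^ 2) ≤
      2 * (‖w.1.1‖ ^ 2 + ‖w.1.2.1‖ ^ 2 + ‖w.1.2.2.1‖ ^ 2) := by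
  have hΛ := d.Lam_pos
  -- The exponent s_n = 1 + |α_n| matches the H^{1/2} weight.
  have hs : ∀ n, 0 < 1 + |d.alphaN n| := fun n => by positivity
  obtain ⟨s1, t1⟩ := bessel_modePair d G hs w.1.1
  obtain ⟨s2, t2⟩ := bessel_modePair d G hs w.1.2.1
  obtain ⟨s3, t3⟩ := bessel_modePair d G hs w.1.2.2.1
  have hle : ∀ n, (1 + |d.alphaN n|) * (d.Lam * ‖d.coeff w.1.2.2.2 n‖ ^ 2) ≤
      2 * (2 * (1 + |d.alphaN n|) * Real.exp (-(2 * (1 + |d.alphaN n|) * G.b)) / d.Lam *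
        ‖modePair d G n (1 + |d.alphaN n| : ℝ) w.1.1‖ ^ 2) +
      2 * (2 * (1 + |d.alphaN n|) * Real.exp (-(2 * (1 + |d.alphaN n|) * G.b)) / d.Lam *
        ‖modePair d G n (1 + |d.alphaN n| : ℝ) w.1.2.1‖ ^ 2) +
      2 * (1 + |d.alphaN n|) * Real.exp (-(2 * (1 + |d.alphaN n|) * G.b)) / d.Lam *
        ‖modePair d G n (1 + |d.alphaN n| : ℝ) w.1.2.2.1‖ ^ 2 := fun n => by
    refine (coeff_sq_le_modePair d G w n (hs n)).trans ?_
    have hx := congrArg norm (modePair_green d G w n (1 + |d.alphaN n| : ℝ)).1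
    rw [norm_mul, norm_mul, Complex.norm_I, one_mul, Complex.norm_real, Real.norm_eq_abs] at hx
    set P := ‖modePair d G n (1 + |d.alphaN n| : ℝ) w.1.2.1‖
    set U := ‖modePair d G n (1 + |d.alphaN n| : ℝ) w.1.1‖
    set Q := ‖modePair d G n (1 + |d.alphaN n| : ℝ) w.1.2.2.1‖
    have hW : 0 ≤ 2 * (1 + |d.alphaN n|) * Real.exp (-(2 * (1 + |d.alphaN n|) * G.b)) / d.Lam := by
      have := hs n; positivity
    -- The factor s_n² ≤ 2 + 2α_n² is traded for ∂_x u, because P = |α_n| U.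
    have h1 : (1 + |d.alphaN n|) ^ 2 * U ^ 2 + Q ^ 2 ≤ 2 * U ^ 2 + 2 * P ^ 2 + Q ^ 2 := by
      rw [← hx]
      nlinarith [sq_nonneg (U * (1 - |d.alphaN n|))]
    refine (mul_le_mul_of_nonneg_left h1 hW).trans (le_of_eq ?_)
    ring
  have hsum := ((s1.mul_left 2).add (s2.mul_left 2)).add s3
  have hS : Summable (fun n => (1 + |d.alphaN n|) * (d.Lam * ‖d.coeff w.1.2.2.2 n‖ ^ 2)) :=
    Summable.of_nonneg_of_le (fun n => by have := hs n; positivity) hle hsum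
  refine ⟨hS, (hS.tsum_le_tsum hle hsum).trans ?_⟩
  rw [((s1.mul_left 2).add (s2.mul_left 2)).tsum_add s3,
    (s1.mul_left 2).tsum_add (s2.mul_left 2), tsum_mul_left, tsum_mul_left]
  nlinarith [sq_nonneg ‖w.1.2.2.1‖]

/-- Vertical frequencies on the rectangle. -/
def boxFreq (m : ℤ) : ℝ := m * (2 * Real.pi / (G.b - G.floor))

/-- The box modes form an orthogonal basis. -/
theorem hasSum_box_modePair (u : L2Ω d G) :
    HasSum (fun k : ℤ × ℤ => (d.Lam * (G.b - G.floor))⁻¹ *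
      ‖modePair d G k.1 (Complex.I * boxFreq d G k.2) u‖ ^ 2) (‖u‖ ^ 2) := by
  have hΛ := d.Lam_pos
  have hL : 0 < G.b - G.floor := sub_pos.2 G.floor_lt_b
  set c : ℝ := d.Lam * (G.b - G.floor) with hc
  have hc0 : 0 < c := by positivity
  let ψ : ℤ × ℤ → Lp ℂ 2 (rectMeasure d G) := fun k =>
    modeLp d G k.1 (Complex.I * boxFreq d G k.2)
  have hψ : ∀ j k, inner ℂ (ψ j) (ψ k) = if j = k then (c : ℂ) else 0 := fun j k => by
    by_cases h1 : j.1 = k.1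
    · have e : ∀ y : ℝ, Complex.exp ((conj (Complex.I * (boxFreq d G j.2 : ℂ)) +
          Complex.I * boxFreq d G k.2) * y) = Complex.exp (Complex.I *
            (((k.2 - j.2 : ℤ) * (2 * Real.pi / (G.b - G.floor)) : ℝ) : ℂ) * y) := fun y => by
        rw [boxFreq, boxFreq, map_mul, Complex.conj_I, Complex.conj_ofReal]
        congr 1; push_cast; ring
      simp only [ψ, h1]
      rw [inner_modeLp_self_left]
      simp only [e]
      by_cases h2 : j.2 = k.2
      · rw [if_pos (Prod.ext h1 h2), h2]
        simp [hc, hL.le]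
      · rw [if_neg (fun h => h2 (by rw [h])), integral_exp_period G.floor_lt_b
          (sub_ne_zero.2 (Ne.symm h2)), mul_zero]
    · rw [if_neg (fun h => h1 (by rw [h]))]
      exact inner_modeLp_of_ne d G h1 _ _
  let v : ℤ × ℤ → Lp ℂ 2 (rectMeasure d G) := fun k => ((√c)⁻¹ : ℂ) • ψ k
  have hsc : ((√c : ℝ) : ℂ) ≠ 0 := by exact_mod_cast (Real.sqrt_pos.2 hc0).ne'
  have hscsq : ((√c : ℝ) : ℂ) * (√c : ℝ) = c := by
    rw [← Complex.ofReal_mul, Real.mul_self_sqrt hc0.le]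
  have hv : Orthonormal ℂ v := by
    rw [orthonormal_iff_ite]
    intro j k
    simp only [v]
    rw [inner_smul_left, inner_smul_right, hψ]
    split_ifs
    · rw [← hscsq, map_inv₀, Complex.conj_ofReal]; field_simp
    · simp
  -- Completeness on the rectangle, with quasi-periodicity α in x and 0 in y.
  have hbot : (Submodule.span ℂ (Set.range v))ᗮ = ⊥ := by
    rw [Submodule.eq_bot_iff]
    intro U hU
    have h0 : ∀ k, inner ℂ (ψ k) U = 0 := fun k => by
      have := (Submodule.mem_orthogonal _ _).1 hU (v k) (Submodule.subset_span ⟨k, rfl⟩)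
      simp only [v] at this
      rw [inner_smul_left] at this
      refine (mul_eq_zero.1 this).resolve_left ?_
      rw [map_inv₀, Complex.conj_ofReal]
      exact inv_ne_zero hsc
    have hz := ae_eq_zero_of_integral_exp_mul_exp_eq_zero hΛ G.floor_lt_b d.alpha 0
      (Lp.stronglyMeasurable U) (Lp.memLp U) fun n m => by
        rw [← h0 (n, m), L2.inner_def]
        refine integral_congr_ae ?_
        filter_upwards [(memLp_rect_of_continuous d G (continuous_mode d n
          (Complex.I * boxFreq d G m)) (r := 2)).coeFn_toLp] with z hz
        simp only [ψ, modeLp]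
        rw [hz, RCLike.inner_apply, conj_mode, ← Complex.exp_add, boxFreq, map_mul,
          Complex.conj_I, Complex.conj_ofReal, WaveData.alphaN]
        congr 2
        push_cast
        ring
    exact (Lp.eq_zero_iff_ae_eq_zero).2 hz
  let b := HilbertBasis.mkOfOrthogonalEqBot hv hbot
  have hb : ∀ k, b k = v k := fun k => by
    simp [b]
  have key := b.hasSum_inner_mul_inner (extend d G u) (extend d G u)
  have hre := Complex.hasSum_re key
  have e1 : (inner ℂ (extend d G u) (extend d G u)).re = ‖u‖ ^ 2 := by
    rw [← norm_extend]; exact inner_self_eq_norm_sq (𝕜 := ℂ) _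
  rw [e1] at hre
  refine hre.congr_fun fun k => ?_
  rw [hb, ← inner_conj_symm, Complex.conj_mul', ← Complex.ofReal_pow, Complex.ofReal_re]
  simp only [v]
  rw [inner_smul_left, norm_mul, mul_pow, map_inv₀, Complex.conj_ofReal, norm_inv,
    Complex.norm_real, Real.norm_of_nonneg (Real.sqrt_nonneg _), inv_pow, Real.sq_sqrt hc0.le,
    inner_modeLp_extend]

/-- Green's formula leaves a trace term because these modes do not vanish on `Γ`. It does not depend
on m, so dividing by the squared vertical frequency makes it summable. -/
theorem boxFreq_sq_mul_le (w : H1Sqp d G) (n m : ℤ) :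
    boxFreq d G m ^ 2 * ‖modePair d G n (Complex.I * boxFreq d G m) w.1.1‖ ^ 2 ≤
      2 * ‖modePair d G n (Complex.I * boxFreq d G m) w.1.2.2.1‖ ^ 2 +
        2 * (d.Lam * ‖d.coeff w.1.2.2.2 n‖) ^ 2 := by
  have h := (modePair_green d G w n (Complex.I * boxFreq d G m)).2
  set U := modePair d G n (Complex.I * boxFreq d G m) w.1.1
  set Q := modePair d G n (Complex.I * boxFreq d G m) w.1.2.2.1
  have h1 : conj (Complex.I * (boxFreq d G m : ℂ)) * U =
      Complex.exp (conj (Complex.I * (boxFreq d G m : ℂ)) * G.b) *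
        (d.Lam * d.coeff w.1.2.2.2 n) - Q := by linear_combination h
  have h2 := congrArg norm h1
  have e : ‖Complex.exp (conj (Complex.I * (boxFreq d G m : ℂ)) * G.b)‖ = 1 := by
    rw [map_mul, Complex.conj_I, Complex.conj_ofReal, neg_mul, neg_mul]
    exact norm_exp_neg_I_mul _ _
  have h3 := norm_sub_le (Complex.exp (conj (Complex.I * (boxFreq d G m : ℂ)) * G.b) *
        (d.Lam * d.coeff w.1.2.2.2 n)) Q
  rw [← h2, norm_mul, norm_mul, Complex.norm_conj, e, norm_mul, norm_mul, Complex.norm_I, one_mul,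
    one_mul, Complex.norm_real, Complex.norm_real, Real.norm_of_nonneg d.Lam_pos.le,
    Real.norm_eq_abs] at h3
  have h4 := pow_le_pow_left₀ (by positivity) h3 2
  rw [mul_pow, sq_abs] at h4
  nlinarith [sq_nonneg (d.Lam * ‖d.coeff w.1.2.2.2 n‖ - ‖Q‖)]

theorem exists_finset_tail_boxFreq {ε : ℝ} (hε : 0 < ε) :
    ∃ s : Finset ℤ, 0 ∈ s ∧
      Summable (fun m => if m ∈ s then 0 else (boxFreq d G m ^ 2)⁻¹) ∧
      ∑' m, (if m ∈ s then 0 else (boxFreq d G m ^ 2)⁻¹) ≤ ε := by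
  have hsum : Summable fun m : ℤ => (boxFreq d G m ^ 2)⁻¹ := by
    have h := (Real.summable_one_div_int_pow (p := 2)).2 (by norm_num)
    refine (h.mul_left ((2 * Real.pi / (G.b - G.floor)) ^ 2)⁻¹).congr fun m => ?_
    rw [boxFreq, mul_pow, mul_inv, one_div, mul_comm]
  have ht := tendsto_tsum_compl_atTop_zero fun m : ℤ => (boxFreq d G m ^ 2)⁻¹
  obtain ⟨s, hs⟩ := Filter.eventually_atTop.1 (ht.eventually (eventually_le_nhds hε))
  have hind : (fun m => if m ∈ insert 0 s then 0 else (boxFreq d G m ^ 2)⁻¹) =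
      Set.indicator {m | m ∉ insert 0 s} fun m => (boxFreq d G m ^ 2)⁻¹ := by
    funext m
    simp only [Set.indicator, Set.mem_ofPred_eq]
    by_cases hm : m ∈ insert 0 s
    · rw [if_pos hm, if_neg (not_not.2 hm)]
    · rw [if_neg hm, if_pos hm]
  -- Frequency zero is made exceptional: its inverse square is 0 by convention and would bound
  -- nothing.
  refine ⟨insert 0 s, Finset.mem_insert_self _ _, ?_, ?_⟩
  · rw [hind]; exact hsum.indicator _
  · rw [hind, ← tsum_subtype]
    exact hs (insert 0 s) (Finset.subset_insert _ _)

/-- A quantitative form of the compactness of the embedding into `L²(Ω)`. -/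
theorem norm_sq_le_of_finite_modes {ε : ℝ} (hε : 0 < ε) :
    ∃ s : Finset (ℤ × ℤ), ∀ w : H1Sqp d G, ‖w.1.1‖ ^ 2 ≤
      ε * (‖w.1.1‖ ^ 2 + ‖w.1.2.1‖ ^ 2 + ‖w.1.2.2.1‖ ^ 2) +
      ∑ k ∈ s, (d.Lam * (G.b - G.floor))⁻¹ *
        ‖modePair d G k.1 (Complex.I * boxFreq d G k.2) w.1.1‖ ^ 2 := by
  have hΛ := d.Lam_pos
  have hL : 0 < G.b - G.floor := sub_pos.2 G.floor_lt_b
  set L := G.b - G.floor with hLdef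
  -- A tolerance e costs 2e from the vertical derivative and 2e/L from the trace, hence e = ε / (2 +
  -- 2/L).
  obtain ⟨e, he, he2, heL⟩ : ∃ e : ℝ, 0 < e ∧ e * 2 + 2 / L * e ≤ ε ∧ e ≤ ε := by
    refine ⟨ε / (2 + 2 / L), by positivity, le_of_eq (by field_simp), ?_⟩
    rw [div_le_iff₀ (by positivity)]
    have : 0 < 2 / L := by positivity
    nlinarith
  obtain ⟨s₂, h0, hs₂, ht₂⟩ := exists_finset_tail_boxFreq d G he
  set κ : ℤ → ℝ := fun m => if m ∈ s₂ then 0 else (boxFreq d G m ^ 2)⁻¹ with hκ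
  have hκ0 : ∀ m, 0 ≤ κ m := fun m => by
    simp only [hκ]; split_ifs <;> positivity
  let s₁ := (d.finite_abs_alphaN_lt (√e⁻¹)).toFinset
  refine ⟨s₁ ×ˢ s₂, fun w => ?_⟩
  set c := (d.Lam * L)⁻¹ with hc
  have hc0 : 0 < c := by positivity
  let A : L2Ω d G → ℤ × ℤ → ℝ := fun u k =>
    c * ‖modePair d G k.1 (Complex.I * boxFreq d G k.2) u‖ ^ 2
  have hA0 : ∀ u k, 0 ≤ A u k := fun u k => by positivity
  have hA : ∀ u, HasSum (A u) (‖u‖ ^ 2) := hasSum_box_modePair d G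
  let t : ℤ → ℝ := fun n => d.Lam * ‖d.coeff w.1.2.2.2 n‖ ^ 2
  have ht0 : ∀ n, 0 ≤ t n := fun n => by positivity
  have ht : Summable t := (hasSum_coeff_L2Γ d w.1.2.2.2).summable
  have htle : ∑' n, t n ≤ ‖w.1.1‖ ^ 2 + ‖w.1.2.2.1‖ ^ 2 := tsum_coeff_le d G w
  have htκ : HasSum (fun k : ℤ × ℤ => t k.1 * κ k.2) ((∑' n, t n) * ∑' m, κ m) :=
    ht.hasSum.mul hs₂.hasSum (ht.mul_of_nonneg hs₂ ht0 hκ0)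
  have hT : HasSum (fun k => if k ∈ s₁ ×ˢ s₂ then A w.1.1 k else 0)
      (∑ k ∈ s₁ ×ˢ s₂, A w.1.1 k) := by
    have := hasSum_sum_of_ne_finset_zero (L := .unconditional _)
      (f := fun k => if k ∈ s₁ ×ˢ s₂ then A w.1.1 k else 0)
      (s := s₁ ×ˢ s₂) fun k hk => if_neg hk
    convert this using 1
    exact Finset.sum_congr rfl fun k hk => (if_pos hk).symm
  -- A mode outside the finite set has a high horizontal frequency, and is controlled by ∂_x u, or a
  -- high vertical one, and is controlled by ∂_y u and the trace.
  have hle : ∀ k, A w.1.1 k ≤ (e * A w.1.2.1 k + e * 2 * A w.1.2.2.1 k + 2 / L * (t k.1 * κ k.2)) +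
      if k ∈ s₁ ×ˢ s₂ then A w.1.1 k else 0 := fun k => by
    have n1 := hA0 w.1.2.1 k
    have n2 := hA0 w.1.2.2.1 k
    have n3 : 0 ≤ t k.1 * κ k.2 := mul_nonneg (ht0 _) (hκ0 _)
    have hL2 : 0 < 2 / L := by positivity
    by_cases hk : k ∈ s₁ ×ˢ s₂
    · rw [if_pos hk]
      have : 0 ≤ e * A w.1.2.1 k + e * 2 * A w.1.2.2.1 k + 2 / L * (t k.1 * κ k.2) := by positivity
      linarith
    rw [if_neg hk, add_zero]
    by_cases hk1 : k.1 ∈ s₁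
    · have hk2 : k.2 ∉ s₂ := fun h => hk (Finset.mem_product.2 ⟨hk1, h⟩)
      have hb : 0 < boxFreq d G k.2 ^ 2 := by
        have : k.2 ≠ 0 := fun h => hk2 (h ▸ h0)
        have : (k.2 : ℝ) ≠ 0 := by exact_mod_cast this
        have := Real.pi_pos
        rw [boxFreq, ← hLdef]
        positivity
      have hκk : κ k.2 = (boxFreq d G k.2 ^ 2)⁻¹ := if_neg hk2
      have hκe : κ k.2 ≤ e := (hs₂.le_tsum k.2 fun m _ => hκ0 m).trans ht₂
      have h1 := mul_le_mul_of_nonneg_left (boxFreq_sq_mul_le d G w k.1 k.2)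
        (mul_nonneg hc0.le (hκ0 k.2))
      have h2 : c * κ k.2 * (boxFreq d G k.2 ^ 2 *
          ‖modePair d G k.1 (Complex.I * boxFreq d G k.2) w.1.1‖ ^ 2) = A w.1.1 k := by
        have hb' : boxFreq d G k.2 ≠ 0 := (pow_ne_zero_iff two_ne_zero).1 hb.ne'
        rw [hκk]; simp only [A]; field_simp
      have h3 : c * κ k.2 * (2 * ‖modePair d G k.1 (Complex.I * boxFreq d G k.2) w.1.2.2.1‖ ^ 2 +
          2 * (d.Lam * ‖d.coeff w.1.2.2.2 k.1‖) ^ 2) =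
          κ k.2 * 2 * A w.1.2.2.1 k + 2 / L * (t k.1 * κ k.2) := by
        simp only [A, t, hc]; field_simp
      rw [h2, h3] at h1
      have h4 : κ k.2 * 2 * A w.1.2.2.1 k ≤ e * 2 * A w.1.2.2.1 k := by gcongr
      have h5 : 0 ≤ e * A w.1.2.1 k := by positivity
      linarith
    · have hα : √e⁻¹ ≤ |d.alphaN k.1| := by simpa [s₁] using hk1
      have hα2 : e⁻¹ ≤ d.alphaN k.1 ^ 2 := by
        rw [← sq_abs, ← Real.sq_sqrt (inv_nonneg.2 he.le)]
        exact pow_le_pow_left₀ (Real.sqrt_nonneg _) hα 2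
      have hx := congrArg norm (modePair_green d G w k.1 (Complex.I * boxFreq d G k.2)).1
      rw [norm_mul, norm_mul, Complex.norm_I, one_mul, Complex.norm_real, Real.norm_eq_abs] at hx
      have h1 : A w.1.2.1 k = d.alphaN k.1 ^ 2 * A w.1.1 k := by
        simp only [A]; rw [← hx, mul_pow, sq_abs]; ring
      have h2 : A w.1.1 k ≤ e * A w.1.2.1 k := by
        rw [h1, ← mul_assoc]
        refine le_mul_of_one_le_left (hA0 _ _) ?_
        rw [inv_le_iff_one_le_mul₀ he] at hα2
        linarith
      have : 0 ≤ e * 2 * A w.1.2.2.1 k + 2 / L * (t k.1 * κ k.2) := by positivity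
      linarith
  have hsum := ((((hA w.1.2.1).mul_left e).add ((hA w.1.2.2.1).mul_left (e * 2))).add
    (htκ.mul_left (2 / L))).add hT
  have hfin := hasSum_le hle (hA w.1.1) hsum
  refine hfin.trans ?_
  have hκsum : 0 ≤ ∑' m, κ m := tsum_nonneg hκ0
  have h1 : (∑' n, t n) * ∑' m, κ m ≤ (‖w.1.1‖ ^ 2 + ‖w.1.2.2.1‖ ^ 2) * e := by gcongr
  have h2 : 2 / L * ((∑' n, t n) * ∑' m, κ m) ≤
      2 / L * ((‖w.1.1‖ ^ 2 + ‖w.1.2.2.1‖ ^ 2) * e) := by gcongr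
  have h3 : 0 ≤ 2 / L * e := by positivity
  have h4 : e * ‖w.1.2.1‖ ^ 2 ≤ ε * ‖w.1.2.1‖ ^ 2 := by gcongr
  have h5 : (e * 2 + 2 / L * e) * ‖w.1.2.2.1‖ ^ 2 ≤ ε * ‖w.1.2.2.1‖ ^ 2 := by gcongr
  have h6 : (e * 2 + 2 / L * e) * ‖w.1.1‖ ^ 2 ≤ ε * ‖w.1.1‖ ^ 2 := by gcongr
  have h7 : 0 ≤ e * 2 * ‖w.1.1‖ ^ 2 := by positivity
  simp only [A] at h1 ⊢
  linarith

end Estimates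

/-! ## Boundary symbols acting on Fourier coefficients -/

theorem summable_mul_and_tsum_mul_le {ι : Type*} {x y : ι → ℝ} (hx0 : ∀ i, 0 ≤ x i)
    (hy0 : ∀ i, 0 ≤ y i) (hx : Summable fun i => x i ^ 2) (hy : Summable fun i => y i ^ 2) :
    Summable (fun i => x i * y i) ∧
      ∑' i, x i * y i ≤ √(∑' i, x i ^ 2) * √(∑' i, y i ^ 2) := by
  have hs : Summable fun i => x i * y i :=
    Summable.of_nonneg_of_le (fun i => mul_nonneg (hx0 i) (hy0 i))
      (fun i => by nlinarith [sq_nonneg (x i - y i), sq_nonneg (x i), sq_nonneg (y i)]) (hx.add hy)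
  refine ⟨hs, hs.tsum_le_of_sum_le fun s => (Real.sum_mul_le_sqrt_mul_sqrt s x y).trans ?_⟩
  gcongr
  · exact hx.sum_le_tsum s fun _ _ => sq_nonneg _
  · exact hy.sum_le_tsum s fun _ _ => sq_nonneg _

/-- Passing from ℓ¹ to ℓ² costs √2 for each of the two vectors; this accounts for the K/2 in all
entrywise bounds. -/
theorem norm_sum_mulVec_mul_conj_le (A : Matrix (Fin 2) (Fin 2) ℂ) {K : ℝ} (hK : 0 ≤ K)
    (hA : ∀ i j, ‖A i j‖ ≤ K / 2) (x y : Fin 2 → ℂ) :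
    ‖∑ i, A.mulVec x i * conj (y i)‖ ≤
      K * (√(∑ j, ‖x j‖ ^ 2) * √(∑ j, ‖y j‖ ^ 2)) := by
  have h1 : ∀ z : Fin 2 → ℂ, ∑ j, ‖z j‖ ≤ √2 * √(∑ j, ‖z j‖ ^ 2) := fun z => by
    rw [← Real.sqrt_mul (by norm_num)]
    refine Real.le_sqrt_of_sq_le ?_
    simp only [Fin.sum_univ_two]
    nlinarith [sq_nonneg (‖z 0‖ - ‖z 1‖)]
  have h2 : ∀ i, ‖A.mulVec x i‖ ≤ K / 2 * ∑ j, ‖x j‖ := fun i => by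
    rw [Matrix.mulVec, dotProduct, Finset.mul_sum]
    refine (norm_sum_le _ _).trans (Finset.sum_le_sum fun j _ => ?_)
    rw [norm_mul]
    gcongr
    exact hA i j
  calc ‖∑ i, A.mulVec x i * conj (y i)‖ ≤ ∑ i, (K / 2 * ∑ j, ‖x j‖) * ‖y i‖ := by
        refine (norm_sum_le _ _).trans (Finset.sum_le_sum fun i _ => ?_)
        rw [norm_mul, Complex.norm_conj]
        gcongr
        exact h2 i
    _ = K / 2 * ((∑ j, ‖x j‖) * ∑ i, ‖y i‖) := by rw [← Finset.mul_sum]; ring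
    _ ≤ K / 2 * ((√2 * √(∑ j, ‖x j‖ ^ 2)) * (√2 * √(∑ j, ‖y j‖ ^ 2))) := by
        gcongr
        · exact h1 x
        · exact h1 y
    _ = K / 2 * (√2 * √2) * (√(∑ j, ‖x j‖ ^ 2) * √(∑ j, ‖y j‖ ^ 2)) := by ring
    _ = _ := by rw [Real.mul_self_sqrt (by norm_num)]; ring

/-! ### Boundedness and dissipativity of the symbols -/

namespace WaveData

variable (d : WaveData)

/-- The Fourier coefficients of a vector field on `Γ`, weighted by `wt`, are square summable. -/
def WeightedSummable (wt : ℤ → ℝ) (g : Fin 2 → ℝ → ℂ) : Prop :=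
  Summable fun n => wt n * (d.Lam * ∑ j, ‖d.coeff (g j) n‖ ^ 2)

/-- The weighted square sum of the Fourier coefficients. -/
def energy (wt : ℤ → ℝ) (g : Fin 2 → ℝ → ℂ) : ℝ :=
  ∑' n, wt n * (d.Lam * ∑ j, ‖d.coeff (g j) n‖ ^ 2)

/-- Cauchy–Schwarz over n, with the weight split evenly between the two arguments. The constant
weight serves M - M̂, the H^{1/2} weight serves M and M̂. -/
theorem symbolPair_bound {A : ℤ → Matrix (Fin 2) (Fin 2) ℂ} {K : ℝ} (hK : 0 ≤ K) {wt : ℤ → ℝ}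
    (hω : ∀ n, 0 ≤ wt n) (hA : ∀ n i j, ‖A n i j‖ ≤ K / 2 * wt n) {g h : Fin 2 → ℝ → ℂ}
    (hg : d.WeightedSummable wt g) (hh : d.WeightedSummable wt h) :
    Summable (fun n => ∑ i : Fin 2,
      (A n).mulVec (fun j => d.coeff (g j) n) i * conj (d.coeff (h i) n)) ∧
    ‖d.symbolPair A g h‖ ≤ K * (√(d.energy wt g) * √(d.energy wt h)) := by
  have hΛ := d.Lam_pos
  let X : (Fin 2 → ℝ → ℂ) → ℤ → ℝ := fun g n => √(wt n * (d.Lam * ∑ j, ‖d.coeff (g j) n‖ ^ 2))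
  have hX0 : ∀ (g : Fin 2 → ℝ → ℂ) n, 0 ≤ wt n * (d.Lam * ∑ j, ‖d.coeff (g j) n‖ ^ 2) := fun g n =>
    mul_nonneg (hω n) (mul_nonneg hΛ.le (Finset.sum_nonneg fun _ _ => by positivity))
  have hX : ∀ (g : Fin 2 → ℝ → ℂ) n, X g n ^ 2 = wt n * (d.Lam * ∑ j, ‖d.coeff (g j) n‖ ^ 2) := fun g n =>
    Real.sq_sqrt (hX0 g n)
  obtain ⟨hs, hle⟩ := summable_mul_and_tsum_mul_le (x := X g) (y := X h)
    (fun _ => Real.sqrt_nonneg _) (fun _ => Real.sqrt_nonneg _)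
    (by simp only [hX]; exact hg) (by simp only [hX]; exact hh)
  simp only [hX] at hle
  have hterm : ∀ n, ‖∑ i : Fin 2,
      (A n).mulVec (fun j => d.coeff (g j) n) i * conj (d.coeff (h i) n)‖ ≤
      K / d.Lam * (X g n * X h n) := fun n => by
    refine (norm_sum_mulVec_mul_conj_le (A n) (K := K * wt n) (mul_nonneg hK (hω n))
      (fun i j => by linarith [hA n i j]) _ _).trans (le_of_eq ?_)
    simp only [X]
    rw [Real.sqrt_mul (hω n), Real.sqrt_mul (hω n), Real.sqrt_mul hΛ.le, Real.sqrt_mul hΛ.le]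
    have e1 := Real.mul_self_sqrt (hω n)
    have e2 := Real.mul_self_sqrt hΛ.le
    calc _ = K * wt n / d.Lam * d.Lam * (√(∑ j, ‖d.coeff (g j) n‖ ^ 2) *
          √(∑ j, ‖d.coeff (h j) n‖ ^ 2)) := by field_simp
      _ = K * (√(wt n) * √(wt n)) / d.Lam * (√d.Lam * √d.Lam) * (√(∑ j, ‖d.coeff (g j) n‖ ^ 2) *
          √(∑ j, ‖d.coeff (h j) n‖ ^ 2)) := by rw [e1, e2]
      _ = _ := by ring
  have hS := Summable.of_norm_bounded (hs.mul_left (K / d.Lam)) hterm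
  refine ⟨hS, ?_⟩
  rw [symbolPair, norm_mul, Complex.norm_real, Real.norm_of_nonneg hΛ.le]
  calc _ ≤ d.Lam * ∑' n, K / d.Lam * (X g n * X h n) := by
        gcongr
        exact tsum_of_norm_bounded (hs.mul_left (K / d.Lam)).hasSum hterm
    _ = K * ∑' n, X g n * X h n := by rw [tsum_mul_left]; field_simp
    _ ≤ _ := by gcongr; exact hle

/-- The weight of `H^{1/2}(Γ)`. -/
def weight (n : ℤ) : ℝ := 1 + |d.alphaN n|

theorem weight_nonneg (n : ℤ) : 0 ≤ d.weight n := by unfold weight; positivity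

/-- A constant in the growth bound of the exact symbol. -/
def growth : ℝ := 2 * (d.mu + d.freq ^ 2 * (1 + d.kappa2) / d.kappa1 ^ 2)

theorem growth_nonneg : 0 ≤ d.growth := by
  have := d.mu_pos; have := d.freq_pos; have := d.kappa1_pos; have := d.kappa2_pos
  unfold growth; positivity

theorem Delta_le {k : ℝ} (hk : 0 < k) (hk2 : k ≤ d.kappa2) (n : ℤ) :
    d.Delta k n ≤ (1 + d.kappa2) * d.weight n := by
  have k2 := d.kappa2_pos
  have ha := abs_nonneg (d.alphaN n)
  have h1 : d.Delta k n ≤ k + |d.alphaN n| := by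
    refine Real.sqrt_le_left (by positivity) |>.2 ?_
    refine (abs_sub _ _).trans ?_
    rw [abs_of_nonneg (by positivity), abs_of_nonneg (by positivity), ← sq_abs (d.alphaN n)]
    nlinarith
  unfold weight
  nlinarith

theorem norm_M_le (n : ℤ) (i j : Fin 2) : ‖d.M n i j‖ ≤ d.growth / 2 * d.weight n := by
  have hμ := d.mu_pos
  have hω := d.freq_pos
  have k1 := d.kappa1_pos
  have k2 := d.kappa2_pos
  have hw := d.weight_nonneg n
  have hχ := d.kappa1_sq_le_norm_chi n
  have hχ0 := d.chi_ne_zero n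
  have ha : |d.alphaN n| ≤ d.weight n := by unfold weight; linarith [abs_nonneg (d.alphaN n)]
  have hr : ∀ x : ℂ, ‖x‖ ≤ (1 + d.kappa2) * d.weight n →
      ‖Complex.I * d.freq ^ 2 / d.chi n * x‖ ≤
        d.freq ^ 2 * (1 + d.kappa2) / d.kappa1 ^ 2 * d.weight n := fun x hx => by
    rw [norm_mul, norm_div, norm_mul, norm_pow, Complex.norm_I, one_mul, Complex.norm_real,
      Real.norm_of_nonneg hω.le]
    calc _ ≤ d.freq ^ 2 / d.kappa1 ^ 2 * ((1 + d.kappa2) * d.weight n) := by gcongr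
      _ = _ := by ring
  have hdiag : ∀ x : ℂ, ‖x‖ ≤ (1 + d.kappa2) * d.weight n →
      ‖Complex.I * d.freq ^ 2 / d.chi n * x‖ ≤ d.growth / 2 * d.weight n := fun x hx => by
    refine (hr x hx).trans ?_
    unfold growth
    nlinarith [mul_nonneg hμ.le hw]
  have hα : ‖(d.alphaN n : ℂ)‖ ≤ (1 + d.kappa2) * d.weight n := by
    rw [Complex.norm_real, Real.norm_eq_abs]; nlinarith
  have hoff : ‖Complex.I * d.mu * d.alphaN n - Complex.I * d.freq ^ 2 / d.chi n * d.alphaN n‖ ≤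
      d.growth / 2 * d.weight n := by
    refine (norm_sub_le _ _).trans ?_
    have h1 := hr _ hα
    have h2 : ‖Complex.I * d.mu * (d.alphaN n : ℂ)‖ ≤ d.mu * d.weight n := by
      rw [norm_mul, norm_mul, Complex.norm_I, one_mul, Complex.norm_real, Complex.norm_real,
        Real.norm_of_nonneg hμ.le, Real.norm_eq_abs]
      gcongr
    unfold growth
    linarith
  fin_cases i <;> fin_cases j
  · have e : d.M n 0 0 = Complex.I * d.freq ^ 2 / d.chi n * d.beta1 n := by simp [M]; ring
    exact e ▸ hdiag (d.beta1 n) (by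
      rw [beta1, d.norm_beta k1]; exact d.Delta_le k1 d.kappa1_lt_kappa2.le n)
  · have e : d.M n 0 1 =
        Complex.I * d.mu * d.alphaN n - Complex.I * d.freq ^ 2 / d.chi n * d.alphaN n := by
      simp [M]; field_simp
    exact e ▸ hoff
  · have e : d.M n 1 0 =
        -(Complex.I * d.mu * d.alphaN n - Complex.I * d.freq ^ 2 / d.chi n * d.alphaN n) := by
      simp [M]; field_simp
    rw [← norm_neg] at hoff
    exact e ▸ hoff
  · have e : d.M n 1 1 = Complex.I * d.freq ^ 2 / d.chi n * d.beta2 n := by simp [M]; ring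
    exact e ▸ hdiag (d.beta2 n) (by
      rw [beta2, d.norm_beta k2]; exact d.Delta_le k2 le_rfl n)

theorem quadratic_form_nonneg {P Q r x y : ℝ} (hP : 0 < P) (h : r ^ 2 ≤ P * Q) :
    0 ≤ P * x ^ 2 + Q * y ^ 2 - 2 * r * x * y := by
  have : 0 ≤ P * (P * x ^ 2 + Q * y ^ 2 - 2 * r * x * y) := by
    nlinarith [sq_nonneg (P * x - r * y), sq_nonneg y, mul_nonneg (sub_nonneg.2 h) (sq_nonneg y)]
  exact nonneg_of_mul_nonneg_right this hP

/-- The exact symbol is dissipative at all modes that are evanescent for both wavenumbers. -/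
theorem re_M_nonpos (hres : d.NonResonant) {n : ℤ} (hn : ¬ |d.alphaN n| < d.kappa2)
    (x : Fin 2 → ℂ) : (∑ i, (d.M n).mulVec x i * conj (x i)).re ≤ 0 := by
  have hμ := d.mu_pos
  have hω := d.freq_pos
  have k1 := d.kappa1_pos
  have k2 := d.kappa2_pos
  have k12 := d.kappa1_lt_kappa2
  have hn1 : ¬ |d.alphaN n| < d.kappa1 := fun h => hn (h.trans k12)
  have e1 := d.Delta_sq_of_not_lt k1 hn1
  have e2 := d.Delta_sq_of_not_lt k2 hn
  have p1 := d.Delta_pos k1 (hres n).1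
  have p2 := d.Delta_pos k2 (hres n).2
  have b1 : d.beta1 n = Complex.I * d.Delta d.kappa1 n := d.beta_of_not_lt k1 hn1
  have b2 : d.beta2 n = Complex.I * d.Delta d.kappa2 n := d.beta_of_not_lt k2 hn
  set Δ₁ := d.Delta d.kappa1 n
  set Δ₂ := d.Delta d.kappa2 n
  set α := d.alphaN n with hα
  set χ : ℝ := α ^ 2 - Δ₁ * Δ₂ with hχ
  have hchi : d.chi n = (χ : ℂ) := by
    rw [chi, b1, b2, hχ]; push_cast
    linear_combination (Δ₁ : ℂ) * Δ₂ * Complex.I_mul_I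
  have h21 : Δ₂ ≤ Δ₁ := abs_le_of_sq_le_sq' (by nlinarith) p1.le |>.2
  have hχ1 : 0 < χ := by nlinarith
  have hχ2 : χ ≤ d.kappa2 ^ 2 := by nlinarith
  have hω2 := d.freq_sq
  set t := d.freq ^ 2 / χ with ht
  have htχ : t * χ = d.freq ^ 2 := div_mul_cancel₀ _ hχ1.ne'
  have ht0 : 0 < t := by positivity
  have htμ : d.mu ≤ t := by
    rw [ht, le_div_iff₀ hχ1, hω2]; gcongr
  have hα2 : d.kappa2 ^ 2 ≤ α ^ 2 := by nlinarith [sq_nonneg Δ₂]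
  -- Inserting Δ₁Δ₂ = α² - χ and tχ = ω², the determinant becomes α²μ(2t - μ) - tω². It is
  -- nonnegative since t ≥ μ and ω² = μκ₂² ≤ μα².
  have hdet : (α * (d.mu - t)) ^ 2 ≤ (t * Δ₁) * (t * Δ₂) := by
    have h1 : (t * Δ₁) * (t * Δ₂) - (α * (d.mu - t)) ^ 2 =
        α ^ 2 * d.mu * (2 * t - d.mu) - t * d.freq ^ 2 := by
      rw [← htχ, hχ]; ring
    have h2 : t * d.freq ^ 2 ≤ α ^ 2 * d.mu * t := by
      rw [hω2]; nlinarith [mul_pos hμ ht0]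
    have h3 : α ^ 2 * d.mu * t ≤ α ^ 2 * d.mu * (2 * t - d.mu) := by
      gcongr; linarith
    linarith
  -- The symbol is Hermitian here, with negative diagonal and nonnegative determinant, hence
  -- negative semidefinite.
  have hM : d.M n = !![((-(t * Δ₁) : ℝ) : ℂ), Complex.I * ((α * (d.mu - t) : ℝ) : ℂ);
      -(Complex.I * ((α * (d.mu - t) : ℝ) : ℂ)), ((-(t * Δ₂) : ℝ) : ℂ)] := by
    have hχc : (χ : ℂ) ≠ 0 := by exact_mod_cast hχ1.ne'
    have htc : (t : ℂ) = (d.freq : ℂ) ^ 2 / χ := by rw [ht]; push_cast; rfl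
    rw [M, b1, b2, hchi]
    ext i j
    fin_cases i <;> fin_cases j
    · simp [htc]; field_simp
      linear_combination (d.freq : ℂ) ^ 2 * Δ₁ * Complex.I_sq
    · simp [htc]; field_simp
      rw [← hα]; ring
    · simp [htc]; field_simp
      rw [← hα]; ring
    · simp [htc]; field_simp
      linear_combination (d.freq : ℂ) ^ 2 * Δ₂ * Complex.I_sq
  have hre : (∑ i, (d.M n).mulVec x i * conj (x i)).re =
      -(t * Δ₁ * ‖x 0‖ ^ 2 + t * Δ₂ * ‖x 1‖ ^ 2 +
        2 * (α * (d.mu - t)) * ((x 1).im * (x 0).re - (x 1).re * (x 0).im)) := by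
    rw [hM]
    simp only [Matrix.mulVec, dotProduct, Fin.sum_univ_two, Complex.sq_norm, Complex.normSq_apply]
    simp
    ring
  have hcross : |(x 1).im * (x 0).re - (x 1).re * (x 0).im| ≤ ‖x 0‖ * ‖x 1‖ := by
    have h := Complex.abs_im_le_norm (x 1 * conj (x 0))
    rw [norm_mul, Complex.norm_conj, Complex.mul_im, Complex.conj_re, Complex.conj_im] at h
    rw [mul_comm ‖x 0‖]
    refine le_trans (le_of_eq ?_) h
    congr 1; ring
  have hq := quadratic_form_nonneg (x := ‖x 0‖) (y := ‖x 1‖) (r := |α * (d.mu - t)|)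
    (mul_pos ht0 p1) (by rwa [sq_abs])
  have hlow : -(|α * (d.mu - t)| * (‖x 0‖ * ‖x 1‖)) ≤
      α * (d.mu - t) * ((x 1).im * (x 0).re - (x 1).re * (x 0).im) := by
    refine le_trans ?_ (neg_abs_le _)
    rw [abs_mul (α * (d.mu - t)) _, neg_le_neg_iff]
    gcongr
  rw [hre]
  linarith

end WaveData

/-! ## The energy space as a Hilbert space -/

section Closed

variable (d : WaveData) (G : Grating d.Lam)

theorem continuous_integral_mul {ψ : ℝ × ℝ → ℂ} (hψ : Continuous ψ) :
    Continuous fun u : L2Ω d G => ∫ z in G.Ω, u z * ψ z := by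
  have hm : MemLp (fun z => conj (ψ z)) 2 (volume.restrict G.Ω) := by
    rw [← rectMeasure_restrict]
    exact (memLp_rect_of_continuous d G (Complex.continuous_conj.comp hψ)).restrict _
  have e : (fun u : L2Ω d G => ∫ z in G.Ω, u z * ψ z) = fun u => inner ℂ (hm.toLp _) u := by
    funext u
    rw [L2.inner_def]
    refine integral_congr_ae ?_
    filter_upwards [hm.coeFn_toLp] with z hz
    rw [hz, RCLike.inner_apply, RCLike.conj_conj]
  rw [e]
  exact continuous_const.inner continuous_id

theorem continuous_integral_mul_Γ {ψ : ℝ → ℂ} (hψ : Continuous ψ) :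
    Continuous fun g : L2Γ d => ∫ x in Ioo 0 d.Lam, g x * ψ x := by
  have hm : MemLp (fun z => conj (ψ z)) 2 (volume.restrict (Ioo 0 d.Lam)) :=
    memLp_of_continuous_Ioo (Complex.continuous_conj.comp hψ)
  have e : (fun g : L2Γ d => ∫ z in Ioo 0 d.Lam, g z * ψ z) = fun u => inner ℂ (hm.toLp _) u := by
    funext u
    rw [L2.inner_def]
    refine integral_congr_ae ?_
    filter_upwards [hm.coeFn_toLp] with z hz
    rw [hz, RCLike.inner_apply, RCLike.conj_conj]
  rw [e]
  exact continuous_const.inner continuous_id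

/-- Both defining conditions are families of equations between L²-continuous functionals. With the
trace recorded as a component, no trace operator has to be constructed. -/
theorem isClosed_H1Sqp : IsClosed (H1Sqp d G : Set (L2Ω d G × L2Ω d G × L2Ω d G × L2Γ d)) := by
  have e : (H1Sqp d G : Set (L2Ω d G × L2Ω d G × L2Ω d G × L2Γ d)) =
      {w | IsWeakGradient G w.1 w.2.1 w.2.2.1} ∩
        {w | HasBoundaryValues d G w.1 w.2.1 w.2.2.1 w.2.2.2} := rfl
  have c1 : ∀ {ψ : ℝ × ℝ → ℂ}, Continuous ψ → Continuous
      fun w : L2Ω d G × L2Ω d G × L2Ω d G × L2Γ d => ∫ z in G.Ω, w.1 z * ψ z := fun h =>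
    (continuous_integral_mul d G h).comp continuous_fst
  have c2 : ∀ {ψ : ℝ × ℝ → ℂ}, Continuous ψ → Continuous
      fun w : L2Ω d G × L2Ω d G × L2Ω d G × L2Γ d => ∫ z in G.Ω, w.2.1 z * ψ z := fun h =>
    (continuous_integral_mul d G h).comp (continuous_fst.comp continuous_snd)
  have c3 : ∀ {ψ : ℝ × ℝ → ℂ}, Continuous ψ → Continuous
      fun w : L2Ω d G × L2Ω d G × L2Ω d G × L2Γ d => ∫ z in G.Ω, w.2.2.1 z * ψ z := fun h =>
    (continuous_integral_mul d G h).comp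
      (continuous_fst.comp (continuous_snd.comp continuous_snd))
  rw [e]
  refine IsClosed.inter ?_ ?_
  · simp only [IsWeakGradient, ofPred_forall]
    refine isClosed_iInter fun φ => isClosed_iInter fun hφ => isClosed_iInter fun _ =>
      isClosed_iInter fun _ => IsClosed.inter ?_ ?_
    · exact isClosed_eq ((c1 (continuous_partial hφ _)).add (c2 hφ.continuous)) continuous_const
    · exact isClosed_eq ((c1 (continuous_partial hφ _)).add (c3 hφ.continuous)) continuous_const
  · simp only [HasBoundaryValues, ofPred_forall]
    refine isClosed_iInter fun φ => isClosed_iInter fun hφ => isClosed_iInter fun _ =>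
      IsClosed.inter ?_ ?_
    · exact isClosed_eq ((c1 (continuous_partial hφ _)).add (c2 hφ.continuous)) continuous_const
    · refine isClosed_eq ((c1 (continuous_partial hφ _)).add (c3 hφ.continuous)) ?_
      exact (continuous_integral_mul_Γ d (hφ.continuous.comp (by fun_prop))).comp
        (continuous_snd.comp (continuous_snd.comp continuous_snd))

instance : CompleteSpace (H1Sqp d G) := (isClosed_H1Sqp d G).completeSpace_coe

end Closed

section EnergySpace

variable {d : WaveData} {G : Grating d.Lam}

theorem V.h1Norm_nonneg (u : V d G) : 0 ≤ u.h1Norm := Real.sqrt_nonneg _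

theorem V.h1Norm_sq (u : V d G) :
    u.h1Norm ^ 2 = ∑ i, (‖u.val i‖ ^ 2 + ‖u.dx i‖ ^ 2 + ‖u.dy i‖ ^ 2) :=
  Real.sq_sqrt (Finset.sum_nonneg fun _ _ => by positivity)

theorem V.component_sq_le (u : V d G) (i : Fin 2) :
    ‖u.val i‖ ^ 2 + ‖u.dx i‖ ^ 2 + ‖u.dy i‖ ^ 2 ≤ u.h1Norm ^ 2 := by
  rw [V.h1Norm_sq]
  exact Finset.single_le_sum (f := fun i => ‖u.val i‖ ^ 2 + ‖u.dx i‖ ^ 2 + ‖u.dy i‖ ^ 2)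
    (fun _ _ => by positivity) (Finset.mem_univ i)

theorem V.norm_val_le (u : V d G) (i : Fin 2) : ‖u.val i‖ ≤ u.h1Norm :=
  abs_le_of_sq_le_sq' (by nlinarith [u.component_sq_le i, sq_nonneg ‖u.dx i‖, sq_nonneg ‖u.dy i‖])
    u.h1Norm_nonneg |>.2

theorem V.norm_dx_le (u : V d G) (i : Fin 2) : ‖u.dx i‖ ≤ u.h1Norm :=
  abs_le_of_sq_le_sq' (by nlinarith [u.component_sq_le i, sq_nonneg ‖u.val i‖, sq_nonneg ‖u.dy i‖])
    u.h1Norm_nonneg |>.2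

theorem V.norm_dy_le (u : V d G) (i : Fin 2) : ‖u.dy i‖ ≤ u.h1Norm :=
  abs_le_of_sq_le_sq' (by nlinarith [u.component_sq_le i, sq_nonneg ‖u.val i‖, sq_nonneg ‖u.dx i‖])
    u.h1Norm_nonneg |>.2

theorem V.norm_trace_le (u : V d G) (i : Fin 2) : ‖u.trace i‖ ≤ u.h1Norm :=
  abs_le_of_sq_le_sq' (by
    have h : ‖u.trace i‖ ^ 2 ≤ ‖u.val i‖ ^ 2 + ‖u.dy i‖ ^ 2 := norm_trace_sq_le d G (u i)
    nlinarith [u.component_sq_le i, sq_nonneg ‖u.dx i‖]) u.h1Norm_nonneg |>.2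

/-- The embedding of the energy space into a product of `L²(Ω)` spaces. -/
def embed (d : WaveData) (G : Grating d.Lam) :
    V d G →ₗ[ℂ] PiLp 2 fun _ : Fin 2 × Fin 3 => L2Ω d G where
  toFun u := WithLp.toLp 2 fun k => ![u.val k.1, u.dx k.1, u.dy k.1] k.2
  map_add' u v := by
    ext1 ⟨i, j⟩
    fin_cases j <;> rfl
  map_smul' c u := by
    ext1 ⟨i, j⟩
    fin_cases j <;> rfl

theorem norm_embed (u : V d G) : ‖embed d G u‖ = u.h1Norm := by
  rw [PiLp.norm_eq_of_L2, V.h1Norm, Fintype.sum_prod_type]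
  congr 1
  refine Finset.sum_congr rfl fun i _ => ?_
  rw [Fin.sum_univ_three]
  rfl

/-- The ambient maximum norm includes the trace, which the H¹ norm omits; the trace inequality with
constant 1 fills the gap. -/
theorem norm_le_h1Norm (u : V d G) : ‖u‖ ≤ u.h1Norm := by
  rw [pi_norm_le_iff_of_nonneg u.h1Norm_nonneg]
  intro i
  have : ‖u i‖ = max ‖u.val i‖ (max ‖u.dx i‖ (max ‖u.dy i‖ ‖u.trace i‖)) := rfl
  rw [this]
  exact max_le (u.norm_val_le i) (max_le (u.norm_dx_le i) (max_le (u.norm_dy_le i)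
    (u.norm_trace_le i)))

theorem h1Norm_le_norm (u : V d G) : u.h1Norm ≤ 3 * ‖u‖ := by
  have hi : ∀ i, ‖u.val i‖ ≤ ‖u‖ ∧ ‖u.dx i‖ ≤ ‖u‖ ∧ ‖u.dy i‖ ≤ ‖u‖ := fun i => by
    have h := norm_le_pi_norm u i
    have : ‖u i‖ = max ‖u.val i‖ (max ‖u.dx i‖ (max ‖u.dy i‖ ‖u.trace i‖)) := rfl
    rw [this] at h
    simp only [max_le_iff] at h
    exact ⟨h.1, h.2.1, h.2.2.1⟩
  refine abs_le_of_sq_le_sq' ?_ (by positivity) |>.2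
  rw [V.h1Norm_sq, Fin.sum_univ_two]
  have p : ∀ {x : ℝ}, 0 ≤ x → x ≤ ‖u‖ → x ^ 2 ≤ ‖u‖ ^ 2 := fun h0 h => pow_le_pow_left₀ h0 h 2
  have a1 := p (norm_nonneg _) (hi 0).1
  have a2 := p (norm_nonneg _) (hi 0).2.1
  have a3 := p (norm_nonneg _) (hi 0).2.2
  have b1 := p (norm_nonneg _) (hi 1).1
  have b2 := p (norm_nonneg _) (hi 1).2.1
  have b3 := p (norm_nonneg _) (hi 1).2.2
  nlinarith [sq_nonneg ‖u‖]

theorem embed_antilipschitz : AntilipschitzWith 1 (embed d G) :=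
  AddMonoidHomClass.antilipschitz_of_bound (embed d G) fun u => by
    rw [NNReal.coe_one, one_mul, norm_embed]; exact norm_le_h1Norm u

theorem embed_injective : Function.Injective (embed d G) := embed_antilipschitz.injective

theorem isComplete_range_embed : IsComplete (Set.range (embed d G)) := by
  have hc : UniformContinuous (embed d G) :=
    ((embed d G).mkContinuous 3 fun u => by rw [norm_embed]; exact h1Norm_le_norm u).uniformContinuous
  exact embed_antilipschitz.isComplete_range hc

/-! ## The sesquilinear forms -/

theorem integral_mul_conj (u v : L2Ω d G) : ∫ z in G.Ω, u z * conj (v z) = inner ℂ v u := by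
  rw [L2.inner_def]
  rfl

theorem integrable_mul_conj (u v : L2Ω d G) :
    Integrable (fun z => u z * conj (v z)) (volume.restrict G.Ω) :=
  (L2.integrable_inner (𝕜 := ℂ) v u).congr (Filter.Eventually.of_forall fun _ => rfl)

/-- The volume part of the form. -/
def volForm (u v : V d G) : ℂ :=
  d.mu * (∑ i, (inner ℂ (v.dx i) (u.dx i) + inner ℂ (v.dy i) (u.dy i)))
    + (d.lam + d.mu) * inner ℂ (v.dx 0 + v.dy 1) (u.dx 0 + u.dy 1)
    - d.freq ^ 2 * ∑ i, inner ℂ (v.val i) (u.val i)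

theorem form_eq (A : ℤ → Matrix (Fin 2) (Fin 2) ℂ) (u v : V d G) :
    form A u v = volForm u v -
      d.symbolPair A (fun i x => u.trace i x) (fun i x => v.trace i x) := by
  rw [form, volForm]
  have e1 : ∫ z in G.Ω, ∑ i, (u.dx i z * conj (v.dx i z) + u.dy i z * conj (v.dy i z)) =
      ∑ i, (inner ℂ (v.dx i) (u.dx i) + inner ℂ (v.dy i) (u.dy i)) := by
    refine (integral_finsetSum _ fun i _ => (integrable_mul_conj (u.dx i) (v.dx i)).add
      (integrable_mul_conj (u.dy i) (v.dy i))).trans ?_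
    refine Finset.sum_congr rfl fun i _ => ?_
    refine (integral_add (integrable_mul_conj (u.dx i) (v.dx i))
      (integrable_mul_conj (u.dy i) (v.dy i))).trans ?_
    rw [integral_mul_conj, integral_mul_conj]
  have e2 : ∫ z in G.Ω, (u.dx 0 z + u.dy 1 z) * conj (v.dx 0 z + v.dy 1 z) =
      inner ℂ (v.dx 0 + v.dy 1) (u.dx 0 + u.dy 1) := by
    rw [← integral_mul_conj]
    refine integral_congr_ae ?_
    filter_upwards [Lp.coeFn_add (u.dx 0) (u.dy 1), Lp.coeFn_add (v.dx 0) (v.dy 1)] with z h1 h2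
    rw [h1, h2]; rfl
  have e3 : ∫ z in G.Ω, ∑ i, u.val i z * conj (v.val i z) =
      ∑ i, inner ℂ (v.val i) (u.val i) := by
    rw [integral_finsetSum _ fun i _ => integrable_mul_conj (u.val i) (v.val i)]
    exact Finset.sum_congr rfl fun i _ => integral_mul_conj _ _
  rw [e1, e2, e3]

theorem coeff_add (g h : L2Γ d) (n : ℤ) :
    d.coeff (g + h : L2Γ d) n = d.coeff g n + d.coeff h n := by
  rw [WaveData.coeff, integral_add_mul_Γ d g h (by fun_prop), mul_add]
  rfl

theorem coeff_smul (c : ℂ) (g : L2Γ d) (n : ℤ) :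
    d.coeff (c • g : L2Γ d) n = c * d.coeff g n := by
  rw [WaveData.coeff, integral_smul_mul_Γ d c g, WaveData.coeff]
  ring

/-- The boundary values of `u`, as functions. -/
def V.tr (u : V d G) (i : Fin 2) (x : ℝ) : ℂ := u.trace i x

theorem V.coeff_tr_add (u v : V d G) (j : Fin 2) (n : ℤ) :
    d.coeff ((u + v).tr j) n = d.coeff (u.tr j) n + d.coeff (v.tr j) n :=
  coeff_add (u.trace j) (v.trace j) n

theorem V.coeff_tr_smul (c : ℂ) (u : V d G) (j : Fin 2) (n : ℤ) :
    d.coeff ((c • u).tr j) n = c * d.coeff (u.tr j) n :=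
  coeff_smul c (u.trace j) n

theorem V.energy_tr_le (u : V d G) :
    d.WeightedSummable d.weight u.tr ∧ d.energy d.weight u.tr ≤ 2 * u.h1Norm ^ 2 := by
  obtain ⟨s0, t0⟩ := tsum_weighted_coeff_le d G (u 0)
  obtain ⟨s1, t1⟩ := tsum_weighted_coeff_le d G (u 1)
  have e : (fun n => d.weight n * (d.Lam * ∑ j, ‖d.coeff (u.tr j) n‖ ^ 2)) = fun n =>
      (1 + |d.alphaN n|) * (d.Lam * ‖d.coeff (u 0).1.2.2.2 n‖ ^ 2) +
      (1 + |d.alphaN n|) * (d.Lam * ‖d.coeff (u 1).1.2.2.2 n‖ ^ 2) := by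
    funext n
    rw [Fin.sum_univ_two, mul_add, mul_add]
    rfl
  constructor
  · rw [WaveData.WeightedSummable, e]; exact s0.add s1
  · rw [WaveData.energy, e, s0.tsum_add s1, V.h1Norm_sq, Fin.sum_univ_two]
    have t0' : _ ≤ 2 * (‖u.val 0‖ ^ 2 + ‖u.dx 0‖ ^ 2 + ‖u.dy 0‖ ^ 2) := t0
    have t1' : _ ≤ 2 * (‖u.val 1‖ ^ 2 + ‖u.dx 1‖ ^ 2 + ‖u.dy 1‖ ^ 2) := t1
    linarith

theorem V.energy_one_tr_le (u : V d G) :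
    d.WeightedSummable (fun _ => 1) u.tr ∧ d.energy (fun _ => 1) u.tr ≤ u.h1Norm ^ 2 := by
  have s0 := (hasSum_coeff_L2Γ d (u.trace 0)).summable
  have s1 := (hasSum_coeff_L2Γ d (u.trace 1)).summable
  have t0 : _ ≤ ‖u.val 0‖ ^ 2 + ‖u.dy 0‖ ^ 2 := tsum_coeff_le d G (u 0)
  have t1 : _ ≤ ‖u.val 1‖ ^ 2 + ‖u.dy 1‖ ^ 2 := tsum_coeff_le d G (u 1)
  have e : (fun n => (1 : ℝ) * (d.Lam * ∑ j, ‖d.coeff (u.tr j) n‖ ^ 2)) = fun n =>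
      d.Lam * ‖d.coeff (u.trace 0) n‖ ^ 2 + d.Lam * ‖d.coeff (u.trace 1) n‖ ^ 2 := by
    funext n
    rw [Fin.sum_univ_two, one_mul, mul_add]
    rfl
  constructor
  · rw [WaveData.WeightedSummable, e]; exact s0.add s1
  · rw [WaveData.energy, e, s0.tsum_add s1, V.h1Norm_sq, Fin.sum_univ_two]
    refine (add_le_add t0 t1).trans ?_
    nlinarith [sq_nonneg ‖u.dx 0‖, sq_nonneg ‖u.dx 1‖]

/-- Symbols of first order. -/
def FirstOrder (d : WaveData) (A : ℤ → Matrix (Fin 2) (Fin 2) ℂ) : Prop :=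
  ∃ K, 0 ≤ K ∧ ∀ n i j, ‖A n i j‖ ≤ K / 2 * d.weight n

theorem firstOrder_M (d : WaveData) : FirstOrder d d.M := ⟨_, d.growth_nonneg, d.norm_M_le⟩

/-- Infinite sums are additive only for summable families, so additivity of the boundary pairing
depends on this. -/
theorem FirstOrder.summable {A : ℤ → Matrix (Fin 2) (Fin 2) ℂ} (hA : FirstOrder d A)
    {g h : Fin 2 → ℝ → ℂ} (hg : d.WeightedSummable d.weight g)
    (hh : d.WeightedSummable d.weight h) :
    Summable (fun n => ∑ i : Fin 2,
      (A n).mulVec (fun j => d.coeff (g j) n) i * conj (d.coeff (h i) n)) := by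
  obtain ⟨K, hK, h⟩ := hA
  exact (d.symbolPair_bound hK d.weight_nonneg h hg hh).1

theorem FirstOrder.symbolPair_le {A : ℤ → Matrix (Fin 2) (Fin 2) ℂ} (hA : FirstOrder d A) :
    ∃ K, 0 ≤ K ∧ ∀ u v : V d G, ‖d.symbolPair A u.tr v.tr‖ ≤ K * u.h1Norm * v.h1Norm := by
  obtain ⟨K, hK, h⟩ := hA
  refine ⟨K * 2, by positivity, fun u v => ?_⟩
  obtain ⟨su, hu⟩ := u.energy_tr_le
  obtain ⟨sv, hv⟩ := v.energy_tr_le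
  refine (d.symbolPair_bound hK d.weight_nonneg h su sv).2.trans ?_
  have nu := u.h1Norm_nonneg
  have nv := v.h1Norm_nonneg
  calc K * (√(d.energy d.weight u.tr) * √(d.energy d.weight v.tr))
      ≤ K * (√(2 * u.h1Norm ^ 2) * √(2 * v.h1Norm ^ 2)) := by gcongr
    _ = K * (√2 * √2) * u.h1Norm * v.h1Norm := by
        rw [Real.sqrt_mul (by norm_num), Real.sqrt_mul (by norm_num), Real.sqrt_sq nu,
          Real.sqrt_sq nv]; ring
    _ = _ := by rw [Real.mul_self_sqrt (by norm_num)]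

end EnergySpace

/-! ### Sesquilinearity, boundedness and Gårding's inequality -/

section Forms

variable {d : WaveData} {G : Grating d.Lam}

theorem symbolPair_add_left {A : ℤ → Matrix (Fin 2) (Fin 2) ℂ} (hA : FirstOrder d A)
    (u u' v : V d G) : d.symbolPair A (u + u').tr v.tr =
      d.symbolPair A u.tr v.tr + d.symbolPair A u'.tr v.tr := by
  simp only [WaveData.symbolPair]
  rw [← mul_add, ← (hA.summable u.energy_tr_le.1 v.energy_tr_le.1).tsum_add
    (hA.summable u'.energy_tr_le.1 v.energy_tr_le.1)]
  congr 2
  funext n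
  simp only [V.coeff_tr_add, Matrix.mulVec, dotProduct, Fin.sum_univ_two]
  ring

theorem symbolPair_add_right {A : ℤ → Matrix (Fin 2) (Fin 2) ℂ} (hA : FirstOrder d A)
    {g : Fin 2 → ℝ → ℂ} (hg : d.WeightedSummable d.weight g)
    (v v' : V d G) : d.symbolPair A g (v + v').tr =
      d.symbolPair A g v.tr + d.symbolPair A g v'.tr := by
  simp only [WaveData.symbolPair]
  rw [← mul_add, ← (hA.summable hg v.energy_tr_le.1).tsum_add (hA.summable hg v'.energy_tr_le.1)]
  congr 2
  funext n
  simp only [V.coeff_tr_add, map_add, Fin.sum_univ_two]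
  ring

theorem symbolPair_smul_left (A : ℤ → Matrix (Fin 2) (Fin 2) ℂ) (c : ℂ) (u v : V d G) :
    d.symbolPair A (c • u).tr v.tr = c * d.symbolPair A u.tr v.tr := by
  simp only [WaveData.symbolPair]
  rw [mul_left_comm, ← tsum_mul_left (a := c)]
  congr 2
  funext n
  simp only [V.coeff_tr_smul, Matrix.mulVec, dotProduct, Fin.sum_univ_two]
  ring

theorem symbolPair_smul_right (A : ℤ → Matrix (Fin 2) (Fin 2) ℂ) (c : ℂ) (g : Fin 2 → ℝ → ℂ)
    (v : V d G) : d.symbolPair A g (c • v).tr = conj c * d.symbolPair A g v.tr := by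
  simp only [WaveData.symbolPair]
  rw [mul_left_comm, ← tsum_mul_left (a := conj c)]
  congr 2
  funext n
  simp only [V.coeff_tr_smul, map_mul, Fin.sum_univ_two]
  ring

theorem symbolPair_sub_symbol {A B : ℤ → Matrix (Fin 2) (Fin 2) ℂ} (hA : FirstOrder d A)
    (hB : FirstOrder d B) {g h : Fin 2 → ℝ → ℂ} (hg : d.WeightedSummable d.weight g)
    (hh : d.WeightedSummable d.weight h) :
    d.symbolPair (A - B) g h = d.symbolPair A g h - d.symbolPair B g h := by
  simp only [WaveData.symbolPair]
  rw [← mul_sub, ← (hA.summable hg hh).tsum_sub (hB.summable hg hh)]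
  congr 2
  funext n
  simp only [Pi.sub_apply, Matrix.sub_mulVec, sub_mul, Finset.sum_sub_distrib]

theorem V.val_add (u v : V d G) (i : Fin 2) : (u + v).val i = u.val i + v.val i := rfl

theorem V.dx_add (u v : V d G) (i : Fin 2) : (u + v).dx i = u.dx i + v.dx i := rfl

theorem V.dy_add (u v : V d G) (i : Fin 2) : (u + v).dy i = u.dy i + v.dy i := rfl

theorem V.val_smul (c : ℂ) (u : V d G) (i : Fin 2) : (c • u).val i = c • u.val i := rfl

theorem V.dx_smul (c : ℂ) (u : V d G) (i : Fin 2) : (c • u).dx i = c • u.dx i := rfl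

theorem V.dy_smul (c : ℂ) (u : V d G) (i : Fin 2) : (c • u).dy i = c • u.dy i := rfl

theorem volForm_add_left (u u' v : V d G) :
    volForm (u + u') v = volForm u v + volForm u' v := by
  simp only [volForm, V.val_add, V.dx_add, V.dy_add, inner_add_right, inner_add_left,
    Fin.sum_univ_two]
  ring

theorem volForm_add_right (u v v' : V d G) :
    volForm u (v + v') = volForm u v + volForm u v' := by
  simp only [volForm, V.val_add, V.dx_add, V.dy_add, inner_add_right, inner_add_left,
    Fin.sum_univ_two]
  ring

theorem volForm_smul_left (c : ℂ) (u v : V d G) : volForm (c • u) v = c * volForm u v := by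
  simp only [volForm, V.val_smul, V.dx_smul, V.dy_smul, ← smul_add, inner_smul_right,
    Fin.sum_univ_two]
  ring

theorem volForm_smul_right (c : ℂ) (u v : V d G) : volForm u (c • v) = conj c * volForm u v := by
  simp only [volForm, V.val_smul, V.dx_smul, V.dy_smul, ← smul_add, inner_smul_left,
    Fin.sum_univ_two]
  ring

theorem form_eq_tr (A : ℤ → Matrix (Fin 2) (Fin 2) ℂ) (u v : V d G) :
    form A u v = volForm u v - d.symbolPair A u.tr v.tr := form_eq A u v

/-- The form of a first order symbol as a sesquilinear map. -/
def formₗ {A : ℤ → Matrix (Fin 2) (Fin 2) ℂ} (hA : FirstOrder d A) (G : Grating d.Lam) :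
    V d G →ₗ[ℂ] V d G →ₗ⋆[ℂ] ℂ :=
  LinearMap.mk₂'ₛₗ (RingHom.id ℂ) (starRingEnd ℂ) (form A)
    (fun u u' v => by
      simp only [form_eq_tr, volForm_add_left, symbolPair_add_left hA]; ring)
    (fun c u v => by
      simp only [form_eq_tr, volForm_smul_left, symbolPair_smul_left, RingHom.id_apply,
        smul_eq_mul]; ring)
    (fun u v v' => by
      simp only [form_eq_tr, volForm_add_right, symbolPair_add_right hA u.energy_tr_le.1]; ring)
    (fun c u v => by
      simp only [form_eq_tr, volForm_smul_right, symbolPair_smul_right, smul_eq_mul]; ring)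

theorem formₗ_apply {A : ℤ → Matrix (Fin 2) (Fin 2) ℂ} (hA : FirstOrder d A) (u v : V d G) :
    formₗ hA G u v = form A u v := rfl

theorem norm_inner_le_h1 {x y : L2Ω d G} {u v : V d G} (hx : ‖x‖ ≤ v.h1Norm)
    (hy : ‖y‖ ≤ u.h1Norm) : ‖inner ℂ x y‖ ≤ u.h1Norm * v.h1Norm := by
  refine (norm_inner_le_norm x y).trans ?_
  rw [mul_comm]
  exact mul_le_mul hy hx (norm_nonneg _) u.h1Norm_nonneg

theorem norm_volForm_le (u v : V d G) :
    ‖volForm u v‖ ≤ (4 * d.mu + 4 * (d.lam + d.mu) + 2 * d.freq ^ 2) * u.h1Norm * v.h1Norm := by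
  have hμ := d.mu_pos
  have hlm := d.lam_add_mu_pos
  set N := u.h1Norm * v.h1Norm with hN
  have a : ∀ i, ‖inner ℂ (v.dx i) (u.dx i)‖ ≤ N := fun i =>
    norm_inner_le_h1 (v.norm_dx_le i) (u.norm_dx_le i)
  have b : ∀ i, ‖inner ℂ (v.dy i) (u.dy i)‖ ≤ N := fun i =>
    norm_inner_le_h1 (v.norm_dy_le i) (u.norm_dy_le i)
  have c : ∀ i, ‖inner ℂ (v.val i) (u.val i)‖ ≤ N := fun i =>
    norm_inner_le_h1 (v.norm_val_le i) (u.norm_val_le i)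
  have e : ‖inner ℂ (v.dx 0 + v.dy 1) (u.dx 0 + u.dy 1)‖ ≤ 4 * N := by
    refine (norm_inner_le_norm _ _).trans ?_
    have h1 : ∀ w : V d G, ‖w.dx 0 + w.dy 1‖ ≤ 2 * w.h1Norm := fun w =>
      (norm_add_le _ _).trans (by linarith [w.norm_dx_le 0, w.norm_dy_le 1])
    calc _ ≤ (2 * v.h1Norm) * (2 * u.h1Norm) :=
          mul_le_mul (h1 v) (h1 u) (norm_nonneg _) (by linarith [v.h1Norm_nonneg])
      _ = _ := by rw [hN]; ring
  have h1 : ‖(d.mu : ℂ) * ∑ i, (inner ℂ (v.dx i) (u.dx i) + inner ℂ (v.dy i) (u.dy i))‖ ≤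
      4 * d.mu * N := by
    rw [norm_mul, Complex.norm_real, Real.norm_of_nonneg hμ.le, Fin.sum_univ_two]
    have h := norm_add_le (inner ℂ (v.dx 0) (u.dx 0) + inner ℂ (v.dy 0) (u.dy 0))
      (inner ℂ (v.dx 1) (u.dx 1) + inner ℂ (v.dy 1) (u.dy 1))
    have h0 := norm_add_le (inner ℂ (v.dx 0) (u.dx 0)) (inner ℂ (v.dy 0) (u.dy 0))
    have h1 := norm_add_le (inner ℂ (v.dx 1) (u.dx 1)) (inner ℂ (v.dy 1) (u.dy 1))
    nlinarith [a 0, a 1, b 0, b 1]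
  have h2 : ‖((d.lam : ℂ) + d.mu) * inner ℂ (v.dx 0 + v.dy 1) (u.dx 0 + u.dy 1)‖ ≤
      4 * (d.lam + d.mu) * N := by
    rw [norm_mul, ← Complex.ofReal_add, Complex.norm_real, Real.norm_of_nonneg hlm.le]
    nlinarith
  have h3 : ‖(d.freq : ℂ) ^ 2 * ∑ i, inner ℂ (v.val i) (u.val i)‖ ≤ 2 * d.freq ^ 2 * N := by
    rw [norm_mul, norm_pow, Complex.norm_real, Real.norm_of_nonneg d.freq_pos.le,
      Fin.sum_univ_two]
    have h := norm_add_le (inner ℂ (v.val 0) (u.val 0)) (inner ℂ (v.val 1) (u.val 1))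
    nlinarith [c 0, c 1, sq_nonneg d.freq]
  rw [volForm]
  refine (norm_sub_le _ _).trans ((add_le_add_left (norm_add_le _ _) _).trans ?_)
  rw [mul_assoc, ← hN]
  linarith

theorem exists_norm_form_le {A : ℤ → Matrix (Fin 2) (Fin 2) ℂ} (hA : FirstOrder d A)
    (G : Grating d.Lam) :
    ∃ K, ∀ u v : V d G, ‖form A u v‖ ≤ K * u.h1Norm * v.h1Norm := by
  obtain ⟨K, -, hK⟩ := hA.symbolPair_le (G := G)
  refine ⟨(4 * d.mu + 4 * (d.lam + d.mu) + 2 * d.freq ^ 2) + K, fun u v => ?_⟩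
  rw [form_eq_tr]
  refine (norm_sub_le _ _).trans ?_
  linarith [norm_volForm_le u v, hK u v]

theorem re_volForm_self_ge (u : V d G) :
    d.mu * ∑ i, (‖u.dx i‖ ^ 2 + ‖u.dy i‖ ^ 2) - d.freq ^ 2 * ∑ i, ‖u.val i‖ ^ 2 ≤
      (volForm u u).re := by
  have hself : ∀ x : L2Ω d G, inner ℂ x x = ((‖x‖ ^ 2 : ℝ) : ℂ) := fun x => by
    rw [inner_self_eq_norm_sq_to_K]; norm_cast
  have e : volForm u u = ((d.mu * ∑ i, (‖u.dx i‖ ^ 2 + ‖u.dy i‖ ^ 2) +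
      (d.lam + d.mu) * ‖u.dx 0 + u.dy 1‖ ^ 2 - d.freq ^ 2 * ∑ i, ‖u.val i‖ ^ 2 : ℝ) : ℂ) := by
    rw [volForm]
    simp only [hself]
    push_cast
    ring
  rw [e, Complex.ofReal_re]
  have := mul_nonneg d.lam_add_mu_pos.le (sq_nonneg ‖u.dx 0 + u.dy 1‖)
  linarith

/-- The boundary term is bounded above by finitely many Fourier coefficients. -/
theorem re_symbolPair_M_le (hres : d.NonResonant) (u : V d G) :
    (d.symbolPair d.M u.tr u.tr).re ≤
      ∑ n ∈ (d.finite_abs_alphaN_lt d.kappa2).toFinset, ∑ i,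
        d.Lam * (d.growth * (1 + d.kappa2)) * ‖d.coeff (u.tr i) n‖ ^ 2 := by
  have hΛ := d.Lam_pos
  set T := (d.finite_abs_alphaN_lt d.kappa2).toFinset with hT
  let τ : ℤ → ℂ := fun n => ∑ i : Fin 2,
    (d.M n).mulVec (fun j => d.coeff (u.tr j) n) i * conj (d.coeff (u.tr i) n)
  have hs : Summable τ := (firstOrder_M d).summable u.energy_tr_le.1 u.energy_tr_le.1
  have hre : Summable fun n => (τ n).re := (Complex.hasSum_re hs.hasSum).summable
  have e : (d.symbolPair d.M u.tr u.tr).re = d.Lam * ∑' n, (τ n).re := by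
    rw [WaveData.symbolPair, Complex.re_ofReal_mul, Complex.re_tsum hs]
  let β : ℤ → ℝ := fun n => d.growth * (1 + d.kappa2) * ∑ i, ‖d.coeff (u.tr i) n‖ ^ 2
  -- Modes with |α_n| < κ₂ have weight at most 1 + κ₂ and are estimated crudely; all others
  -- contribute a nonpositive real part.
  have hterm : ∀ n, (τ n).re ≤ if n ∈ T then β n else 0 := fun n => by
    split_ifs with hn
    · have hn' : |d.alphaN n| < d.kappa2 := by simpa [hT] using hn
      have hS : 0 ≤ ∑ i, ‖d.coeff (u.tr i) n‖ ^ 2 := Finset.sum_nonneg fun _ _ => by positivity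
      have h := norm_sum_mulVec_mul_conj_le (d.M n) (K := d.growth * d.weight n)
        (mul_nonneg d.growth_nonneg (d.weight_nonneg n))
        (fun i j => by linarith [d.norm_M_le n i j]) (fun j => d.coeff (u.tr j) n)
        (fun j => d.coeff (u.tr j) n)
      rw [Real.mul_self_sqrt hS] at h
      refine (Complex.re_le_norm _).trans (h.trans ?_)
      have hw : d.weight n ≤ 1 + d.kappa2 := by unfold WaveData.weight; linarith
      have := d.growth_nonneg
      simp only [β]
      gcongr
    · exact d.re_M_nonpos hres (by simpa [hT] using hn) _
  have hT' : HasSum (fun n => if n ∈ T then β n else 0) (∑ n ∈ T, β n) := by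
    have := hasSum_sum_of_ne_finset_zero (L := .unconditional _)
      (f := fun n => if n ∈ T then β n else 0) (s := T) fun k hk => if_neg hk
    convert this using 1
    exact Finset.sum_congr rfl fun k hk => (if_pos hk).symm
  rw [e]
  refine (mul_le_mul_of_nonneg_left (hasSum_le hterm hre.hasSum hT') hΛ.le).trans (le_of_eq ?_)
  rw [Finset.mul_sum]
  refine Finset.sum_congr rfl fun n _ => ?_
  simp only [β, Finset.mul_sum]
  exact Finset.sum_congr rfl fun i _ => by ring

/-- Gårding's inequality up to finitely many functionals. -/
theorem exists_garding (hres : d.NonResonant) (G : Grating d.Lam) :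
    ∃ (ι : Type) (_ : Fintype ι) (ℓ : ι → V d G →ₗ[ℂ] ℂ),
      (∀ k, ∃ C, ∀ u, ‖ℓ k u‖ ≤ C * u.h1Norm) ∧
      ∀ u : V d G, d.mu / 2 * u.h1Norm ^ 2 ≤ (form d.M u u).re + ∑ k, ‖ℓ k u‖ ^ 2 := by
  have hΛ := d.Lam_pos
  have hμ := d.mu_pos
  have hω := d.freq_pos
  have k2 := d.kappa2_pos
  have hL : 0 < G.b - G.floor := sub_pos.2 G.floor_lt_b
  have hμω : 0 < d.mu + d.freq ^ 2 := by positivity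
  -- The volume part is at least μ‖u‖²_{H¹} - (μ + ω²)‖u‖²; with this ε the negative term costs half
  -- of the first one and finitely many modes.
  obtain ⟨S, hS⟩ := norm_sq_le_of_finite_modes d G (ε := d.mu / (2 * (d.mu + d.freq ^ 2)))
    (by positivity)
  set T := (d.finite_abs_alphaN_lt d.kappa2).toFinset with hT
  set C₁ := d.Lam * (d.growth * (1 + d.kappa2)) with hC₁
  set C₂ := (d.mu + d.freq ^ 2) * (d.Lam * (G.b - G.floor))⁻¹ with hC₂
  have hC₁0 : 0 ≤ C₁ := by have := d.growth_nonneg; positivity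
  have hC₂0 : 0 ≤ C₂ := by positivity
  -- One family consists of trace coefficients for the boundary term, the other of box modes for the
  -- lower-order volume term.
  let ℓ : (T ⊕ S) × Fin 2 → V d G →ₗ[ℂ] ℂ := fun k =>
    Sum.elim
      (fun n : T => (√C₁ : ℂ) • ({ toFun := fun u => d.coeff (u.tr k.2) n
                                   map_add' := fun u v => V.coeff_tr_add u v k.2 n
                                   map_smul' := fun c u => V.coeff_tr_smul c u k.2 n } :
          V d G →ₗ[ℂ] ℂ))
      (fun m : S => (√C₂ : ℂ) • ({ toFun := fun u =>
                                     modePair d G m.1.1 (Complex.I * boxFreq d G m.1.2) (u.val k.2)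
                                   map_add' := fun u v => modePair_add d G _ _ _ _
                                   map_smul' := fun c u => modePair_smul d G _ _ _ _ } :
          V d G →ₗ[ℂ] ℂ)) k.1
  have hℓ1 : ∀ n i u, ℓ (Sum.inl n, i) u = (√C₁ : ℂ) * d.coeff (u.tr i) n := fun n i u => rfl
  have hℓ2 : ∀ m i u, ℓ (Sum.inr m, i) u =
      (√C₂ : ℂ) * modePair d G m.1.1 (Complex.I * boxFreq d G m.1.2) (u.val i) :=
    fun m i u => rfl
  have hn : ∀ {C : ℝ} (_ : 0 ≤ C) (x : ℂ), ‖(√C : ℂ) * x‖ ^ 2 = C * ‖x‖ ^ 2 := fun {C} h0 x => by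
    rw [norm_mul, mul_pow, Complex.norm_real, Real.norm_of_nonneg (Real.sqrt_nonneg _),
      Real.sq_sqrt h0]
  refine ⟨(T ⊕ S) × Fin 2, inferInstance, ℓ, ?_, fun u => ?_⟩
  · have hb : ∀ {x N c : ℝ}, 0 < c → 0 ≤ N → c * x ^ 2 ≤ N ^ 2 → x ≤ √c⁻¹ * N :=
      fun {x N c} hc hN h => by
        refine abs_le_of_sq_le_sq' ?_ (by positivity) |>.2
        rw [mul_pow, Real.sq_sqrt (by positivity), inv_mul_eq_div, le_div_iff₀ hc]
        linarith
    rintro ⟨n | m, i⟩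
    · refine ⟨√C₁ * √d.Lam⁻¹, fun u => ?_⟩
      rw [hℓ1, norm_mul, Complex.norm_real, Real.norm_of_nonneg (Real.sqrt_nonneg _), mul_assoc]
      gcongr
      refine hb hΛ u.h1Norm_nonneg ?_
      have h1 := le_hasSum (hasSum_coeff_L2Γ d (u.trace i)) n.1 fun _ _ => by positivity
      exact h1.trans (pow_le_pow_left₀ (norm_nonneg _) (u.norm_trace_le i) 2)
    · refine ⟨√C₂ * √((d.Lam * (G.b - G.floor))⁻¹)⁻¹, fun u => ?_⟩
      rw [hℓ2, norm_mul, Complex.norm_real, Real.norm_of_nonneg (Real.sqrt_nonneg _), mul_assoc]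
      gcongr
      refine hb (by positivity) u.h1Norm_nonneg ?_
      have h1 := le_hasSum (hasSum_box_modePair d G (u.val i)) m.1 fun _ _ => by positivity
      exact h1.trans (pow_le_pow_left₀ (norm_nonneg _) (u.norm_val_le i) 2)
  · have e : ∑ k, ‖ℓ k u‖ ^ 2 = (∑ n ∈ T, ∑ i, C₁ * ‖d.coeff (u.tr i) n‖ ^ 2) +
        ∑ m ∈ S, ∑ i, C₂ *
          ‖modePair d G m.1 (Complex.I * boxFreq d G m.2) (u.val i)‖ ^ 2 := by
      rw [Fintype.sum_prod_type, Fintype.sum_sum_type]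
      simp only [hℓ1, hℓ2, hn hC₁0, hn hC₂0]
      rw [Finset.sum_coe_sort T fun n => ∑ i, C₁ * ‖d.coeff (u.tr i) n‖ ^ 2,
        Finset.sum_coe_sort S fun m => ∑ i, C₂ *
          ‖modePair d G m.1 (Complex.I * boxFreq d G m.2) (u.val i)‖ ^ 2]
    have h1 := re_symbolPair_M_le hres u
    have h2 := re_volForm_self_ge u
    have h3 : ∀ i, (d.mu + d.freq ^ 2) * ‖u.val i‖ ^ 2 ≤
        d.mu / 2 * (‖u.val i‖ ^ 2 + ‖u.dx i‖ ^ 2 + ‖u.dy i‖ ^ 2) +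
        ∑ m ∈ S, C₂ * ‖modePair d G m.1 (Complex.I * boxFreq d G m.2) (u.val i)‖ ^ 2 := fun i => by
      have h := mul_le_mul_of_nonneg_left (hS (u i)) hμω.le
      refine h.trans (le_of_eq ?_)
      rw [mul_add, Finset.mul_sum]
      congr 1
      · rw [← mul_assoc]
        congr 1
        field_simp
      · exact Finset.sum_congr rfl fun m _ => by rw [hC₂, mul_assoc]; rfl
    have h4 := add_le_add (h3 0) (h3 1)
    have e2 : ∑ m ∈ S, ∑ i, C₂ *
        ‖modePair d G m.1 (Complex.I * boxFreq d G m.2) (u.val i)‖ ^ 2 =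
        (∑ m ∈ S, C₂ * ‖modePair d G m.1 (Complex.I * boxFreq d G m.2) (u.val 0)‖ ^ 2) +
        ∑ m ∈ S, C₂ * ‖modePair d G m.1 (Complex.I * boxFreq d G m.2) (u.val 1)‖ ^ 2 := by
      rw [← Finset.sum_add_distrib]
      exact Finset.sum_congr rfl fun m _ => Fin.sum_univ_two _
    rw [e, e2, form_eq_tr, Complex.sub_re, V.h1Norm_sq]
    simp only [Fin.sum_univ_two (f := fun i => ‖u.val i‖ ^ 2 + ‖u.dx i‖ ^ 2 + ‖u.dy i‖ ^ 2),
      Fin.sum_univ_two (f := fun i => ‖u.dx i‖ ^ 2 + ‖u.dy i‖ ^ 2),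
      Fin.sum_univ_two (f := fun i => ‖u.val i‖ ^ 2)] at h2 ⊢
    linarith

end Forms

/-! ## Test functions and an upper bound for the inf-sup constant -/

section TestFunctions

variable (d : WaveData) (G : Grating d.Lam)

theorem memLp_Ω_of_continuous {f : ℝ × ℝ → ℂ} (hf : Continuous f) :
    MemLp f 2 (volume.restrict G.Ω) := by
  rw [← rectMeasure_restrict]
  exact (memLp_rect_of_continuous d G hf).restrict _

theorem isOpen_Ω : IsOpen G.Ω :=
  G.isOpen.inter ((isOpen_lt continuous_const continuous_fst).inter
    ((isOpen_lt continuous_fst continuous_const).inter (isOpen_lt continuous_snd continuous_const)))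

theorem Ω_nonempty : G.Ω.Nonempty := by
  obtain ⟨c, hc, h⟩ := G.above
  have hΛ := d.Lam_pos
  refine ⟨(d.Lam / 2, (c + G.b) / 2), h _ _ (by linarith), ?_, ?_, ?_⟩ <;> simp only <;> linarith

/-- The integrands vanish off `Ω`, so one integrates by parts in the whole plane. No support
condition on φ is required, which yields the boundary conditions with zero trace. -/
theorem integral_by_parts_Ω {f φ : ℝ × ℝ → ℂ} (hf : ContDiff ℝ ∞ f) (hc : HasCompactSupport f)
    (hs : tsupport f ⊆ G.Ω) (hφ : ContDiff ℝ ∞ φ) (v : ℝ × ℝ) :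
    (∫ z in G.Ω, f z * fderiv ℝ φ z v) + ∫ z in G.Ω, fderiv ℝ f z v * φ z = 0 := by
  have hf' := continuous_partial hf v
  have hφ' := continuous_partial hφ v
  have hc' : HasCompactSupport fun z => fderiv ℝ f z v := hc.fderiv_apply ℝ v
  have z1 : ∀ z, z ∉ G.Ω → f z = 0 := fun z hz => image_eq_zero_of_notMem_tsupport fun h => hz (hs h)
  have z2 : ∀ z, z ∉ G.Ω → fderiv ℝ f z v = 0 := fun z hz => by
    rw [fderiv_of_notMem_tsupport ℝ fun h => hz (hs h)]; rfl
  rw [setIntegral_eq_integral_of_forall_compl_eq_zero fun z hz => by rw [z1 z hz, zero_mul],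
    setIntegral_eq_integral_of_forall_compl_eq_zero fun z hz => by rw [z2 z hz, zero_mul],
    integral_mul_fderiv_eq_neg_fderiv_mul_of_integrable
      ((hf'.mul hφ.continuous).integrable_of_hasCompactSupport hc'.mul_right)
      ((hf.continuous.mul hφ').integrable_of_hasCompactSupport hc.mul_right)
      ((hf.continuous.mul hφ.continuous).integrable_of_hasCompactSupport hc.mul_right)
      (fun x _ => (hf.differentiable (by simp)).differentiableAt)
      (fun x _ => (hφ.differentiable (by simp)).differentiableAt)]
  exact neg_add_cancel _

/-- A test function as an element of `H¹_{S,qp}(Ω)`. -/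
def ofTest (f : ℝ × ℝ → ℂ) (hf : ContDiff ℝ ∞ f) (hc : HasCompactSupport f)
    (hs : tsupport f ⊆ G.Ω) : H1Sqp d G :=
  ⟨((memLp_Ω_of_continuous d G hf.continuous).toLp f,
    (memLp_Ω_of_continuous d G (continuous_partial hf (1, 0))).toLp _,
    (memLp_Ω_of_continuous d G (continuous_partial hf (0, 1))).toLp _, 0), by
    have key : ∀ (g : ℝ × ℝ → ℂ) (hg : Continuous g) (ψ : ℝ × ℝ → ℂ),
        ∫ z in G.Ω, ((memLp_Ω_of_continuous d G hg).toLp g : L2Ω d G) z * ψ z =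
          ∫ z in G.Ω, g z * ψ z := fun g hg ψ => by
      refine integral_congr_ae ?_
      filter_upwards [(memLp_Ω_of_continuous d G hg).coeFn_toLp] with z hz
      rw [hz]
    refine ⟨fun φ hφ _ _ => ?_, fun φ hφ _ => ?_⟩
    · simp only [key _ hf.continuous, key _ (continuous_partial hf _)]
      exact ⟨integral_by_parts_Ω d G hf hc hs hφ _, integral_by_parts_Ω d G hf hc hs hφ _⟩
    · simp only [key _ hf.continuous, key _ (continuous_partial hf _)]
      refine ⟨integral_by_parts_Ω d G hf hc hs hφ _, ?_⟩
      rw [integral_by_parts_Ω d G hf hc hs hφ _]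
      exact (integral_zero_mul_Γ d fun x => φ (x, G.b)).symm⟩

/-- There are test functions that oscillate in the `x`-direction as fast as desired. -/
theorem exists_oscillating_test (k : ℝ) :
    ∃ w : H1Sqp d G, w.1.2.2.2 = 0 ∧ w.1.1 ≠ 0 ∧ k * ‖w.1.1‖ ≤ ‖w.1.2.1‖ := by
  obtain ⟨z₀, hz₀⟩ := Ω_nonempty d G
  obtain ⟨b, hbs, hbc, hb, -, hb1⟩ := exists_contDiff_tsupport_subset (n := ⊤)
    ((isOpen_Ω d G).mem_nhds hz₀)
  let e : ℝ × ℝ → ℂ := fun z => Complex.exp (Complex.I * k * z.1)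
  let f : ℝ × ℝ → ℂ := fun z => (b z : ℂ) * e z
  have hfst : ContDiff ℝ ∞ fun z : ℝ × ℝ => (z.1 : ℂ) :=
    (Complex.ofRealCLM ∘L ContinuousLinearMap.fst ℝ ℝ ℝ).contDiff
  have he : ContDiff ℝ ∞ e := (contDiff_const.mul hfst).cexp
  have hb' : ContDiff ℝ ∞ fun z => (b z : ℂ) := Complex.ofRealCLM.contDiff.comp hb
  have hf : ContDiff ℝ ∞ f := hb'.mul he
  have hbc' : HasCompactSupport fun z => (b z : ℂ) := hbc.comp_left Complex.ofReal_zero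
  have hc : HasCompactSupport f := hbc'.mul_right
  have hs : tsupport f ⊆ G.Ω :=
    (tsupport_mul_subset_left (f := fun z => (b z : ℂ)) (g := e)).trans
      ((tsupport_comp_subset Complex.ofReal_zero b).trans hbs)
  have hen : ∀ z, ‖e z‖ = 1 := fun z => by
    have h := norm_exp_neg_I_mul (-k) z.1
    have h' : e z = Complex.exp (-(Complex.I * ((-k : ℝ) : ℂ) * z.1)) := by
      simp only [e]; congr 1; push_cast; ring
    rw [h', h]
  have hder : ∀ z, fderiv ℝ f z (1, 0) =
      ((fderiv ℝ b z (1, 0) : ℝ) + Complex.I * (k * b z : ℝ)) * e z := fun z => by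
    have h1 : HasFDerivAt (fun z : ℝ × ℝ => (z.1 : ℂ))
        (Complex.ofRealCLM ∘L ContinuousLinearMap.fst ℝ ℝ ℝ) z :=
      (Complex.ofRealCLM ∘L ContinuousLinearMap.fst ℝ ℝ ℝ).hasFDerivAt
    have h2 := (h1.const_mul (Complex.I * k)).cexp
    have h3 : HasFDerivAt (fun z => (b z : ℂ)) (Complex.ofRealCLM ∘L fderiv ℝ b z) z :=
      Complex.ofRealCLM.hasFDerivAt.comp z
        (hb.differentiable (by simp)).differentiableAt.hasFDerivAt
    have h4 := (h3.mul h2).fderiv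
    have h5 : fderiv ℝ f z = _ := h4
    rw [h5]
    simp [e]
    ring
  -- As b is real, k b is the imaginary part of ∂_x b + i k b.
  have hle : ∀ z, ‖(k : ℂ) * f z‖ ≤ ‖fderiv ℝ f z (1, 0)‖ := fun z => by
    rw [hder, norm_mul, norm_mul, norm_mul, hen, mul_one, mul_one, ← norm_mul,
      ← Complex.ofReal_mul, Complex.norm_real, Real.norm_eq_abs]
    have := Complex.abs_im_le_norm ((fderiv ℝ b z (1, 0) : ℝ) + Complex.I * (k * b z : ℝ) : ℂ)
    refine le_trans (le_of_eq ?_) this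
    simp
  refine ⟨ofTest d G f hf hc hs, rfl, fun h0 => ?_, ?_⟩
  · have h1 : f =ᵐ[volume.restrict G.Ω] 0 := by
      have h2 := (memLp_Ω_of_continuous d G hf.continuous).coeFn_toLp
      have h0' : (memLp_Ω_of_continuous d G hf.continuous).toLp f = 0 := h0
      rw [h0'] at h2
      exact h2.symm.trans (Lp.coeFn_zero _ _ _)
    have h2 := Measure.eqOn_open_of_ae_eq h1 (isOpen_Ω d G) hf.continuous.continuousOn
      continuousOn_const hz₀
    have h3 : ‖f z₀‖ = 1 := by
      simp only [f]; rw [norm_mul, hen, hb1]; simp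
    rw [h2] at h3
    simp at h3
  · by_cases hk : 0 ≤ k
    · rw [← Real.norm_of_nonneg hk, ← Complex.norm_real, ← norm_smul]
      refine Lp.norm_le_norm_of_ae_le ?_
      filter_upwards [Lp.coeFn_smul (k : ℂ) (ofTest d G f hf hc hs).1.1,
        (memLp_Ω_of_continuous d G hf.continuous).coeFn_toLp,
        (memLp_Ω_of_continuous d G (continuous_partial hf (1, 0))).coeFn_toLp] with z h1 h2 h3
      rw [h1, Pi.smul_apply]
      change ‖(k : ℂ) • ((memLp_Ω_of_continuous d G hf.continuous).toLp f : L2Ω d G) z‖ ≤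
        ‖((memLp_Ω_of_continuous d G (continuous_partial hf (1, 0))).toLp _ : L2Ω d G) z‖
      rw [h2, h3, smul_eq_mul]
      exact hle z
    · exact (mul_nonpos_of_nonpos_of_nonneg (not_le.1 hk).le (norm_nonneg _)).trans (norm_nonneg _)

end TestFunctions

/-! ### Consequences of the inf-sup condition -/

section InfSup

variable {d : WaveData} {G : Grating d.Lam}

theorem aNorm_le {u : V d G} {B : ℝ} (hB : 0 ≤ B)
    (h : ∀ v : V d G, ‖form d.M u v‖ ≤ B * v.h1Norm) : aNorm u ≤ ENNReal.ofReal B :=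
  iSup₂_le fun v _ => ENNReal.ofReal_le_ofReal (div_le_of_le_mul₀ v.h1Norm_nonneg hB (h v))

theorem InfSup.le_of_forall {γ : ℝ} (h : InfSup G γ) {u : V d G} {B : ℝ} (hB : 0 ≤ B)
    (hu : ∀ v : V d G, ‖form d.M u v‖ ≤ B * v.h1Norm) : γ * u.h1Norm ≤ B :=
  (ENNReal.ofReal_le_ofReal_iff hB).1 ((h u).trans (aNorm_le hB hu))

/-- For a field (f, 0) with zero trace the boundary term drops out, and fast oscillation gives ω²‖f‖
≤ μ‖∂_x f‖. Then |a(u, v)| ≤ (μ + 2(λ+μ) + μ) ‖∇f‖ ‖v‖, while ‖∇f‖ ≤ ‖u‖. -/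
theorem InfSup.le {γ : ℝ} (h : InfSup G γ) : γ ≤ 2 * (d.lam + 2 * d.mu) := by
  have hμ := d.mu_pos
  have hω := d.freq_pos
  have hlm := d.lam_add_mu_pos
  obtain ⟨w, hw0, hw1, hw2⟩ := exists_oscillating_test d G (d.freq ^ 2 / d.mu)
  let u : V d G := ![w, 0]
  have hval1 : u.val 1 = 0 := rfl
  have hdx1 : u.dx 1 = 0 := rfl
  have hdy1 : u.dy 1 = 0 := rfl
  have htr : ∀ i, u.trace i = 0 := fun i => by
    fin_cases i
    · exact hw0
    · rfl
  have hc0 : ∀ i n, d.coeff (u.tr i) n = 0 := fun i n => by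
    have h1 : d.coeff (u.tr i) n = d.coeff ((0 : ℂ) • u.trace i : L2Γ d) n := by
      rw [htr, smul_zero, ← htr i]; rfl
    rw [h1, coeff_smul, zero_mul]
  set f := u.val 0 with hf
  set p := u.dx 0 with hp
  set q := u.dy 0 with hq
  set P := √(‖p‖ ^ 2 + ‖q‖ ^ 2) with hP
  have hP2 : P ^ 2 = ‖p‖ ^ 2 + ‖q‖ ^ 2 := Real.sq_sqrt (by positivity)
  have hP0 : 0 ≤ P := Real.sqrt_nonneg _
  have hpP : ‖p‖ ≤ P := abs_le_of_sq_le_sq' (by nlinarith [sq_nonneg ‖q‖]) hP0 |>.2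
  have hfp : d.freq ^ 2 * ‖f‖ ≤ d.mu * ‖p‖ := by
    have h1 : d.freq ^ 2 / d.mu * ‖f‖ ≤ ‖p‖ := hw2
    rw [div_mul_eq_mul_div, div_le_iff₀ hμ] at h1
    linarith
  have hf0 : 0 < ‖f‖ := norm_pos_iff.2 hw1
  have hPpos : 0 < P := by
    have : 0 < d.mu * ‖p‖ := lt_of_lt_of_le (by positivity) hfp
    exact (pos_of_mul_pos_right this hμ.le).trans_le hpP
  have hB : ∀ v : V d G, ‖form d.M u v‖ ≤ (2 * (d.lam + 2 * d.mu) * P) * v.h1Norm := fun v => by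
    have hpair : d.symbolPair d.M u.tr v.tr = 0 := by
      rw [WaveData.symbolPair]
      simp only [hc0, Matrix.mulVec, dotProduct, mul_zero, Finset.sum_const_zero, zero_mul,
        tsum_zero]
    have e : form d.M u v = d.mu * (inner ℂ (v.dx 0) p + inner ℂ (v.dy 0) q) +
        (d.lam + d.mu) * inner ℂ (v.dx 0 + v.dy 1) p - d.freq ^ 2 * inner ℂ (v.val 0) f := by
      rw [form_eq_tr, hpair, sub_zero, volForm]
      simp only [Fin.sum_univ_two, hval1, hdx1, hdy1, inner_zero_right, add_zero]
      rfl
    have hv := v.component_sq_le 0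
    have n0 := v.h1Norm_nonneg
    have h1 : ‖inner ℂ (v.dx 0) p + inner ℂ (v.dy 0) q‖ ≤ P * v.h1Norm := by
      refine (norm_add_le _ _).trans ((add_le_add (norm_inner_le_norm _ _)
        (norm_inner_le_norm _ _)).trans ?_)
      refine abs_le_of_sq_le_sq' ?_ (by positivity) |>.2
      rw [mul_pow, hP2]
      have h2 : ‖v.dx 0‖ ^ 2 + ‖v.dy 0‖ ^ 2 ≤ v.h1Norm ^ 2 := by nlinarith [sq_nonneg ‖v.val 0‖]
      refine le_trans ?_ (mul_le_mul_of_nonneg_left h2 (by positivity))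
      nlinarith [sq_nonneg (‖v.dx 0‖ * ‖q‖ - ‖v.dy 0‖ * ‖p‖)]
    have h2 : ‖inner ℂ (v.dx 0 + v.dy 1) p‖ ≤ 2 * (P * v.h1Norm) := by
      refine (norm_inner_le_norm _ _).trans ?_
      have h3 : ‖v.dx 0 + v.dy 1‖ ≤ 2 * v.h1Norm :=
        (norm_add_le _ _).trans (by linarith [v.norm_dx_le 0, v.norm_dy_le 1])
      calc _ ≤ (2 * v.h1Norm) * P := mul_le_mul h3 hpP (norm_nonneg _) (by positivity)
        _ = _ := by ring
    have h3 : d.freq ^ 2 * ‖inner ℂ (v.val 0) f‖ ≤ d.mu * (P * v.h1Norm) := by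
      calc d.freq ^ 2 * ‖inner ℂ (v.val 0) f‖ ≤ d.freq ^ 2 * (‖v.val 0‖ * ‖f‖) := by
            gcongr; exact norm_inner_le_norm _ _
        _ = ‖v.val 0‖ * (d.freq ^ 2 * ‖f‖) := by ring
        _ ≤ v.h1Norm * (d.mu * P) :=
            mul_le_mul (v.norm_val_le 0) (hfp.trans (by gcongr)) (by positivity) n0
        _ = _ := by ring
    rw [e]
    refine (norm_sub_le _ _).trans ((add_le_add_left (norm_add_le _ _) _).trans ?_)
    rw [norm_mul, norm_mul, norm_mul, norm_pow, ← Complex.ofReal_add, Complex.norm_real,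
      Complex.norm_real, Complex.norm_real, Real.norm_of_nonneg hμ.le, Real.norm_of_nonneg hlm.le,
      Real.norm_of_nonneg hω.le]
    have a1 := mul_le_mul_of_nonneg_left h1 hμ.le
    have a2 := mul_le_mul_of_nonneg_left h2 hlm.le
    linarith
  have hmain := h.le_of_forall (by have := d.lam_add_two_mu_pos; positivity) hB
  have hPu : P ≤ u.h1Norm := by
    refine abs_le_of_sq_le_sq' ?_ u.h1Norm_nonneg |>.2
    rw [hP2]
    have := u.component_sq_le 0
    nlinarith [sq_nonneg ‖u.val 0‖]
  by_contra hlt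
  have h1 : 2 * (d.lam + 2 * d.mu) * P < γ * P := by
    exact mul_lt_mul_of_pos_right (not_le.1 hlt) hPpos
  have hγ : 0 ≤ γ := by have := d.lam_add_two_mu_pos; linarith [not_le.1 hlt]
  have h2 : γ * P ≤ γ * u.h1Norm := by gcongr
  linarith

end InfSup

/-! ## The perturbed problem -/

theorem IsPMLFunction.zeta_im_pos {b δ : ℝ} {ρ : ℝ → ℂ} (h : IsPMLFunction b ρ) (hδ : 0 < δ) :
    0 < (zeta b δ ρ).im := by
  have hi := h.continuous.intervalIntegrable (μ := volume) b (b + δ)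
  have e : (zeta b δ ρ).im = ∫ τ in b..(b + δ), (ρ τ).im :=
    (Complex.imCLM.intervalIntegral_comp_comm hi).symm
  rw [e]
  exact intervalIntegral.intervalIntegral_pos_of_pos_on
    ((Complex.continuous_im.comp h.continuous).intervalIntegrable _ _)
    (fun τ hτ => h.im_pos τ hτ.1) (by linarith)

/-! ### Regularity and Fourier coefficients of the incident wave -/

section IncidentWave

variable (d : WaveData)

theorem hasDerivAt_uInc_left (i : Fin 2) (x y : ℝ) :
    HasDerivAt (fun s => d.uInc i s y)
      (d.uInc i x y * (Complex.I * d.kappa1 * Real.sin d.θ)) x := by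
  have h : HasDerivAt (fun s : ℝ => Complex.I * d.kappa1 *
      (s * Real.sin d.θ - y * Real.cos d.θ : ℂ)) (Complex.I * d.kappa1 * (1 * Real.sin d.θ)) x :=
    (((hasDerivAt_id x).ofReal_comp.mul_const _).sub_const _).const_mul _
  refine (h.cexp.const_mul _).congr_deriv ?_
  rw [WaveData.uInc]; ring

theorem hasDerivAt_uInc_right (i : Fin 2) (x y : ℝ) :
    HasDerivAt (fun t => d.uInc i x t)
      (d.uInc i x y * -(Complex.I * d.kappa1 * Real.cos d.θ)) y := by
  have h : HasDerivAt (fun t : ℝ => Complex.I * d.kappa1 *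
      (x * Real.sin d.θ - t * Real.cos d.θ : ℂ)) (Complex.I * d.kappa1 * -(1 * Real.cos d.θ)) y :=
    (((hasDerivAt_id y).ofReal_comp.mul_const _).const_sub _).const_mul _
  refine (h.cexp.const_mul _).congr_deriv ?_
  rw [WaveData.uInc]; ring

theorem continuous_uInc (i : Fin 2) (y : ℝ) : Continuous fun x => d.uInc i x y :=
  continuous_iff_continuousAt.2 fun x => (hasDerivAt_uInc_left d i x y).continuousAt

theorem continuous_boundaryD_uInc (i : Fin 2) (y : ℝ) :
    Continuous fun x => d.boundaryD d.uInc x y i := by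
  have h0 := continuous_uInc d 0 y
  have h1 := continuous_uInc d 1 y
  simp only [WaveData.boundaryD, (hasDerivAt_uInc_left d _ _ _).deriv,
    (hasDerivAt_uInc_right d _ _ _).deriv]
  fin_cases i
  · simp only [Fin.zero_eta, Matrix.cons_val_zero]; fun_prop
  · simp only [Fin.mk_one, Matrix.cons_val_one, Matrix.cons_val_fin_one]; fun_prop

/-- At fixed height the incident wave is a multiple of e^{iαx}, the mode n = 0. -/
theorem coeff_uInc (i : Fin 2) (y : ℝ) {n : ℤ} (hn : n ≠ 0) :
    d.coeff (fun x => d.uInc i x y) n = 0 := by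
  have h := integral_exp_period d.Lam_pos (k := -n) (neg_ne_zero.2 hn)
  rw [sub_zero] at h
  have e : ∀ x : ℝ, d.uInc i x y * Complex.exp (-(Complex.I * d.alphaN n * x)) =
      d.uInc i 0 y * Complex.exp
        (Complex.I * (((-n : ℤ) * (2 * Real.pi / d.Lam) : ℝ) : ℂ) * x) := fun x => by
    simp only [WaveData.uInc, WaveData.alphaN, WaveData.alpha]
    rw [mul_assoc (_ : ℂ) (Complex.exp _), mul_assoc (_ : ℂ) (Complex.exp _),
      ← Complex.exp_add, ← Complex.exp_add]
    congr 2
    push_cast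
    ring
  rw [WaveData.coeff]
  simp only [e]
  rw [integral_const_mul, h, mul_zero, mul_zero]

theorem weightedSummable_uInc (wt : ℤ → ℝ) (y : ℝ) :
    d.WeightedSummable wt fun i x => d.uInc i x y := by
  refine summable_of_ne_finset_zero (s := {0}) fun n hn => ?_
  have hn0 : n ≠ 0 := by simpa using hn
  simp only [coeff_uInc d _ y hn0, norm_zero, ne_eq, OfNat.ofNat_ne_zero, not_false_eq_true,
    zero_pow, Finset.sum_const_zero, mul_zero]

end IncidentWave

/-! ### The right-hand side as a bounded functional -/

section Load

variable {d : WaveData} {G : Grating d.Lam}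

theorem l2Pair_tr {h : Fin 2 → ℝ → ℂ}
    (hm : ∀ i, MemLp (h i) 2 (volume.restrict (Ioo 0 d.Lam))) (v : V d G) :
    d.l2Pair h v.tr = ∑ i, inner ℂ (v.trace i) ((hm i).toLp (h i)) := by
  have e : ∀ i, (fun x => h i x * conj (v.tr i x)) =ᵐ[volume.restrict (Ioo 0 d.Lam)]
      fun x => inner ℂ (v.trace i x) ((hm i).toLp (h i) x) := fun i => by
    filter_upwards [(hm i).coeFn_toLp] with x hx
    rw [hx]
    rfl
  rw [WaveData.l2Pair, integral_finsetSum _ fun i _ =>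
    (L2.integrable_inner (𝕜 := ℂ) (v.trace i) ((hm i).toLp (h i))).congr (e i).symm]
  refine Finset.sum_congr rfl fun i _ => ?_
  rw [L2.inner_def]
  exact integral_congr_ae (e i)

/-- The load of a first order symbol as a conjugate-linear functional. -/
theorem exists_loadₗ {A : ℤ → Matrix (Fin 2) (Fin 2) ℂ} (hA : FirstOrder d A)
    (G : Grating d.Lam) : ∃ L : V d G →ₗ⋆[ℂ] ℂ, (∀ v, L v = load A v) ∧
      ∃ C, ∀ v, ‖L v‖ ≤ C * v.h1Norm := by
  have hm : ∀ i, MemLp (fun x => d.boundaryD d.uInc x G.b i) 2 (volume.restrict (Ioo 0 d.Lam)) :=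
    fun i => memLp_of_continuous_Ioo (continuous_boundaryD_uInc d i G.b)
  have hs := weightedSummable_uInc d d.weight G.b
  have e : ∀ v : V d G, load A v = (∑ i, inner ℂ (v.trace i) ((hm i).toLp _)) -
      d.symbolPair A (fun i x => d.uInc i x G.b) v.tr := fun v =>
    congrArg (· - d.symbolPair A (fun i x => d.uInc i x G.b) v.tr) (l2Pair_tr hm v)
  have tadd : ∀ (u v : V d G) i, (u + v).trace i = u.trace i + v.trace i := fun _ _ _ => rfl
  have tsmul : ∀ (c : ℂ) (v : V d G) i, (c • v).trace i = c • v.trace i := fun _ _ _ => rfl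
  refine ⟨{ toFun := load A, map_add' := fun u v => ?_, map_smul' := fun c v => ?_ },
    fun v => rfl, ?_⟩
  · simp only [e, tadd, inner_add_left, symbolPair_add_right hA hs, Finset.sum_add_distrib]
    ring
  · simp only [e, tsmul, inner_smul_left, symbolPair_smul_right, ← Finset.mul_sum, smul_eq_mul]
    ring
  · obtain ⟨K, hK, hAK⟩ := hA
    set E := d.energy d.weight fun i x => d.uInc i x G.b
    refine ⟨∑ i, ‖(hm i).toLp _‖ + K * (√E * √2), fun v => ?_⟩
    have h1 : ‖∑ i, inner ℂ (v.trace i) ((hm i).toLp _)‖ ≤ (∑ i, ‖(hm i).toLp _‖) * v.h1Norm := by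
      rw [Finset.sum_mul]
      refine norm_sum_le_of_le _ fun i _ => (norm_inner_le_norm _ _).trans ?_
      rw [mul_comm]
      exact mul_le_mul_of_nonneg_left (v.norm_trace_le i) (norm_nonneg _)
    have h2 := (d.symbolPair_bound hK d.weight_nonneg hAK hs v.energy_tr_le.1).2
    have h3 : √(d.energy d.weight v.tr) ≤ √2 * v.h1Norm := by
      refine (Real.sqrt_le_sqrt v.energy_tr_le.2).trans_eq ?_
      rw [Real.sqrt_mul (by norm_num), Real.sqrt_sq v.h1Norm_nonneg]
    change ‖load A v‖ ≤ _
    rw [e, add_mul]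
    refine (norm_sub_le _ _).trans (add_le_add h1 (h2.trans ?_))
    rw [mul_assoc, mul_assoc]
    gcongr

end Load

/-! ### Stability under bounded perturbations of the symbol -/

section Perturbation

variable {d : WaveData} {G : Grating d.Lam}

theorem WaveData.one_le_weight (d : WaveData) (n : ℤ) : 1 ≤ d.weight n := by
  unfold WaveData.weight; linarith [abs_nonneg (d.alphaN n)]

theorem FirstOrder.of_bounded {A : ℤ → Matrix (Fin 2) (Fin 2) ℂ} {K : ℝ} (hK : 0 ≤ K)
    (hA : ∀ n i j, ‖A n i j‖ ≤ K / 2) : FirstOrder d A :=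
  ⟨K, hK, fun n i j => (hA n i j).trans
    (le_mul_of_one_le_right (by positivity) (d.one_le_weight n))⟩

theorem FirstOrder.sub {A B : ℤ → Matrix (Fin 2) (Fin 2) ℂ} (hA : FirstOrder d A)
    (hB : FirstOrder d B) : FirstOrder d (A - B) := by
  obtain ⟨K, hK, h⟩ := hA
  obtain ⟨K', hK', h'⟩ := hB
  refine ⟨K + K', by positivity, fun n i j => ?_⟩
  refine (norm_sub_le (A n i j) (B n i j)).trans ?_
  linarith [h n i j, h' n i j]

/-- Linearity is stated through coefficients because the incident wave is not given as the trace of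
an element of `V`. -/
theorem symbolPair_sub_left {A : ℤ → Matrix (Fin 2) (Fin 2) ℂ} (hA : FirstOrder d A)
    {g g' g'' h : Fin 2 → ℝ → ℂ} (hc : ∀ j n, d.coeff (g'' j) n = d.coeff (g j) n - d.coeff (g' j) n)
    (hg : d.WeightedSummable d.weight g) (hg' : d.WeightedSummable d.weight g')
    (hh : d.WeightedSummable d.weight h) :
    d.symbolPair A g'' h = d.symbolPair A g h - d.symbolPair A g' h := by
  simp only [WaveData.symbolPair]
  rw [← mul_sub, ← (hA.summable hg hh).tsum_sub (hA.summable hg' hh)]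
  congr 2
  funext n
  simp only [hc, Matrix.mulVec, dotProduct, Fin.sum_univ_two]
  ring

theorem coeff_sub_of_memLp {g h : ℝ → ℂ} (hg : MemLp g 2 (volume.restrict (Ioo 0 d.Lam)))
    (hh : MemLp h 2 (volume.restrict (Ioo 0 d.Lam))) (n : ℤ) :
    d.coeff (fun x => g x - h x) n = d.coeff g n - d.coeff h n := by
  have hi : ∀ {f : ℝ → ℂ}, MemLp f 2 (volume.restrict (Ioo 0 d.Lam)) → Integrable
      (fun x => f x * Complex.exp (-(Complex.I * d.alphaN n * x)))
      (volume.restrict (Ioo 0 d.Lam)) := fun hf =>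
    (hf.integrable (by norm_num)).mul_bdd (c := 1)
      (Continuous.aestronglyMeasurable (by fun_prop))
      (Filter.Eventually.of_forall fun x => (norm_exp_neg_I_mul _ x).le)
  simp only [WaveData.coeff, sub_mul]
  rw [integral_sub (hi hg) (hi hh), mul_sub]

theorem energy_one_eq_l2Norm_sq {g : Fin 2 → ℝ → ℂ}
    (hg : ∀ i, MemLp (g i) 2 (volume.restrict (Ioo 0 d.Lam))) :
    d.WeightedSummable (fun _ => 1) g ∧ d.energy (fun _ => 1) g = d.l2Norm g ^ 2 := by
  have h := hasSum_sum (s := Finset.univ) fun i _ => d.hasSum_coeff (hg i)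
  have h' : HasSum (fun n => 1 * (d.Lam * ∑ j, ‖d.coeff (g j) n‖ ^ 2))
      (∫ x in Ioo 0 d.Lam, ∑ i : Fin 2, ‖g i x‖ ^ 2) := by
    rw [integral_finsetSum _ fun i _ => (hg i).integrable_norm_pow (by norm_num)]
    simpa only [one_mul, Finset.mul_sum] using h
  refine ⟨h'.summable, ?_⟩
  rw [WaveData.energy, h'.tsum_eq, WaveData.l2Norm, Real.sq_sqrt]
  exact integral_nonneg fun x => Finset.sum_nonneg fun i _ => by positivity

theorem l2Norm_nonneg (g : Fin 2 → ℝ → ℂ) : 0 ≤ d.l2Norm g := Real.sqrt_nonneg _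

/-- A bounded symbol pairs `L²(Γ)²` with the traces of `H¹(Ω)²`. -/
theorem norm_symbolPair_le_of_bounded {A : ℤ → Matrix (Fin 2) (Fin 2) ℂ} {K : ℝ} (hK : 0 ≤ K)
    (hA : ∀ n i j, ‖A n i j‖ ≤ K / 2) {g : Fin 2 → ℝ → ℂ} {B : ℝ} (hB : 0 ≤ B)
    (hg : d.WeightedSummable (fun _ => 1) g) (hgB : d.energy (fun _ => 1) g ≤ B ^ 2) (v : V d G) :
    ‖d.symbolPair A g v.tr‖ ≤ K * B * v.h1Norm := by
  refine (d.symbolPair_bound hK (wt := fun _ => 1) (fun _ => zero_le_one)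
    (fun n i j => by simpa using hA n i j) hg v.energy_one_tr_le.1).2.trans ?_
  rw [mul_assoc]
  refine mul_le_mul_of_nonneg_left ?_ hK
  exact mul_le_mul ((Real.sqrt_le_left hB).2 hgB)
    ((Real.sqrt_le_left v.h1Norm_nonneg).2 v.energy_one_tr_le.2)
    (Real.sqrt_nonneg _) hB

theorem norm_form_sub_form_le {A B : ℤ → Matrix (Fin 2) (Fin 2) ℂ} (hA : FirstOrder d A)
    (hB : FirstOrder d B) {K : ℝ} (hK : 0 ≤ K) (h : ∀ n i j, ‖(A n - B n) i j‖ ≤ K / 2)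
    (u v : V d G) : ‖form A u v - form B u v‖ ≤ K * u.h1Norm * v.h1Norm := by
  have e : form A u v - form B u v = -d.symbolPair (A - B) u.tr v.tr := by
    rw [form_eq_tr, form_eq_tr, symbolPair_sub_symbol hA hB u.energy_tr_le.1 v.energy_tr_le.1]
    ring
  rw [e, norm_neg]
  exact norm_symbolPair_le_of_bounded hK h u.h1Norm_nonneg u.energy_one_tr_le.1
    u.energy_one_tr_le.2 v

/-- Existence and uniqueness for a small bounded perturbation of the exact symbol. -/
theorem existsUnique_of_infSup_of_perturbation (hres : d.NonResonant)
    {B : ℤ → Matrix (Fin 2) (Fin 2) ℂ} (hB : FirstOrder d B) {K γ : ℝ} (hK : 0 ≤ K)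
    (h : ∀ n i j, ‖(d.M n - B n) i j‖ ≤ K / 2) (hγ : InfSup G γ) (hKγ : K < γ) :
    ∃! w : V d G, ∀ v, form B w v = load B v := by
  obtain ⟨C, hC⟩ := exists_norm_form_le (firstOrder_M d) G
  obtain ⟨ι, _, ℓ, hℓ, hg⟩ := exists_garding hres G
  obtain ⟨L, hL, hLb⟩ := exists_loadₗ hB G
  have hμ := d.mu_pos
  have key := existsUnique_of_garding_of_infSup (embed d G) embed_injective isComplete_range_embed
    (formₗ (firstOrder_M d) G) (formₗ hB G) (K := C) (η := K) (γ := γ) (c := d.mu / 2)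
    (fun u v => by simpa only [norm_embed, formₗ_apply] using hC u v) hK hKγ
    (fun u v => by
      simpa only [norm_embed, formₗ_apply] using norm_form_sub_form_le (firstOrder_M d) hB hK h u v)
    ℓ (by simpa only [norm_embed] using hℓ) (by positivity)
    (by simpa only [norm_embed, formₗ_apply] using hg)
    (fun u B hB0 hu => by
      rw [norm_embed]
      exact hγ.le_of_forall hB0 fun v => by simpa only [norm_embed, formₗ_apply] using hu v)
    L (by simpa only [norm_embed] using hLb)
  simpa only [formₗ_apply, hL] using key

/-- The error of a bounded perturbation of the exact symbol. -/
theorem norm_form_sub_le {B : ℤ → Matrix (Fin 2) (Fin 2) ℂ} (hB : FirstOrder d B) {K : ℝ}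
    (hK : 0 ≤ K) (h : ∀ n i j, ‖(d.M n - B n) i j‖ ≤ K / 2) {u w : V d G}
    (hu : IsWeakSolution u) (hw : ∀ v : V d G, form B w v = load B v) (v : V d G) :
    ‖form d.M (u - w) v‖ ≤
      K * d.l2Norm (fun i x => w.trace i x - d.uInc i x G.b) * v.h1Norm := by
  have hM := firstOrder_M d
  have hinc := weightedSummable_uInc d d.weight G.b
  have hv := v.energy_tr_le.1
  have mw : ∀ i, MemLp (w.tr i) 2 (volume.restrict (Ioo 0 d.Lam)) := fun i =>
    Lp.memLp (w.trace i)
  have mi : ∀ i, MemLp (fun x => d.uInc i x G.b) 2 (volume.restrict (Ioo 0 d.Lam)) := fun i =>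
    memLp_of_continuous_Ioo (continuous_uInc d i G.b)
  -- The volume parts cancel in a(w, v) - a^PML(w, v), and 𝒟 u_inc cancels between the two loads;
  -- only the difference of the symbols applied to w - u_inc remains.
  have e : form d.M (u - w) v =
      d.symbolPair (d.M - B) (fun i x => w.tr i x - d.uInc i x G.b) v.tr := by
    have e1 : form d.M (u - w) v = form d.M u v - form d.M w v := by
      simp only [← formₗ_apply hM, map_sub, LinearMap.sub_apply]
    have e2 : form d.M w v - form B w v =
        d.symbolPair B w.tr v.tr - d.symbolPair d.M w.tr v.tr := by
      rw [form_eq_tr, form_eq_tr]; ring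
    have e3 : load d.M v - load B v = d.symbolPair B (fun i x => d.uInc i x G.b) v.tr -
        d.symbolPair d.M (fun i x => d.uInc i x G.b) v.tr := by
      unfold load V.tr; ring
    rw [symbolPair_sub_left (hM.sub hB) (fun j n => coeff_sub_of_memLp (mw j) (mi j) n)
      w.energy_tr_le.1 hinc hv, symbolPair_sub_symbol hM hB w.energy_tr_le.1 hv,
      symbolPair_sub_symbol hM hB hinc hv, e1, hu v]
    linear_combination e3 - e2 - hw v
  obtain ⟨hs, hE⟩ := energy_one_eq_l2Norm_sq fun i => (mw i).sub (mi i)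
  rw [e]
  exact norm_symbolPair_le_of_bounded hK h (l2Norm_nonneg _) hs hE.le v

end Perturbation

theorem WaveData.FHat_nonneg (d : WaveData) (hres : d.NonResonant) {z : ℂ}
    (hi : 0 < z.im) : 0 ≤ d.FHat z := by
  have h1 := d.kappa1_pos
  have hF : 0 ≤ d.F z := by
    rw [d.F_eq]
    exact (mul_pos (d.decayMax_pos hres hi) d.factor_pos).le
  unfold WaveData.FHat
  positivity

/-- Since λ + 2μ = ω²/κ₁², both inequalities say the same; the conclusion is the smallness required
by the symbol estimate. -/
theorem WaveData.F_le_of_FHat_le (d : WaveData) {z : ℂ}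
    (h : d.FHat z ≤ 2 * (d.lam + 2 * d.mu)) : d.F z ≤ 2 * d.kappa1 ^ 2 / 17 := by
  have h1 := d.kappa1_pos
  have hω := d.freq_pos
  have hl := d.lam_add_two_mu_pos
  have e : d.lam + 2 * d.mu = d.freq ^ 2 / d.kappa1 ^ 2 := by
    rw [d.kappa1_sq]; field_simp
  rw [e, WaveData.FHat, div_le_iff₀ (by positivity)] at h
  have e2 : 2 * (d.freq ^ 2 / d.kappa1 ^ 2) * d.kappa1 ^ 4 = d.freq ^ 2 * (2 * d.kappa1 ^ 2) := by
    field_simp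
  rw [e2, mul_comm 17, mul_assoc] at h
  have := le_of_mul_le_mul_left h (by positivity)
  linarith

end ElasticPML

end

theorem theorem3p2 (d : ElasticPML.WaveData) (hres : d.NonResonant) :
    (∃ C c : ℝ, 0 < C ∧ 0 < c ∧ ∀ z : ℂ, 1 ≤ z.re → 1 ≤ z.im →
      0 < d.FHat z ∧
        d.FHat z ≤ C * (Real.exp (-(c * z.re)) + Real.exp (-(c * z.im)))) ∧
    ∀ (G : ElasticPML.Grating d.Lam) (δ : ℝ) (ρ : ℝ → ℂ) (γ₁ : ℝ),
      0 < δ → ElasticPML.IsPMLFunction G.b ρ →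
      1 ≤ (ElasticPML.zeta G.b δ ρ).re →
      0 < γ₁ → ElasticPML.InfSup G γ₁ →
      d.FHat (ElasticPML.zeta G.b δ ρ) * G.gamma2 ^ 2 < γ₁ →
      (∃! w : ElasticPML.V d G, ElasticPML.IsPMLSolution (ElasticPML.zeta G.b δ ρ) w) ∧
      ∀ u w : ElasticPML.V d G, ElasticPML.IsWeakSolution u →
        ElasticPML.IsPMLSolution (ElasticPML.zeta G.b δ ρ) w →
        ElasticPML.aNorm (u - w) ≤
          ENNReal.ofReal (d.FHat (ElasticPML.zeta G.b δ ρ) * G.gamma2 *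
            d.l2Norm (fun i x => w.trace i x - d.uInc i x G.b)) := by
  refine ⟨d.FHat_exponential_decay hres, fun G δ ρ γ₁ hδ hρ hr _ hγ hF => ?_⟩
  have hi := hρ.zeta_im_pos hδ
  set z := ElasticPML.zeta G.b δ ρ
  have hF0 := d.FHat_nonneg hres hi
  have h2 : 1 ≤ G.gamma2 := G.one_le_gamma2
  have hFγ : d.FHat z < γ₁ :=
    (le_mul_of_one_le_right hF0 (one_le_pow₀ h2)).trans_lt hF
  -- The chain F̂ < γ₁ ≤ 2(λ+2μ) supplies the smallness of F.
  have hM := d.norm_M_sub_MHat_le hres hr hi (d.F_le_of_FHat_le (hFγ.le.trans hγ.le))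
  -- The growth of M̂ is read off from M̂ = M - (M - M̂), with bounded difference.
  have hB : ElasticPML.FirstOrder d (d.MHat z) := by
    have := (ElasticPML.firstOrder_M d).sub (ElasticPML.FirstOrder.of_bounded
      (A := d.M - d.MHat z) hF0 hM)
    rwa [sub_sub_cancel] at this
  refine ⟨ElasticPML.existsUnique_of_infSup_of_perturbation hres hB hF0 hM hγ hFγ,
    fun u w hu hw => ?_⟩
  refine ElasticPML.aNorm_le (mul_nonneg (mul_nonneg hF0 (by linarith))
    (ElasticPML.l2Norm_nonneg _)) fun v => ?_
  refine (ElasticPML.norm_form_sub_le hB hF0 hM hu hw v).trans ?_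
  refine mul_le_mul_of_nonneg_right ?_ v.h1Norm_nonneg
  exact mul_le_mul_of_nonneg_right (le_mul_of_one_le_right hF0 h2) (ElasticPML.l2Norm_nonneg _)
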